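/- A game graph $(G,w)$ is a finite directed graph $G=(V,E)$ with $V\neq\emptyset$, in which every node has out-degree at least one, whose node set is partitioned as $V=V_A\cup V_B$ (nodes of Alice and of Bob), together with integer edge weights $w$. Let $n=|V|$, $m=|E|$, $W=\max_{(u,v)\in E}|w(u,v)|$. A (positional) strategy $\sigma$ of Alice ($\tau$ of Bob) chooses an out-neighbour of each node in $V_A$ ($V_B$); $G(\sigma,\tau)$ is the subgraph consisting of the chosen edges, and $C_{\sigma,\tau}(s)$ is its unique cycle reachable from the node $s$. Put $e^*_{G(\sigma,\tau),w}(s)=\infty$ if $w(C_{\sigma,\tau}(s))<0$, and otherwise $e^*_{G(\sigma,\tau),w}(s)=\max\{0,-\min_P w(P)\}$, where $P$ ranges over the simple paths of $G(\sigma,\tau)$ that start at $s$. The minimal energy of $s$ is $e^*_{G,w}(s)=\min_\sigma\max_\tau e^*_{G(\sigma,\tau),w}(s)$. A strategy $\tau^*$ of Bob is optimal for $s$ if $e^*_{G(\sigma,\tau^*),w}(s)\ge e^*_{G,w}(s)$ for all $\sigma$. The penalty $P_{G,w}(s)\in[0,\infty]$ is the supremum of all real $D\ge 0$ for which Bob has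 a strategy $\tau^*$, optimal for $s$, such that for every $\sigma$ the cycle $C=C_{\sigma,\tau^*}(s)$ satisfies: if $w(C)<0$ then $w(C)/|C|\le -D$. The penalty of the graph is $P(G,w)=\min_{s\in V} P_{G,w}(s)$ (it is always at least $1/n$). Theorem. There is a single algorithm which, given a game graph $(G,w)$ and a natural number $M$ such that $e^*_{G,w}(v)\le M$ for every node $v$ with $e^*_{G,w}(v)<\infty$, computes $e^*_{G,w}(v)$ for all nodes $v$ in time $$O\!\left(mn\cdot\log\frac{M}{n}\cdot\log\frac{M}{n\lceil P(G,w)\rceil}+m\cdot\frac{M}{\lceil P(G,w)\rceil}\right),$$ where each logarithm (to base 2) is read as the maximum of $1$ and its value, and, if $P(G,w)=\infty$, $M/\lceil P(G,w)\rceil$ is read as $0$ and the second logarithm as $1$. The input consists of $G$, $w$ and $M$ only; the penalty is not given. Moreover, for every polynomial $q$ with coefficients in $\mathbb N$, the same algorithm, run with $M=nW$, computes the minimal energies in time polynomial in $n+m+\log W$ on all game graphs with $W\le q(n)\cdot P(G,w)$. Time is the number of unit-cost steps of a word RAM (memory access, comparison, addition, subtraction, multiplication and integer division of words), in which all numbers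 occurring during the run are bounded in absolute value by a fixed polynomial in $n+W+M$. -/

import Mathlib

open scoped ENNReal NNReal

/-! ### Energy games -/

/-- A game graph: a finite directed graph whose nodes are split between Alice (`alice`) and Bob
(the remaining nodes), and in which every node has an outgoing edge. -/
structure GameGraph (V : Type*) [Fintype V] [DecidableEq V] where
  /-- the nodes that belong to Alice -/
  alice : Finset V
  /-- the edges -/
  edges : Finset (V × V)
  exists_edge : ∀ u, ∃ v, (u, v) ∈ edges

namespace GameGraph

variable {V : Type*} [Fintype V] [DecidableEq V]

/-- A positional strategy of Alice: it picks an out-neighbour of each of her nodes. -/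
def AliceStrategy (G : GameGraph V) : Type _ :=
  (u : {u : V // u ∈ G.alice}) → {v : V // (u.1, v) ∈ G.edges}

/-- A positional strategy of Bob: it picks an out-neighbour of each of his nodes. -/
def BobStrategy (G : GameGraph V) : Type _ :=
  (u : {u : V // u ∉ G.alice}) → {v : V // (u.1, v) ∈ G.edges}

/-- The graph `G(σ, τ)`, in which every node `u` has the unique out-edge `(u, G.next σ τ u)`. -/
def next (G : GameGraph V) (σ : G.AliceStrategy) (τ : G.BobStrategy) (u : V) : V :=
  if h : u ∈ G.alice then (σ ⟨u, h⟩).1 else (τ ⟨u, h⟩).1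

/-- The largest absolute value `W` of the weight of an edge. -/
def maxWeight (G : GameGraph V) (w : V → V → ℤ) : ℕ :=
  G.edges.sup fun p => (w p.1 p.2).natAbs

end GameGraph

section Play

variable {V : Type*} [Fintype V] [DecidableEq V]

/-- In the graph with the edges `(u, f u)`: the weight of the path of length `i` from `s`. -/
def pathWeight (f : V → V) (w : V → V → ℤ) (s : V) (i : ℕ) : ℤ :=
  ∑ j ∈ Finset.range i, w (f^[j] s) (f^[j + 1] s)

/-- In the graph with the edges `(u, f u)`: the path of length `i` from `s` is simple. -/
def IsSimplePath (f : V → V) (s : V) (i : ℕ) : Prop :=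
  Set.InjOn (fun j => f^[j] s) (Set.Iic i)

open Classical in
/-- In the graph with the edges `(u, f u)`: the nodes of the unique cycle reachable from `s`. -/
noncomputable def cycleNodes (f : V → V) (s : V) : Finset V :=
  Finset.univ.filter fun u => u ∈ Function.periodicPts f ∧ ∃ i : ℕ, f^[i] s = u

/-- In the graph with the edges `(u, f u)`: the weight of the unique cycle reachable from `s`. -/
noncomputable def cycleWeight (f : V → V) (w : V → V → ℤ) (s : V) : ℤ :=
  ∑ u ∈ cycleNodes f s, w u (f u)

open Classical in
/-- The minimal sufficient energy at `s` in the graph with the edges `(u, f u)`: it is `∞` if the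
cycle reachable from `s` is negative, and otherwise the maximum of `0` and all `-w(P)`, for `P` a
simple path from `s` (`Int.toNat` is the positive part). -/
noncomputable def playEnergy (f : V → V) (w : V → V → ℤ) (s : V) : ℕ∞ :=
  if cycleWeight f w s < 0 then ⊤
  else ⨆ (i : ℕ) (_ : IsSimplePath f s i), ((-pathWeight f w s i).toNat : ℕ∞)

end Play

namespace GameGraph

variable {V : Type*} [Fintype V] [DecidableEq V]

/-- The minimal sufficient energy at `s`: the minimum over the strategies of Alice of the maximum
over the strategies of Bob. -/
noncomputable def minEnergy (G : GameGraph V) (w : V → V → ℤ) (s : V) : ℕ∞ :=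
  ⨅ σ : G.AliceStrategy, ⨆ τ : G.BobStrategy, playEnergy (G.next σ τ) w s

/-- `M` is an upper bound on the finite minimal energy. -/
def IsEnergyBound (G : GameGraph V) (w : V → V → ℤ) (M : ℕ) : Prop :=
  ∀ v, G.minEnergy w v < ⊤ → G.minEnergy w v ≤ (M : ℕ∞)

/-- `τ` is an optimal strategy of Bob for the starting node `s`. -/
def IsOptimalForBob (G : GameGraph V) (w : V → V → ℤ) (s : V) (τ : G.BobStrategy) : Prop :=
  ∀ σ : G.AliceStrategy, G.minEnergy w s ≤ playEnergy (G.next σ τ) w s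

/-- The node `s` has a penalty of at least `D`: Bob has an optimal strategy such that, whatever
Alice does, the cycle that is reached from `s` has, if it is negative, average weight at most
`-D`. -/
def HasPenaltyAtLeast (G : GameGraph V) (w : V → V → ℤ) (s : V) (D : ℝ≥0) : Prop :=
  ∃ τ : G.BobStrategy, G.IsOptimalForBob w s τ ∧
    ∀ σ : G.AliceStrategy, cycleWeight (G.next σ τ) w s < 0 →
      (cycleWeight (G.next σ τ) w s : ℝ) / ((cycleNodes (G.next σ τ) s).card : ℝ) ≤ -(D : ℝ)

/-- The penalty of the node `s`, possibly `∞`. -/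
noncomputable def nodePenalty (G : GameGraph V) (w : V → V → ℤ) (s : V) : ℝ≥0∞ :=
  ⨆ (D : ℝ≥0) (_ : G.HasPenaltyAtLeast w s D), (D : ℝ≥0∞)

/-- The penalty of the weighted graph: the minimum of the penalties of its nodes. -/
noncomputable def penalty (G : GameGraph V) (w : V → V → ℤ) : ℝ≥0∞ :=
  ⨅ s, G.nodePenalty w s

end GameGraph

/-! ### A word RAM with a step count

Programs are while-programs that work on integer registers and integer arrays with random access.
A program is a fixed finite text, so it names finitely many registers and arrays. All numbers have
to fit into a machine word: a run in which some number exceeds the bound `B` in absolute value gets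
stuck. Every evaluation of a constant, variable, array cell, arithmetic operation or test and every
assignment costs one step. -/

/-- The memory: the registers and the arrays. -/
structure RamState where
  reg : ℕ → ℤ
  arr : ℕ → ℕ → ℤ

/-- Arithmetic expressions: `get a i` is the cell of the array `a` at the index `i`. -/
inductive RamExpr where
  | const (z : ℤ)
  | var (x : ℕ)
  | get (a : ℕ) (i : RamExpr)
  | add (e₁ e₂ : RamExpr)
  | sub (e₁ e₂ : RamExpr)
  | mul (e₁ e₂ : RamExpr)
  | div (e₁ e₂ : RamExpr)

/-- The number `z`, if it fits into a word. -/
def fitWord (B : ℕ) (z : ℤ) : Option ℤ :=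
  if z.natAbs ≤ B then some z else none

namespace RamExpr

/-- The number of steps needed to evaluate an expression. -/
def cost : RamExpr → ℕ
  | const _ => 1
  | var _ => 1
  | get _ i => i.cost + 1
  | add e₁ e₂ => e₁.cost + e₂.cost + 1
  | sub e₁ e₂ => e₁.cost + e₂.cost + 1
  | mul e₁ e₂ => e₁.cost + e₂.cost + 1
  | div e₁ e₂ => e₁.cost + e₂.cost + 1

/-- The value of an expression. It is undefined for a number that does not fit into a word, a
negative array index and a division by zero. Division is integer division with a non-negative
remainder. -/
def eval (B : ℕ) (s : RamState) : RamExpr → Option ℤ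
  | const z => fitWord B z
  | var x => fitWord B (s.reg x)
  | get a i => (i.eval B s).bind fun k => if 0 ≤ k then fitWord B (s.arr a k.toNat) else none
  | add e₁ e₂ => (e₁.eval B s).bind fun x => (e₂.eval B s).bind fun y => fitWord B (x + y)
  | sub e₁ e₂ => (e₁.eval B s).bind fun x => (e₂.eval B s).bind fun y => fitWord B (x - y)
  | mul e₁ e₂ => (e₁.eval B s).bind fun x => (e₂.eval B s).bind fun y => fitWord B (x * y)
  | div e₁ e₂ => (e₁.eval B s).bind fun x => (e₂.eval B s).bind fun y =>
      if y = 0 then none else fitWord B (x / y)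

end RamExpr

/-- Tests. -/
inductive RamTest where
  | le (e₁ e₂ : RamExpr)
  | lt (e₁ e₂ : RamExpr)
  | eq (e₁ e₂ : RamExpr)

namespace RamTest

/-- The number of steps needed to evaluate a test. -/
def cost : RamTest → ℕ
  | le e₁ e₂ => e₁.cost + e₂.cost + 1
  | lt e₁ e₂ => e₁.cost + e₂.cost + 1
  | eq e₁ e₂ => e₁.cost + e₂.cost + 1

/-- The outcome of a test. -/
def eval (B : ℕ) (s : RamState) : RamTest → Option Bool
  | le e₁ e₂ => (e₁.eval B s).bind fun x => (e₂.eval B s).bind fun y => some (decide (x ≤ y))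
  | lt e₁ e₂ => (e₁.eval B s).bind fun x => (e₂.eval B s).bind fun y => some (decide (x < y))
  | eq e₁ e₂ => (e₁.eval B s).bind fun x => (e₂.eval B s).bind fun y => some (decide (x = y))

end RamTest

/-- Programs. -/
inductive RamProgram where
  | skip
  | set (x : ℕ) (e : RamExpr)
  | put (a : ℕ) (i e : RamExpr)
  | seq (c₁ c₂ : RamProgram)
  | ite (b : RamTest) (c₁ c₂ : RamProgram)
  | loop (b : RamTest) (c : RamProgram)

/-- `Runs B c s t s'`: started in the state `s`, the program `c` halts in the state `s'` after
exactly `t` steps, and all numbers in its run are at most `B` in absolute value. -/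
inductive Runs (B : ℕ) : RamProgram → RamState → ℕ → RamState → Prop where
  | skip (s : RamState) : Runs B .skip s 1 s
  | set (s : RamState) (x : ℕ) (e : RamExpr) (z : ℤ) (he : e.eval B s = some z) :
      Runs B (.set x e) s (e.cost + 1) { s with reg := Function.update s.reg x z }
  | put (s : RamState) (a : ℕ) (i e : RamExpr) (k : ℕ) (z : ℤ)
      (hi : i.eval B s = some (k : ℤ)) (he : e.eval B s = some z) :
      Runs B (.put a i e) s (i.cost + e.cost + 1)
        { s with arr := Function.update s.arr a (Function.update (s.arr a) k z) }
  | seq (c₁ c₂ : RamProgram) (s₀ s₁ s₂ : RamState) (t₁ t₂ : ℕ)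
      (h₁ : Runs B c₁ s₀ t₁ s₁) (h₂ : Runs B c₂ s₁ t₂ s₂) :
      Runs B (.seq c₁ c₂) s₀ (t₁ + t₂) s₂
  | iteTrue (b : RamTest) (c₁ c₂ : RamProgram) (s s' : RamState) (t : ℕ)
      (hb : b.eval B s = some true) (h : Runs B c₁ s t s') :
      Runs B (.ite b c₁ c₂) s (b.cost + t) s'
  | iteFalse (b : RamTest) (c₁ c₂ : RamProgram) (s s' : RamState) (t : ℕ)
      (hb : b.eval B s = some false) (h : Runs B c₂ s t s') :
      Runs B (.ite b c₁ c₂) s (b.cost + t) s'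
  | loopTrue (b : RamTest) (c : RamProgram) (s₀ s₁ s₂ : RamState) (t₁ t₂ : ℕ)
      (hb : b.eval B s₀ = some true) (h₁ : Runs B c s₀ t₁ s₁)
      (h₂ : Runs B (.loop b c) s₁ t₂ s₂) :
      Runs B (.loop b c) s₀ (b.cost + t₁ + t₂) s₂
  | loopFalse (b : RamTest) (c : RamProgram) (s : RamState) (hb : b.eval B s = some false) :
      Runs B (.loop b c) s b.cost s

/-! ### The computational problem -/

/-- `es` lists the edges of `G`, each of them once, in some order. -/
def IsEdgeList {n : ℕ} (G : GameGraph (Fin n)) (es : List (Fin n × Fin n)) : Prop :=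
  es.Nodup ∧ ∀ p, p ∈ es ↔ p ∈ G.edges

/-- The input: the registers `0`, `1`, `2` hold the number of nodes, the number of edges and `M`;
the array `0` tells which nodes belong to Alice; the arrays `1`, `2`, `3` hold the start nodes, the
end nodes and the weights of the edges. All other cells are `0`. -/
def inputState {n : ℕ} (G : GameGraph (Fin n)) (w : Fin n → Fin n → ℤ)
    (es : List (Fin n × Fin n)) (M : ℕ) : RamState where
  reg x := match x with
    | 0 => (n : ℤ)
    | 1 => (es.length : ℤ)
    | 2 => (M : ℤ)
    | _ => 0
  arr a i := match a with
    | 0 => if h : i < n then (if (⟨i, h⟩ : Fin n) ∈ G.alice then 1 else 0) else 0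
    | 1 => if h : i < es.length then ((es[i].1 : ℕ) : ℤ) else 0
    | 2 => if h : i < es.length then ((es[i].2 : ℕ) : ℤ) else 0
    | 3 => if h : i < es.length then w es[i].1 es[i].2 else 0
    | _ => 0

/-- The integer that represents an energy in the output: `∞` is represented by `-1`. -/
def energyCode : ℕ∞ → ℤ
  | ⊤ => -1
  | (k : ℕ) => (k : ℤ)

/-- Given `(G, w)` and `M`, with word bound `B`, the program `c` halts after at most `T` steps, and
then the cell `v` of the array `4` holds the minimal energy of the node `v`. -/
def ComputesEnergies {n : ℕ} (c : RamProgram) (B : ℕ) (G : GameGraph (Fin n))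
    (w : Fin n → Fin n → ℤ) (es : List (Fin n × Fin n)) (M : ℕ) (T : ℝ) : Prop :=
  ∃ (t : ℕ) (s : RamState), Runs B c (inputState G w es M) t s ∧ (t : ℝ) ≤ T ∧
    ∀ v : Fin n, s.arr 4 v = energyCode (G.minEnergy w v)

/-- The logarithm as it is read in a running time: at least `1`. -/
noncomputable def timeLog (x : ℝ) : ℝ :=
  max 1 (Real.logb 2 x)

/-- `m n log(M/n) log(M/(n⌈P⌉)) + m M/⌈P⌉`, where a division by `⌈P⌉ = ∞` gives `0`. -/
noncomputable def energyTime (n m M : ℕ) (P : ℝ≥0∞) : ℝ :=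
  m * n * timeLog ((M : ℝ) / n) *
      timeLog ((M : ℝ≥0∞) / (n * ((ENat.ceil P : ℕ∞) : ℝ≥0∞))).toReal +
    m * ((M : ℝ≥0∞) / ((ENat.ceil P : ℕ∞) : ℝ≥0∞)).toReal

/-! Energies as least solutions. Call `f : V → ℕ∞` feasible if `f v ≤ f u + w u v`, for finite `f
u`, holds on all of Bob's edges and on at least one edge out of each node of Alice. Telescoping
along a play shows that Alice can keep the energy below any feasible `f`. Conversely, Bob has one
positional strategy that forces at least the least feasible function from every node
(`exists_leastFeasible_le_playEnergy`, by induction on the number of edges). Hence the minimal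
energy is the least feasible function (`minEnergy_eq_leastFeasible`), and it can be computed by
lifting values from below until no constraint is violated.

Scaling. Measure in units of `b`, weights rounded up and energies rounded down. The rounded minimal
energy is feasible for the rounded weights, so lifting in the rounded game stays below it. If `b ≤
⌈P⌉`, so that `P > b - 1`, the converse holds up to a small error: a feasible `f` of the rounded
game satisfies `e* ≤ b f + n (b - 1)` (`minEnergy_le_of_feasible_ceilWeight`). Indeed, let Alice
follow `f` against Bob's penalty strategy. The cycle reached is nonnegative after rounding, so its
average weight is at least `-(b - 1)`, which the penalty forbids for a negative cycle; along a
simple path rounding loses at most `b - 1` per edge. So when the units are halved, the doubled old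
values are lower bounds that are at most `2n` units too small, and a worklist run repairs them in
`O(mn)` steps.

Guessing the penalty. The guesses are `2 ^ k`, from about `M / n` downwards. The first phase has
units `2 ^ k` and costs `O(m (M / 2 ^ k + 1))`; values beyond `M / 2 ^ k` may safely become `∞`.
Each later phase halves the units and lets a value grow by `2n` at most; a node that exceeds its cap
becomes `∞` and a flag is set. If the flag is never set, the final values are feasible in units of
`1` and below the truth, hence exact, whether or not the guess was right. If `2 ^ k ≤ ⌈P⌉`, the flag
is never set. Since `⌈P⌉ ≥ 1`, the guess `1` succeeds at the latest; the costs `m M / 2 ^ k` form a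
geometric series, and the phases contribute `mn` times the number of phases per guess times the
number of guesses.

The machine part refines this to a concrete program: an abstract worklist run with a potential that
drops in every step (`wp_liftStep`), and time bounds for nested loops by variants. -/

set_option linter.unusedSimpArgs false

/-! ### Walks and cycles in a graph with out-degree one -/

section Walks

set_option linter.unusedSectionVars false

variable {V : Type*} [Fintype V] [DecidableEq V]

theorem pathWeight_zero (f : V → V) (w : V → V → ℤ) (s : V) : pathWeight f w s 0 = 0 := by
  simp [pathWeight]

theorem pathWeight_succ (f : V → V) (w : V → V → ℤ) (s : V) (i : ℕ) :
    pathWeight f w s (i + 1) = pathWeight f w s i + w (f^[i] s) (f (f^[i] s)) := by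
  simp [pathWeight, Finset.sum_range_succ, Function.iterate_succ_apply']

theorem pathWeight_add (f : V → V) (w : V → V → ℤ) (s : V) (i j : ℕ) :
    pathWeight f w s (i + j) = pathWeight f w s i + pathWeight f w (f^[i] s) j := by
  induction j with
  | zero => simp [pathWeight_zero]
  | succ j ih =>
    rw [← Nat.add_assoc, pathWeight_succ, pathWeight_succ, ih, ← Function.iterate_add_apply,
      Nat.add_comm j i]
    ring

theorem pathWeight_succ_left (f : V → V) (w : V → V → ℤ) (s : V) (i : ℕ) :
    pathWeight f w s (i + 1) = w s (f s) + pathWeight f w (f s) i := by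
  rw [Nat.add_comm, pathWeight_add]
  simp [pathWeight]

theorem pathWeight_mul_of_isPeriodicPt (f : V → V) (w : V → V → ℤ) {c : V} {p : ℕ}
    (h : Function.IsPeriodicPt f p c) (q : ℕ) :
    pathWeight f w c (p * q) = q * pathWeight f w c p := by
  induction q with
  | zero => simp [pathWeight_zero]
  | succ q ih =>
    rw [Nat.mul_succ, pathWeight_add, ih, (h.mul_const q).eq]
    push_cast
    ring

theorem exists_iterate_mem_periodicPts (f : V → V) (s : V) :
    ∃ k, f^[k] s ∈ Function.periodicPts f := by
  obtain ⟨i, j, hij, h⟩ := Finite.exists_ne_map_eq_of_infinite (fun k : ℕ => f^[k] s)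
  wlog hlt : i < j generalizing i j
  · exact this j i hij.symm h.symm (lt_of_le_of_ne (not_lt.mp hlt) hij.symm)
  refine ⟨i, j - i, Nat.sub_pos_of_lt hlt, ?_⟩
  rw [Function.IsPeriodicPt, Function.IsFixedPt, ← Function.iterate_add_apply,
    Nat.sub_add_cancel hlt.le, h]

/-- Only one cycle is reachable, so once the walk is on it, one period enumerates it. This turns
sums over the node set into path weights. -/
theorem cycleNodes_eq_image (f : V → V) {s : V} {k : ℕ}
    (hc : f^[k] s ∈ Function.periodicPts f) :
    cycleNodes f s = (Finset.range (Function.minimalPeriod f (f^[k] s))).image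
      fun j => f^[j] (f^[k] s) := by
  have hpos := Function.minimalPeriod_pos_of_mem_periodicPts hc
  ext u
  simp only [cycleNodes, Finset.mem_filter, Finset.mem_univ, true_and, Finset.mem_image,
    Finset.mem_range]
  constructor
  · rintro ⟨⟨q, hq, hqu⟩, i, rfl⟩
    have key : ∃ l, f^[l] (f^[k] s) = f^[i] s := by
      -- From `f^[i] s`, which has period `q`, another `q * k ≥ k` steps return to it; the first `k`
      -- steps of that walk lead to `f^[k] s`.
      refine ⟨q * k + i - k, ?_⟩
      rw [← Function.iterate_add_apply]
      have : k ≤ q * k := Nat.le_mul_of_pos_left k hq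
      rw [Nat.sub_add_cancel (by omega), Function.iterate_add_apply]
      exact (hqu.mul_const k).eq
    obtain ⟨l, hl⟩ := key
    exact ⟨l % _, Nat.mod_lt _ hpos, by rw [Function.iterate_mod_minimalPeriod_eq, hl]⟩
  · rintro ⟨j, -, rfl⟩
    refine ⟨?_, j + k, Function.iterate_add_apply ..⟩
    obtain ⟨q, hq, hqc⟩ := hc
    exact ⟨q, hq, hqc.apply_iterate j⟩

theorem injOn_iterate_minimalPeriod (f : V → V) (c : V) :
    Set.InjOn (fun j => f^[j] c) (Finset.range (Function.minimalPeriod f c)) := by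
  intro i hi j hj h
  simp only [Finset.coe_range, Set.mem_Iio] at hi hj
  exact (Function.iterate_eq_iterate_iff_of_lt_minimalPeriod hi hj).mp h

theorem cycleWeight_eq_pathWeight (f : V → V) (w : V → V → ℤ) {s : V} {k : ℕ}
    (hc : f^[k] s ∈ Function.periodicPts f) :
    cycleWeight f w s =
      pathWeight f w (f^[k] s) (Function.minimalPeriod f (f^[k] s)) := by
  rw [cycleWeight, cycleNodes_eq_image f hc, Finset.sum_image (injOn_iterate_minimalPeriod f _)]
  simp [pathWeight, Function.iterate_succ_apply']

theorem card_cycleNodes (f : V → V) {s : V} {k : ℕ} (hc : f^[k] s ∈ Function.periodicPts f) :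
    (cycleNodes f s).card = Function.minimalPeriod f (f^[k] s) := by
  rw [cycleNodes_eq_image f hc, Finset.card_image_of_injOn (injOn_iterate_minimalPeriod f _),
    Finset.card_range]

theorem cycleNodes_apply (f : V → V) (s : V) : cycleNodes f (f s) = cycleNodes f s := by
  obtain ⟨k, hk⟩ := exists_iterate_mem_periodicPts f s
  have h1 : f^[k + 1] s ∈ Function.periodicPts f := by
    obtain ⟨q, hq, hqc⟩ := hk
    exact ⟨q, hq, by rw [Function.iterate_succ_apply']; exact hqc.apply_iterate 1⟩
  rw [cycleNodes_eq_image f (k := k) (s := f s) (by rwa [← Function.iterate_succ_apply]),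
    cycleNodes_eq_image f h1, Function.iterate_succ_apply]

theorem cycleWeight_apply (f : V → V) (w : V → V → ℤ) (s : V) :
    cycleWeight f w (f s) = cycleWeight f w s := by
  simp [cycleWeight, cycleNodes_apply]

/-- A closed walk runs around the unique cycle a whole number of times. -/
theorem pathWeight_nonneg_of_isPeriodicPt (f : V → V) (w : V → V → ℤ) {s : V}
    (hw : 0 ≤ cycleWeight f w s) {i l : ℕ} (hl : 0 < l)
    (h : Function.IsPeriodicPt f l (f^[i] s)) : 0 ≤ pathWeight f w (f^[i] s) l := by
  obtain ⟨q, rfl⟩ := h.minimalPeriod_dvd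
  rw [pathWeight_mul_of_isPeriodicPt f w (Function.isPeriodicPt_minimalPeriod f _),
    ← cycleWeight_eq_pathWeight f w ⟨_, hl, h⟩]
  positivity

/-- Cutting out a closed subwalk does not increase the weight, because closed walks have nonnegative
weight; induct on the length. -/
theorem exists_isSimplePath_pathWeight_le (f : V → V) (w : V → V → ℤ) {s : V}
    (hw : 0 ≤ cycleWeight f w s) (i : ℕ) :
    ∃ j, IsSimplePath f s j ∧ pathWeight f w s j ≤ pathWeight f w s i := by
  induction i using Nat.strong_induction_on with
  | _ i ih =>
    by_cases hs : IsSimplePath f s i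
    · exact ⟨i, hs, le_rfl⟩
    · have : ∃ j k, j < k ∧ k ≤ i ∧ f^[j] s = f^[k] s := by
        simp only [IsSimplePath, Set.InjOn, not_forall] at hs
        obtain ⟨j, hj, k, hk, h, hne⟩ := hs
        rcases lt_or_gt_of_ne hne with hlt | hlt
        · exact ⟨j, k, hlt, hk, h⟩
        · exact ⟨k, j, hlt, hj, h.symm⟩
      obtain ⟨j, k, hjk, hki, h⟩ := this
      obtain ⟨l, rfl⟩ := Nat.exists_eq_add_of_lt hjk
      obtain ⟨r, rfl⟩ := Nat.exists_eq_add_of_le hki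
      have hper : Function.IsPeriodicPt f (l + 1) (f^[j] s) := by
        rw [Function.IsPeriodicPt, Function.IsFixedPt, ← Function.iterate_add_apply, h,
          Nat.add_comm, Nat.add_assoc]
      obtain ⟨j', hj', hle⟩ := ih (j + r) (by omega)
      refine ⟨j', hj', hle.trans ?_⟩
      have h0 := pathWeight_nonneg_of_isPeriodicPt f w hw (Nat.succ_pos l) hper
      rw [Nat.add_assoc j l 1, pathWeight_add f w s (j + (l + 1)), pathWeight_add f w s j (l + 1),
        pathWeight_add f w s j r]
      rw [Nat.add_assoc] at h
      rw [← h]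
      linarith [h0]

/-- Replacing simple paths by arbitrary walks makes the condition compatible with moving the start
along an edge. -/
theorem playEnergy_le_iff {f : V → V} {w : V → V → ℤ} {s : V} (hw : 0 ≤ cycleWeight f w s)
    (a : ℕ) : playEnergy f w s ≤ a ↔ ∀ i, 0 ≤ a + pathWeight f w s i := by
  rw [playEnergy, if_neg (not_lt.mpr hw)]
  simp only [iSup_le_iff, Nat.cast_le]
  constructor
  · intro h i
    obtain ⟨j, hj, hle⟩ := exists_isSimplePath_pathWeight_le f w hw i
    have := h j hj
    omega
  · intro h i _
    have := h i
    omega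

theorem isSimplePath_lt_card {f : V → V} {s : V} {i : ℕ} (h : IsSimplePath f s i) :
    i < Fintype.card V := by
  have := Finset.card_le_card_of_injOn (s := Finset.range (i + 1)) (t := Finset.univ)
    (fun j => f^[j] s) (by simp) (fun a ha b hb hab => h (by simpa [Nat.lt_succ_iff] using ha)
      (by simpa [Nat.lt_succ_iff] using hb) hab)
  simpa [Nat.succ_le_iff] using this

theorem playEnergy_eq_top_of_neg {f : V → V} {w : V → V → ℤ} {s : V}
    (hw : cycleWeight f w s < 0) : playEnergy f w s = ⊤ := if_pos hw

theorem cycleWeight_nonneg_of_lt_top {f : V → V} {w : V → V → ℤ} {s : V}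
    (h : playEnergy f w s ≠ ⊤) : 0 ≤ cycleWeight f w s :=
  not_lt.mp fun hw => h (playEnergy_eq_top_of_neg hw)

end Walks

/-! ### Feasible functions and positional determinacy -/

/-- The edge from `u` to `v` does not force the value of `u` to be larger than `f u`. -/
def EdgeOk {V : Type*} (w : V → V → ℤ) (f : V → ℕ∞) (u v : V) : Prop :=
  ∀ a : ℕ, f u = a → ∃ b : ℕ, f v = b ∧ (b : ℤ) ≤ a + w u v

section Feasible

variable {V : Type*}

/-- The monotonicity behind everything that follows: a constraint survives an increase at its source
and a decrease at its target. -/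
theorem EdgeOk.of_le {w : V → V → ℤ} {f g : V → ℕ∞} {u v : V} (h : EdgeOk w f u v)
    (hu : f u ≤ g u) (hv : g v ≤ f v) : EdgeOk w g u v := by
  intro a ha
  rw [ha] at hu
  obtain ⟨a', ha', hle⟩ := ENat.le_natCast_iff.mp hu
  obtain ⟨b, hb, hba⟩ := h a' ha'
  rw [hb] at hv
  obtain ⟨b', hb', hle'⟩ := ENat.le_natCast_iff.mp hv
  exact ⟨b', hb', by omega⟩

theorem EdgeOk.of_top {w : V → V → ℤ} {f : V → ℕ∞} {u v : V} (h : f u = ⊤) :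
    EdgeOk w f u v := by
  intro a ha
  simp [h] at ha

variable [Fintype V] [DecidableEq V]

theorem edgeOk_playEnergy (f : V → V) (w : V → V → ℤ) (s : V) :
    EdgeOk w (playEnergy f w) s (f s) := by
  intro a ha
  have hw := cycleWeight_nonneg_of_lt_top (f := f) (w := w) (s := s) (by simp [ha])
  have h := (playEnergy_le_iff hw a).mp ha.le
  have h1 := h 1
  rw [pathWeight_succ_left, pathWeight_zero] at h1
  have hle : playEnergy f w (f s) ≤ ((a + w s (f s)).toNat : ℕ) := by
    rw [playEnergy_le_iff (by rwa [cycleWeight_apply])]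
    intro i
    have := h (i + 1)
    rw [pathWeight_succ_left] at this
    omega
  obtain ⟨b, hb, hba⟩ := ENat.le_natCast_iff.mp hle
  exact ⟨b, hb, by omega⟩

theorem EdgeOk.iterate {f : V → V} {w : V → V → ℤ} {g : V → ℕ∞}
    (h : ∀ u, EdgeOk w g u (f u)) {s : V} {a : ℕ} (ha : g s = a) (i : ℕ) :
    ∃ b : ℕ, g (f^[i] s) = b ∧ (b : ℤ) ≤ a + pathWeight f w s i := by
  induction i with
  | zero => exact ⟨a, ha, by simp [pathWeight_zero]⟩
  | succ i ih =>
    obtain ⟨b, hb, hba⟩ := ih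
    obtain ⟨b', hb', hle⟩ := h _ b hb
    exact ⟨b', by rwa [Function.iterate_succ_apply'], by rw [pathWeight_succ]; omega⟩

/-- One turn around the cycle returns to the same finite value, and the constraints telescope. -/
theorem cycleWeight_nonneg_of_edgeOk {f : V → V} {w : V → V → ℤ} {g : V → ℕ∞}
    (h : ∀ u, EdgeOk w g u (f u)) {s : V} {a : ℕ} (ha : g s = a) : 0 ≤ cycleWeight f w s := by
  obtain ⟨k, hk⟩ := exists_iterate_mem_periodicPts f s
  obtain ⟨b, hb, -⟩ := EdgeOk.iterate h ha k
  obtain ⟨b', hb', hle⟩ := EdgeOk.iterate h hb (Function.minimalPeriod f (f^[k] s))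
  rw [Function.iterate_minimalPeriod, hb, Nat.cast_inj] at hb'
  rw [cycleWeight_eq_pathWeight f w hk]
  omega

theorem playEnergy_le_of_edgeOk {f : V → V} {w : V → V → ℤ} {g : V → ℕ∞}
    (h : ∀ u, EdgeOk w g u (f u)) (s : V) : playEnergy f w s ≤ g s := by
  cases ha : g s with
  | top => exact le_top
  | coe a =>
    rw [playEnergy_le_iff (cycleWeight_nonneg_of_edgeOk h ha)]
    intro i
    obtain ⟨b, -, hb⟩ := EdgeOk.iterate h ha i
    omega

/-- `f` is a pre-fixed point of the lifting operator of value iteration. -/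
def GameGraph.Feasible (G : GameGraph V) (w : V → V → ℤ) (f : V → ℕ∞) : Prop :=
  (∀ u ∈ G.alice, ∃ v, (u, v) ∈ G.edges ∧ EdgeOk w f u v) ∧
    ∀ u ∉ G.alice, ∀ v, (u, v) ∈ G.edges → EdgeOk w f u v

/-- The least pre-fixed point of the lifting operator. -/
noncomputable def GameGraph.leastFeasible (G : GameGraph V) (w : V → V → ℤ) (u : V) : ℕ∞ :=
  sInf {x | ∃ f, G.Feasible w f ∧ f u = x}

namespace GameGraph

theorem feasible_top (G : GameGraph V) (w : V → V → ℤ) : G.Feasible w fun _ => ⊤ :=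
  ⟨fun u _ => (G.exists_edge u).imp fun _ hv => ⟨hv, .of_top rfl⟩, fun _ _ _ _ => .of_top rfl⟩

theorem leastFeasible_le {G : GameGraph V} {w : V → V → ℤ} {f : V → ℕ∞} (h : G.Feasible w f)
    (u : V) : G.leastFeasible w u ≤ f u :=
  sInf_le ⟨f, h, rfl⟩

/-- Infima in `ℕ∞` are attained. At `u` borrow the constraint from a feasible function that attains
the infimum there; passing to the pointwise infimum only lowers the targets. -/
theorem feasible_leastFeasible (G : GameGraph V) (w : V → V → ℤ) :
    G.Feasible w (G.leastFeasible w) := by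
  have key : ∀ u, ∃ f, G.Feasible w f ∧ f u = G.leastFeasible w u := fun u =>
    csInf_mem (s := {x | ∃ f, G.Feasible w f ∧ f u = x}) ⟨⊤, _, G.feasible_top w, rfl⟩
  refine ⟨fun u hu => ?_, fun u hu v hv => ?_⟩
  · obtain ⟨f, hf, hfu⟩ := key u
    obtain ⟨v, hv, hok⟩ := hf.1 u hu
    exact ⟨v, hv, hok.of_le hfu.le (leastFeasible_le hf v)⟩
  · obtain ⟨f, hf, hfu⟩ := key u
    exact (hf.2 u hu v hv).of_le hfu.le (leastFeasible_le hf v)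

/-- The graph without the edge from `u` to `v`, where `u` keeps another edge. -/
def eraseEdge (G : GameGraph V) (u v v' : V) (hv' : (u, v') ∈ G.edges) (hne : v' ≠ v) :
    GameGraph V where
  alice := G.alice
  edges := G.edges.erase (u, v)
  exists_edge x := by
    by_cases hx : x = u
    · exact ⟨v', by simp [hx, hv', hne]⟩
    · obtain ⟨y, hy⟩ := G.exists_edge x
      exact ⟨y, by simp [hx, hy]⟩

/-- Adding a constant preserves each constraint, and so does a minimum, each node using whichever
function is smaller. The shift makes both functions agree at `u`, so there the constraints of `f`
suffice and `g` may violate its own. -/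
theorem feasible_min_add {G : GameGraph V} {w : V → V → ℤ} {f g : V → ℕ∞} {u : V} {k a : ℕ}
    (hu : u ∉ G.alice) (hf : G.Feasible w f) (hfu : f u = a) (hgu : g u + k = a)
    (hA : ∀ x ∈ G.alice, ∃ y, (x, y) ∈ G.edges ∧ EdgeOk w g x y)
    (hB : ∀ x ∉ G.alice, x ≠ u → ∀ y, (x, y) ∈ G.edges → EdgeOk w g x y) :
    G.Feasible w fun x => min (f x) (g x + k) := by
  have add : ∀ x y, EdgeOk w g x y → EdgeOk w (fun x => g x + k) x y := by
    intro x y h c hc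
    simp only at hc ⊢
    cases hx : g x with
    | top => simp [hx] at hc
    | coe d =>
      rw [hx] at hc
      norm_cast at hc
      obtain ⟨b, hb, hle⟩ := h d hx
      exact ⟨b + k, by simp [hb], by push_cast; omega⟩
  constructor
  · intro x hx
    rcases le_total (f x) (g x + k) with h | h
    · obtain ⟨y, hy, hok⟩ := hf.1 x hx
      exact ⟨y, hy, hok.of_le (by simp [h]) (by simp)⟩
    · obtain ⟨y, hy, hok⟩ := hA x hx
      exact ⟨y, hy, (add x y hok).of_le (by simp [h]) (by simp)⟩
  · intro x hx y hy
    by_cases hxu : x = u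
    · subst hxu
      exact (hf.2 x hx y hy).of_le (by simp [hfu, hgu]) (by simp)
    · rcases le_total (f x) (g x + k) with h | h
      · exact (hf.2 x hx y hy).of_le (by simp [h]) (by simp)
      · exact (add x y (hB x hx hxu y hy)).of_le (by simp [h]) (by simp)

/-- At a node of Bob with two edges, one of them is dispensable: the one whose removal leaves the
larger value at `u`. Let `f` and `g` be the least solutions without `v₁` and without `v₂`, with `g u
≤ f u`. The function `min f (g + (f u - g u))` is feasible without `v₁`, so leastness gives `f v₁ ≤
g v₁ + (f u - g u)`. As `g` respects the edge to `v₁`, so does `f`. -/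
theorem feasible_of_eraseEdge {G : GameGraph V} {w : V → V → ℤ} {u v₁ v₂ : V}
    (hu : u ∉ G.alice) (h₁ : (u, v₁) ∈ G.edges) (h₂ : (u, v₂) ∈ G.edges) (hne : v₁ ≠ v₂)
    (hle : (G.eraseEdge u v₂ v₁ h₁ hne).leastFeasible w u ≤
      (G.eraseEdge u v₁ v₂ h₂ hne.symm).leastFeasible w u) :
    G.Feasible w ((G.eraseEdge u v₁ v₂ h₂ hne.symm).leastFeasible w) := by
  set f := (G.eraseEdge u v₁ v₂ h₂ hne.symm).leastFeasible w with hfdef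
  set g := (G.eraseEdge u v₂ v₁ h₁ hne).leastFeasible w with hgdef
  have hf : (G.eraseEdge u v₁ v₂ h₂ hne.symm).Feasible w f := feasible_leastFeasible _ _
  have hg : (G.eraseEdge u v₂ v₁ h₁ hne).Feasible w g := feasible_leastFeasible _ _
  have hmem : ∀ {x y a b}, (x, y) ∈ G.edges.erase (a, b) ↔ ¬ (x = a ∧ y = b) ∧ (x, y) ∈ G.edges := by
    intro x y a b
    rw [Finset.mem_erase, ne_eq, Prod.mk.injEq]
  have hne_of : ∀ {x}, x ∈ G.alice → x ≠ u := fun hx h => hu (h ▸ hx)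
  refine ⟨fun x hx => ?_, fun x hx y hy => ?_⟩
  · obtain ⟨y, hy, hok⟩ := hf.1 x hx
    exact ⟨y, (hmem.mp hy).2, hok⟩
  · by_cases hxy : x = u ∧ y = v₁
    · obtain ⟨rfl, rfl⟩ := hxy
      intro a ha
      rw [ha] at hle
      obtain ⟨b, hb, hba⟩ := ENat.le_natCast_iff.mp hle
      have hmin : (G.eraseEdge x y v₂ h₂ hne.symm).Feasible w
          fun z => min (f z) (g z + (a - b : ℕ)) := by
        refine feasible_min_add hx hf ha ?_ ?_ ?_
        · rw [hb]
          norm_cast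
          omega
        · intro z hz
          obtain ⟨t, ht, hok⟩ := hg.1 z hz
          exact ⟨t, hmem.mpr ⟨fun h => hne_of hz h.1, (hmem.mp ht).2⟩, hok⟩
        · intro z hz hzu t ht
          exact hg.2 z hz t (hmem.mpr ⟨fun h => hzu h.1, (hmem.mp ht).2⟩)
      have hle2 : f y ≤ g y + (a - b : ℕ) := (leastFeasible_le hmin y).trans (min_le_right _ _)
      obtain ⟨c, hc, hcb⟩ := hg.2 x hx y (hmem.mpr ⟨fun h => hne h.2, hy⟩) b hb
      rw [hc] at hle2
      norm_cast at hle2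
      obtain ⟨d, hd, hdc⟩ := ENat.le_natCast_iff.mp hle2
      exact ⟨d, hd, by omega⟩
    · exact hf.2 x hx y (hmem.mpr ⟨hxy, hy⟩)

/-- Induct on the number of edges, removing a dispensable edge of Bob each time. When every node of
Bob has a single edge, the play energy of any choice of Alice is itself feasible: Bob's only edges
are the ones played, and Alice may use hers. -/
theorem exists_leastFeasible_le_playEnergy (G : GameGraph V) (w : V → V → ℤ) :
    ∃ t : V → V, (∀ u, (u, t u) ∈ G.edges) ∧ ∀ f : V → V, (∀ u, (u, f u) ∈ G.edges) →
      (∀ u ∉ G.alice, f u = t u) → ∀ s, G.leastFeasible w s ≤ playEnergy f w s := by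
  induction hk : G.edges.card using Nat.strong_induction_on generalizing G with
  | _ k ih =>
    subst hk
    by_cases h : ∃ u v₁ v₂, u ∉ G.alice ∧ (u, v₁) ∈ G.edges ∧ (u, v₂) ∈ G.edges ∧ v₁ ≠ v₂
    · obtain ⟨u, v₁, v₂, hu, h₁, h₂, hne⟩ := h
      wlog hle : (G.eraseEdge u v₂ v₁ h₁ hne).leastFeasible w u ≤
        (G.eraseEdge u v₁ v₂ h₂ hne.symm).leastFeasible w u generalizing v₁ v₂
      · exact this v₂ v₁ h₂ h₁ hne.symm (le_of_not_ge hle)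
      have hfeas := feasible_of_eraseEdge hu h₁ h₂ hne hle
      obtain ⟨t, ht, hopt⟩ := ih _ (Finset.card_erase_lt_of_mem h₁)
        (G.eraseEdge u v₁ v₂ h₂ hne.symm) rfl
      refine ⟨t, fun x => Finset.mem_of_mem_erase (ht x), fun f hf hft s => ?_⟩
      refine (leastFeasible_le hfeas s).trans (hopt f (fun x => ?_) hft s)
      refine Finset.mem_erase.mpr ⟨fun hx => ?_, hf x⟩
      rw [Prod.mk.injEq] at hx
      obtain ⟨rfl, hx⟩ := hx
      exact Finset.ne_of_mem_erase (ht x) (by rw [← hft x hu, hx])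
    · push Not at h
      choose t ht using G.exists_edge
      refine ⟨t, ht, fun f hf hft s => leastFeasible_le (f := playEnergy f w) ⟨?_, ?_⟩ s⟩
      · exact fun u _ => ⟨f u, hf u, edgeOk_playEnergy f w u⟩
      · intro u hu v hv
        rw [h u v (f u) hu hv (hf u)]
        exact edgeOk_playEnergy f w u

theorem next_mem (G : GameGraph V) (σ : G.AliceStrategy) (τ : G.BobStrategy) (u : V) :
    (u, G.next σ τ u) ∈ G.edges := by
  unfold next
  split
  · exact (σ ⟨u, _⟩).2
  · exact (τ ⟨u, _⟩).2

theorem exists_bobStrategy_leastFeasible_le (G : GameGraph V) (w : V → V → ℤ) :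
    ∃ τ : G.BobStrategy, ∀ (σ : G.AliceStrategy) s,
      G.leastFeasible w s ≤ playEnergy (G.next σ τ) w s := by
  obtain ⟨t, ht, hopt⟩ := G.exists_leastFeasible_le_playEnergy w
  refine ⟨fun u => ⟨t u, ht u⟩, fun σ s => hopt _ (G.next_mem _ _) (fun u hu => ?_) s⟩
  simp [next, hu]

theorem Feasible.exists_aliceStrategy {G : GameGraph V} {w : V → V → ℤ} {f : V → ℕ∞}
    (h : G.Feasible w f) :
    ∃ σ : G.AliceStrategy, ∀ (τ : G.BobStrategy) u, EdgeOk w f u (G.next σ τ u) := by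
  choose σ hσ hok using h.1
  refine ⟨fun u => ⟨σ u u.2, hσ u u.2⟩, fun τ u => ?_⟩
  by_cases hu : u ∈ G.alice
  · simpa [next, hu] using hok u hu
  · exact h.2 u hu _ (G.next_mem _ τ u)

/-- Alice plays edges that satisfy the constraints of the least solution; Bob plays the uniform
strategy of `exists_bobStrategy_leastFeasible_le`. No separate minimax argument is needed. -/
theorem minEnergy_eq_leastFeasible (G : GameGraph V) (w : V → V → ℤ) :
    G.minEnergy w = G.leastFeasible w := by
  funext s
  apply le_antisymm
  · obtain ⟨σ, hσ⟩ := (G.feasible_leastFeasible w).exists_aliceStrategy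
    exact iInf_le_of_le σ (iSup_le fun τ => playEnergy_le_of_edgeOk (hσ τ) s)
  · obtain ⟨τ, hτ⟩ := G.exists_bobStrategy_leastFeasible_le w
    exact le_iInf fun σ => le_iSup_of_le τ (hτ σ s)

theorem feasible_minEnergy (G : GameGraph V) (w : V → V → ℤ) : G.Feasible w (G.minEnergy w) := by
  rw [minEnergy_eq_leastFeasible]
  exact G.feasible_leastFeasible w

theorem minEnergy_le_of_feasible {G : GameGraph V} {w : V → V → ℤ} {f : V → ℕ∞}
    (h : G.Feasible w f) (s : V) : G.minEnergy w s ≤ f s := by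
  rw [minEnergy_eq_leastFeasible]
  exact leastFeasible_le h s

theorem exists_optimal_bobStrategy (G : GameGraph V) (w : V → V → ℤ) :
    ∃ τ : G.BobStrategy, ∀ s, G.IsOptimalForBob w s τ := by
  obtain ⟨τ, hτ⟩ := G.exists_bobStrategy_leastFeasible_le w
  refine ⟨τ, fun s σ => ?_⟩
  rw [minEnergy_eq_leastFeasible]
  exact hτ σ s

end GameGraph

end Feasible

/-! ### Rounding and the role of the penalty -/

/-- The weights in units of `B`, rounded up. -/
def ceilWeight {V : Type*} (w : V → V → ℤ) (B : ℕ) (u v : V) : ℤ :=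
  -((-w u v) / (B : ℤ))

/-- An energy in units of `B`, rounded down. -/
def scaleDown (B : ℕ) : ℕ∞ → ℕ∞
  | ⊤ => ⊤
  | (a : ℕ) => (a / B : ℕ)

theorem scaleDown_top (B : ℕ) : scaleDown B ⊤ = ⊤ := rfl

theorem scaleDown_natCast (B a : ℕ) : scaleDown B a = (a / B : ℕ) := rfl

theorem scaleDown_one (x : ℕ∞) : scaleDown 1 x = x := by
  cases x with
  | top => rfl
  | coe a => simp [scaleDown_natCast]

theorem ceilWeight_one {V : Type*} (w : V → V → ℤ) : ceilWeight w 1 = w := by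
  funext u v
  simp [ceilWeight]

theorem le_mul_ceilWeight {V : Type*} (w : V → V → ℤ) {B : ℕ} (hB : 0 < B) (u v : V) :
    w u v ≤ B * ceilWeight w B u v := by
  have := Int.mul_ediv_self_le (x := -w u v) (k := (B : ℤ)) (by positivity)
  rw [ceilWeight]
  linarith

theorem mul_ceilWeight_le {V : Type*} (w : V → V → ℤ) {B : ℕ} (hB : 0 < B) (u v : V) :
    B * ceilWeight w B u v ≤ w u v + (B - 1) := by
  have := Int.lt_mul_ediv_self_add (x := -w u v) (k := (B : ℤ)) (by positivity)
  rw [ceilWeight]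
  linarith

section Scaling

set_option linter.unusedSectionVars false

variable {V : Type*} [Fintype V] [DecidableEq V]

theorem mul_pathWeight_ceilWeight_le (f : V → V) (w : V → V → ℤ) {B : ℕ} (hB : 0 < B) (s : V)
    (i : ℕ) : B * pathWeight f (ceilWeight w B) s i ≤ pathWeight f w s i + i * (B - 1) := by
  induction i with
  | zero => simp [pathWeight_zero]
  | succ i ih =>
    have := mul_ceilWeight_le w hB (f^[i] s) (f (f^[i] s))
    rw [pathWeight_succ, pathWeight_succ]
    push_cast
    linarith

/-- Rounding weights up helps Alice, and after that an integral number of units can be pulled out of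
the floor. -/
theorem EdgeOk.scaleDown {w : V → V → ℤ} {f : V → ℕ∞} {u v : V} {B : ℕ} (hB : 0 < B)
    (h : EdgeOk w f u v) : EdgeOk (ceilWeight w B) (fun x => scaleDown B (f x)) u v := by
  intro a ha
  simp only at ha ⊢
  cases hu : f u with
  | top => simp [hu, scaleDown_top] at ha
  | coe c =>
    obtain ⟨d, hd, hle⟩ := h c hu
    refine ⟨d / B, by rw [hd, scaleDown_natCast], ?_⟩
    rw [hu, scaleDown_natCast, Nat.cast_inj] at ha
    subst ha
    have h1 := le_mul_ceilWeight w hB u v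
    push_cast
    have hB' : (0 : ℤ) < B := by exact_mod_cast hB
    have h2 : (d : ℤ) / B ≤ (c + B * ceilWeight w B u v) / B :=
      Int.ediv_le_ediv hB' (by linarith)
    rwa [Int.add_mul_ediv_left _ _ hB'.ne'] at h2

namespace GameGraph

theorem Feasible.scaleDown {G : GameGraph V} {w : V → V → ℤ} {f : V → ℕ∞} {B : ℕ} (hB : 0 < B)
    (h : G.Feasible w f) : G.Feasible (ceilWeight w B) fun x => scaleDown B (f x) :=
  ⟨fun u hu => (h.1 u hu).imp fun _ hv => ⟨hv.1, hv.2.scaleDown hB⟩,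
    fun u hu v hv => (h.2 u hu v hv).scaleDown hB⟩

theorem penalty_le_nodePenalty (G : GameGraph V) (w : V → V → ℤ) (s : V) :
    G.penalty w ≤ G.nodePenalty w s := iInf_le _ s

/-- A negative integral cycle has weight at most `-1` and at most `n` edges, so any optimal strategy
of Bob has this penalty. Consequently the guess `1` is always admissible. -/
theorem inv_card_le_penalty (G : GameGraph V) (w : V → V → ℤ) :
    ((Fintype.card V : ℝ≥0)⁻¹ : ℝ≥0) ≤ G.penalty w := by
  obtain ⟨τ, hτ⟩ := G.exists_optimal_bobStrategy w
  refine le_iInf fun s => le_iSup₂_of_le _ ⟨τ, hτ s, fun σ hneg => ?_⟩ le_rfl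
  have h1 : (cycleWeight (G.next σ τ) w s : ℝ) ≤ -1 := by exact_mod_cast Int.le_sub_one_of_lt hneg
  obtain ⟨k, hk⟩ := exists_iterate_mem_periodicPts (G.next σ τ) s
  have hpos : 0 < (cycleNodes (G.next σ τ) s).card := by
    rw [card_cycleNodes _ hk]
    exact Function.minimalPeriod_pos_of_mem_periodicPts hk
  have hle : (cycleNodes (G.next σ τ) s).card ≤ Fintype.card V := Finset.card_le_univ _
  have hpos' : (0 : ℝ) < (cycleNodes (G.next σ τ) s).card := by exact_mod_cast hpos
  have hle' : ((cycleNodes (G.next σ τ) s).card : ℝ) ≤ Fintype.card V := by exact_mod_cast hle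
  rw [div_le_iff₀ hpos']
  have hV : (0 : ℝ) < Fintype.card V := hpos'.trans_le hle'
  push_cast
  have : (Fintype.card V : ℝ)⁻¹ * (cycleNodes (G.next σ τ) s).card ≤ 1 := by
    rw [inv_mul_le_iff₀ hV]
    linarith
  linarith

theorem one_le_ceil_penalty [Nonempty V] (G : GameGraph V) (w : V → V → ℤ) :
    1 ≤ ENat.ceil (G.penalty w) := by
  rw [Order.one_le_iff_pos, ENat.ceil_pos]
  refine lt_of_lt_of_le ?_ (G.inv_card_le_penalty w)
  simp

/-- `B ≤ ⌈P⌉` means `P > B - 1`. The strict inequality passes from the supremum to one `D`, and it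
is what contradicts a rounding error of up to `B - 1` per edge. -/
theorem exists_hasPenaltyAtLeast {G : GameGraph V} {w : V → V → ℤ} {B : ℕ} (hB : 0 < B)
    (h : (B : ℕ∞) ≤ ENat.ceil (G.penalty w)) (s : V) :
    ∃ D : ℝ≥0, ((B : ℝ) - 1 < D) ∧ G.HasPenaltyAtLeast w s D := by
  obtain ⟨b, rfl⟩ := Nat.exists_eq_succ_of_ne_zero hB.ne'
  have h1 : (b : ℕ∞) < ENat.ceil (G.penalty w) :=
    lt_of_lt_of_le (by exact_mod_cast Nat.lt_succ_self b) h
  rw [ENat.lt_ceil] at h1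
  have h2 := h1.trans_le (G.penalty_le_nodePenalty w s)
  rw [nodePenalty, lt_iSup_iff] at h2
  obtain ⟨D, hD⟩ := h2
  rw [lt_iSup_iff] at hD
  obtain ⟨hpen, hD⟩ := hD
  refine ⟨D, ?_, hpen⟩
  have h3 : (b : ℝ≥0) < D := by
    rw [← ENNReal.coe_lt_coe]
    simpa using hD
  push_cast
  have : (b : ℝ) < D := by exact_mod_cast h3
  linarith

/-- Alice follows `f`, and Bob his penalty strategy for `s`. Since Bob's strategy is optimal, it
suffices to bound the energy of this one play. -/
theorem minEnergy_le_of_feasible_ceilWeight {G : GameGraph V} {w : V → V → ℤ} {B : ℕ}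
    (hB : 0 < B) (hP : (B : ℕ∞) ≤ ENat.ceil (G.penalty w)) {f : V → ℕ∞}
    (hf : G.Feasible (ceilWeight w B) f) {s : V} {a : ℕ} (ha : f s = a) :
    G.minEnergy w s ≤ (B * a + Fintype.card V * (B - 1) : ℕ) := by
  obtain ⟨D, hD, τ, hopt, hpen⟩ := exists_hasPenaltyAtLeast hB hP s
  obtain ⟨σ, hσ⟩ := hf.exists_aliceStrategy
  refine (hopt σ).trans ?_
  specialize hσ τ
  specialize hpen σ
  set t := G.next σ τ
  -- Feasibility makes the rounded cycle nonnegative, so its true average is at least `-(B - 1) >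
  -- -D`. By the choice of `D`, it cannot be negative.
  have hcyc : 0 ≤ cycleWeight t w s := by
    by_contra! hneg
    have h1 := hpen hneg
    have h2 := cycleWeight_nonneg_of_edgeOk hσ ha
    obtain ⟨k, hk⟩ := exists_iterate_mem_periodicPts t s
    have hpos := Function.minimalPeriod_pos_of_mem_periodicPts hk
    rw [cycleWeight_eq_pathWeight _ _ hk] at h1 h2
    rw [card_cycleNodes _ hk] at h1
    set p := Function.minimalPeriod t (t^[k] s)
    have h3 := mul_pathWeight_ceilWeight_le t w hB (t^[k] s) p
    have h4 : 0 ≤ pathWeight t w (t^[k] s) p + p * ((B : ℤ) - 1) := le_trans (by positivity) h3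
    have h5 : (0 : ℝ) ≤ pathWeight t w (t^[k] s) p + p * ((B : ℝ) - 1) := by exact_mod_cast h4
    have hp : (0 : ℝ) < p := by exact_mod_cast hpos
    rw [div_le_iff₀ hp] at h1
    nlinarith
  rw [playEnergy, if_neg (not_lt.mpr hcyc)]
  refine iSup₂_le fun i hi => ?_
  have hi' := isSimplePath_lt_card hi
  obtain ⟨b, -, hb⟩ := EdgeOk.iterate hσ ha i
  have h3 := mul_pathWeight_ceilWeight_le t w hB s i
  rw [Nat.cast_le, Int.toNat_le]
  push_cast [Nat.cast_sub (Nat.succ_le_of_lt hB)]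
  have hBz : (0 : ℤ) < B := by exact_mod_cast hB
  have h6 : (0 : ℤ) ≤ B * (a + pathWeight t (ceilWeight w B) s i) :=
    mul_nonneg hBz.le (by omega)
  -- Only simple paths matter once the cycle is nonnegative, so at most `n` rounding errors add up.
  have h7 : (i : ℤ) * (B - 1) ≤ Fintype.card V * (B - 1) :=
    mul_le_mul_of_nonneg_right (by exact_mod_cast hi'.le) (by omega)
  linarith

theorem abs_weight_le_maxWeight (G : GameGraph V) (w : V → V → ℤ) {u v : V}
    (h : (u, v) ∈ G.edges) : (w u v).natAbs ≤ G.maxWeight w :=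
  Finset.le_sup (f := fun p : V × V => (w p.1 p.2).natAbs) h

theorem isEnergyBound_card_mul_maxWeight (G : GameGraph V) (w : V → V → ℤ) :
    G.IsEnergyBound w (Fintype.card V * G.maxWeight w) := by
  intro s hs
  rw [minEnergy, iInf_lt_iff] at hs
  obtain ⟨σ, hσ⟩ := hs
  refine iInf_le_of_le σ (iSup_le fun τ => ?_)
  have hτ : playEnergy (G.next σ τ) w s ≠ ⊤ := ((le_iSup _ τ).trans_lt hσ).ne
  rw [playEnergy, if_neg (not_lt.mpr (cycleWeight_nonneg_of_lt_top hτ))]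
  refine iSup₂_le fun i hi => ?_
  rw [Nat.cast_le]
  have hi' := isSimplePath_lt_card hi
  have key : ∀ i : ℕ, -pathWeight (G.next σ τ) w s i ≤ i * (G.maxWeight w : ℤ) := by
    intro i
    induction i with
    | zero => simp [pathWeight_zero]
    | succ i ih =>
      have := G.abs_weight_le_maxWeight w (G.next_mem σ τ ((G.next σ τ)^[i] s))
      rw [pathWeight_succ]
      push_cast
      rw [add_mul, one_mul]
      omega
  rw [Int.toNat_le]
  refine (key i).trans ?_
  push_cast
  exact mul_le_mul_of_nonneg_right (by exact_mod_cast hi'.le) (by positivity)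

end GameGraph

end Scaling

/-! ### Linked lists of the edges with a common endpoint -/

section LinkedList

variable {V : Type*} [DecidableEq V]

/-- The largest index in `{1, …, k}` at which `key` takes the value `v`, or `0`. -/
def lastIdx (key : ℕ → V) : ℕ → V → ℕ
  | 0, _ => 0
  | k + 1, v => if key (k + 1) = v then k + 1 else lastIdx key k v

/-- The number of indices in `{1, …, k}` at which `key` takes the value `v`. -/
def countIdx (key : ℕ → V) : ℕ → V → ℕ
  | 0, _ => 0
  | k + 1, v => countIdx key k v + if key (k + 1) = v then 1 else 0

theorem lastIdx_le (key : ℕ → V) (k : ℕ) (v : V) : lastIdx key k v ≤ k := by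
  induction k with
  | zero => simp [lastIdx]
  | succ k ih =>
    rw [lastIdx]
    split <;> omega

theorem key_lastIdx (key : ℕ → V) (k : ℕ) (v : V) (h : lastIdx key k v ≠ 0) :
    key (lastIdx key k v) = v := by
  induction k with
  | zero => simp [lastIdx] at h
  | succ k ih =>
    rw [lastIdx] at h ⊢
    split
    · assumption
    · rename_i hne
      rw [if_neg hne] at h
      exact ih h

theorem le_lastIdx (key : ℕ → V) {k p : ℕ} (hp : 1 ≤ p) (hpk : p ≤ k) :
    p ≤ lastIdx key k (key p) := by
  induction k with
  | zero => omega
  | succ k ih =>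
    rw [lastIdx]
    split
    · exact hpk
    · rename_i hne
      exact ih (by
        rcases Nat.lt_or_ge k p with h | h
        · exact absurd (congrArg key (by omega : k + 1 = p)) hne
        · exact h)

theorem lastIdx_pos (key : ℕ → V) {k p : ℕ} (hp : 1 ≤ p) (hpk : p ≤ k) :
    1 ≤ lastIdx key k (key p) := hp.trans (le_lastIdx key hp hpk)

/-- No occurrence of `v` lies beyond the last one. With `countIdx_pred`, this makes `countIdx` at a
list pointer the remaining length of the list, which drops by one at each move. -/
theorem countIdx_lastIdx (key : ℕ → V) (k : ℕ) (v : V) :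
    countIdx key (lastIdx key k v) v = countIdx key k v := by
  induction k with
  | zero => rfl
  | succ k ih =>
    rw [lastIdx]
    split
    · rfl
    · rename_i hne
      rw [ih, countIdx, if_neg hne, Nat.add_zero]

theorem countIdx_pred (key : ℕ → V) {p : ℕ} (hp : 1 ≤ p) :
    countIdx key (p - 1) (key p) + 1 = countIdx key p (key p) := by
  obtain ⟨q, rfl⟩ := Nat.exists_eq_succ_of_ne_zero (by omega : p ≠ 0)
  simp [countIdx]

theorem sum_countIdx [Fintype V] (key : ℕ → V) (k : ℕ) : ∑ v, countIdx key k v = k := by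
  induction k with
  | zero => simp [countIdx]
  | succ k ih => simp [countIdx, Finset.sum_add_distrib, ih]

end LinkedList

/-! ### Abstract worklist runs: invariants and potential -/

/-- The data of a worklist run: the owner of each node, the edges `1, …, m`, their weights, and for
each node the value above which it is set to `∞`. -/
structure LiftData (V : Type*) where
  alice : Finset V
  m : ℕ
  src : ℕ → V
  dst : ℕ → V
  w : V → V → ℤ
  cap : V → ℕ

/-- The state of a worklist run: the values, the candidate edge of each node of Alice, the stack of
raised nodes, the current edge (`0` if there is none), and whether some node exceeded its cap. -/
structure LiftState (V : Type*) where
  f : V → ℕ∞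
  ptr : V → ℕ
  stack : List V
  cur : ℕ
  flag : Bool

/-- The number of units by which a value may still be raised. -/
def room (c : ℕ) : ℕ∞ → ℕ
  | ⊤ => 0
  | (a : ℕ) => c + 1 - a

theorem room_top (c : ℕ) : room c ⊤ = 0 := rfl

theorem room_natCast (c a : ℕ) : room c a = c + 1 - a := rfl

/-- The value that follows `x`, where values above `c` are replaced by `∞`. -/
noncomputable def bump (c : ℕ) (x : ℕ∞) : ℕ∞ :=
  if x < c then x + 1 else ⊤

theorem le_bump (c : ℕ) (x : ℕ∞) : x ≤ bump c x := by
  rw [bump]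
  split
  · exact le_self_add
  · exact le_top

namespace LiftState

variable {V : Type*} [DecidableEq V] (D : LiftData V) (a : LiftState V)

/-- Take the node `v` from the stack, which leaves `l`. -/
def pop (v : V) (l : List V) : LiftState V :=
  { a with stack := l, cur := lastIdx D.dst D.m v }

/-- Go to the next edge into the node in progress. -/
def drop : LiftState V :=
  { a with cur := lastIdx D.dst (a.cur - 1) (D.dst a.cur) }

/-- Replace the candidate edge of `u` by the next edge out of `u`. -/
def advance (u : V) : LiftState V :=
  { a with ptr := Function.update a.ptr u (lastIdx D.src (a.ptr u - 1) u) }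

/-- Raise the value of `u` by one unit. -/
noncomputable def raise (u : V) : LiftState V where
  f := Function.update a.f u (bump (D.cap u) (a.f u))
  ptr := Function.update a.ptr u (lastIdx D.src D.m u)
  stack := u :: a.stack
  cur := a.cur
  flag := a.flag || !decide (a.f u < D.cap u)

/-- The invariant of a worklist run. -/
structure Inv : Prop where
  cur_le : a.cur ≤ D.m
  one_le_ptr : ∀ u, 1 ≤ a.ptr u
  ptr_le : ∀ u, a.ptr u ≤ D.m
  src_ptr : ∀ u, D.src (a.ptr u) = u
  le_cap : ∀ u (x : ℕ), a.f u = x → x ≤ D.cap u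
  passed : ∀ u ∈ D.alice, ∀ p, a.ptr u < p → p ≤ D.m → D.src p = u →
    ¬EdgeOk D.w a.f u (D.dst p) ∨ a.f u = ⊤
  bob : ∀ u ∉ D.alice, ∀ p, 1 ≤ p → p ≤ D.m → D.src p = u →
    EdgeOk D.w a.f u (D.dst p) ∨ D.dst p ∈ a.stack ∨ (p ≤ a.cur ∧ D.dst p = D.dst a.cur)
  alice : ∀ u ∈ D.alice, EdgeOk D.w a.f u (D.dst (a.ptr u)) ∨ D.dst (a.ptr u) ∈ a.stack ∨
    ∃ p, 1 ≤ p ∧ p ≤ a.cur ∧ D.dst p = D.dst a.cur ∧ D.src p = u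

/-- The invariant that relates the values to a solution `g`: under the condition `K` the values are
below `g` even if some cap was exceeded, and under the condition `S` no cap is exceeded. -/
structure LowerInv (K S : Prop) (g f₀ : V → ℕ∞) : Prop where
  le : a.flag = false ∨ K → ∀ u, a.f u ≤ g u
  start_le : ∀ u, f₀ u ≤ a.f u
  flag : S → a.flag = false

variable {D a}

/-- Constraints excused by `v` lying on the stack become excused by lying in the list of edges into
`v`, which is entered at its head and so is still complete. -/
theorem Inv.pop {v : V} {l : List V} (h : a.Inv D) (hs : a.stack = v :: l) (hc : a.cur = 0) :
    (a.pop D v l).Inv D where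
  cur_le := lastIdx_le _ _ _
  one_le_ptr := h.one_le_ptr
  ptr_le := h.ptr_le
  src_ptr := h.src_ptr
  le_cap := h.le_cap
  passed := h.passed
  bob u hu p hp hpm hsrc := by
    rcases h.bob u hu p hp hpm hsrc with h1 | h1 | h1
    · exact .inl h1
    · rw [hs, List.mem_cons] at h1
      rcases h1 with h1 | h1
      · right; right
        have h2 := le_lastIdx D.dst hp hpm
        rw [h1] at h2
        exact ⟨h2, by rw [h1]; exact (key_lastIdx _ _ _ (by omega)).symm⟩
      · exact .inr (.inl h1)
    · omega
  alice u hu := by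
    rcases h.alice u hu with h1 | h1 | ⟨p, h1, h2, -⟩
    · exact .inl h1
    · rw [hs, List.mem_cons] at h1
      rcases h1 with h1 | h1
      · right; right
        have h2 := le_lastIdx D.dst (h.one_le_ptr u) (h.ptr_le u)
        rw [h1] at h2
        have h3 := h.one_le_ptr u
        exact ⟨_, h3, h2, by rw [h1]; exact (key_lastIdx _ _ _ (by omega)).symm, h.src_ptr u⟩
      · exact .inr (.inl h1)
    · omega

/-- The only edge that leaves the pending list is the current one. For a node of Bob its own
constraint has been tested; for a node of Alice, that of her candidate edge. -/
theorem Inv.drop (h : a.Inv D)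
    (hok : ∀ p, (if D.src a.cur ∈ D.alice then a.ptr (D.src a.cur) else a.cur) = p →
      EdgeOk D.w a.f (D.src a.cur) (D.dst p)) : (a.drop D).Inv D := by
  have next : ∀ p, 1 ≤ p → p ≤ a.cur → D.dst p = D.dst a.cur → p ≠ a.cur →
      p ≤ (a.drop D).cur ∧ D.dst p = D.dst (a.drop D).cur := by
    intro p h1 h2 h3 hne
    have h4 := le_lastIdx D.dst h1 (by omega : p ≤ a.cur - 1)
    rw [h3] at h4
    exact ⟨h4, by rw [h3]; exact (key_lastIdx D.dst _ _ (by omega)).symm⟩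
  refine ⟨(lastIdx_le _ _ _).trans (by have := h.cur_le; omega), h.one_le_ptr, h.ptr_le,
    h.src_ptr, h.le_cap, h.passed, fun u hu p hp hpm hsrc => ?_, fun u hu => ?_⟩
  · rcases h.bob u hu p hp hpm hsrc with h1 | h1 | ⟨h1, h2⟩
    · exact .inl h1
    · exact .inr (.inl h1)
    · by_cases hpc : p = a.cur
      · subst hpc hsrc
        exact .inl (hok _ (if_neg hu))
      · exact .inr (.inr (next p hp h1 h2 hpc))
  · rcases h.alice u hu with h1 | h1 | ⟨p, h1, h2, h3, h4⟩
    · exact .inl h1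
    · exact .inr (.inl h1)
    · by_cases hpc : p = a.cur
      · subst hpc h4
        exact .inl (hok _ (if_pos hu))
      · obtain ⟨h5, h6⟩ := next p h1 h2 h3 hpc
        exact .inr (.inr ⟨p, h1, h5, h6, h4⟩)

/-- The violated candidate joins the passed edges. The new candidate is untested, but `u` remains
pending because the current edge does not move. -/
theorem Inv.advance (h : a.Inv D) (hc : a.cur ≠ 0)
    (hbad : ¬EdgeOk D.w a.f (D.src a.cur) (D.dst (a.ptr (D.src a.cur))))
    (hnext : lastIdx D.src (a.ptr (D.src a.cur) - 1) (D.src a.cur) ≠ 0) :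
    (a.advance D (D.src a.cur)).Inv D := by
  set u := D.src a.cur with hudef
  have hle := lastIdx_le D.src (a.ptr u - 1) u
  have hptr := h.ptr_le u
  refine ⟨h.cur_le, fun x => ?_, fun x => ?_, fun x => ?_, h.le_cap, fun x hx p hp hpm hsrc => ?_,
    h.bob, fun x hx => ?_⟩
  · by_cases hxu : x = u
    · subst hxu
      simpa [LiftState.advance, Nat.one_le_iff_ne_zero] using hnext
    · simpa [LiftState.advance, hxu] using h.one_le_ptr x
  · by_cases hxu : x = u
    · subst hxu
      simp only [LiftState.advance, Function.update_self]
      omega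
    · simpa [LiftState.advance, hxu] using h.ptr_le x
  · by_cases hxu : x = u
    · subst hxu
      simpa only [LiftState.advance, Function.update_self] using key_lastIdx _ _ _ hnext
    · simpa [LiftState.advance, hxu] using h.src_ptr x
  · by_cases hxu : x = u
    · subst hxu
      simp only [LiftState.advance, Function.update_self] at hp
      rcases lt_trichotomy p (a.ptr u) with h1 | h1 | h1
      · have := le_lastIdx D.src (p := p) (k := a.ptr u - 1) (by omega) (by omega)
        rw [hsrc] at this
        omega
      · subst h1
        exact .inl hbad
      · exact h.passed u hx p h1 hpm hsrc
    · simp only [LiftState.advance, Function.update_of_ne hxu] at hp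
      exact h.passed x hx p hp hpm hsrc
  · by_cases hxu : x = u
    · subst hxu
      exact .inr (.inr ⟨a.cur, by omega, le_rfl, rfl, rfl⟩)
    · simpa [LiftState.advance, hxu] using h.alice x hx

theorem edgeOk_update_of_ne {w : V → V → ℤ} {f : V → ℕ∞} {u x y : V} {z : ℕ∞} (hx : x ≠ u)
    (hz : f u ≤ z) (h : EdgeOk w (Function.update f u z) x y) : EdgeOk w f x y := by
  refine h.of_le (by simp [hx]) ?_
  by_cases hy : y = u
  · subst hy
    simpa using hz
  · simp [hy]

theorem edgeOk_update {w : V → V → ℤ} {f : V → ℕ∞} {u x y : V} {z : ℕ∞} (hy : y ≠ u)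
    (hz : f u ≤ z) (h : EdgeOk w f x y) : EdgeOk w (Function.update f u z) x y := by
  refine h.of_le ?_ (by simp [hy])
  by_cases hx : x = u
  · subst hx
    simpa using hz
  · simp [hx]

/-- Raising `u` can only break constraints of edges into `u`, hence the push. Edges passed at other
nodes stay violated since targets only grow; at `u` the candidate returns to the head of the list,
so nothing counts as passed. -/
theorem Inv.raise (h : a.Inv D) (hc : a.cur ≠ 0) : (a.raise D (D.src a.cur)).Inv D := by
  set u := D.src a.cur with hudef
  have hb := le_bump (D.cap u) (a.f u)
  have hm := h.cur_le
  have hhead : 1 ≤ lastIdx D.src D.m u := lastIdx_pos D.src (by omega) hm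
  refine ⟨h.cur_le, fun x => ?_, fun x => ?_, fun x => ?_, fun x y hy => ?_,
    fun x hx p hp hpm hsrc => ?_, fun x hx p hp hpm hsrc => ?_, fun x hx => ?_⟩
  · by_cases hxu : x = u
    · subst hxu
      simpa [LiftState.raise] using hhead
    · simpa [LiftState.raise, hxu] using h.one_le_ptr x
  · by_cases hxu : x = u
    · subst hxu
      simpa [LiftState.raise] using lastIdx_le _ _ _
    · simpa [LiftState.raise, hxu] using h.ptr_le x
  · by_cases hxu : x = u
    · subst hxu
      simpa [LiftState.raise] using key_lastIdx D.src _ _ (by omega)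
    · simpa [LiftState.raise, hxu] using h.src_ptr x
  · by_cases hxu : x = u
    · subst hxu
      simp only [LiftState.raise, Function.update_self, bump] at hy
      split at hy
      · rename_i hlt
        cases hf : a.f u with
        | top => simp [hf] at hlt
        | coe z =>
          rw [hf] at hlt hy
          norm_cast at hlt hy
          omega
      · simp at hy
    · simp only [LiftState.raise, Function.update_of_ne hxu] at hy
      exact h.le_cap x y hy
  · by_cases hxu : x = u
    · subst hxu
      simp only [LiftState.raise, Function.update_self] at hp
      have := le_lastIdx D.src (p := p) (k := D.m) (by omega) hpm
      rw [hsrc] at this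
      omega
    · simp only [LiftState.raise, Function.update_of_ne hxu] at hp ⊢
      exact (h.passed x hx p hp hpm hsrc).imp (mt (edgeOk_update_of_ne hxu hb)) id
  · by_cases hpu : D.dst p = u
    · exact .inr (.inl (by simp [LiftState.raise, hpu]))
    · rcases h.bob x hx p hp hpm hsrc with h1 | h1 | h1
      · exact .inl (edgeOk_update hpu hb h1)
      · exact .inr (.inl (by simp [LiftState.raise, h1]))
      · exact .inr (.inr h1)
  · by_cases hxu : x = u
    · subst hxu
      exact .inr (.inr ⟨a.cur, by omega, le_rfl, rfl, rfl⟩)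
    · simp only [LiftState.raise, Function.update_of_ne hxu]
      by_cases hpu : D.dst (a.ptr x) = u
      · exact .inr (.inl (by simp [hpu]))
      · rcases h.alice x hx with h1 | h1 | h1
        · exact .inl (edgeOk_update hpu hb h1)
        · exact .inr (.inl (by simp [h1]))
        · exact .inr (.inr h1)

/-- Every edge that could justify the present value of `u` is violated. -/
def Forced (D : LiftData V) (a : LiftState V) (u : V) : Prop :=
  a.f u ≠ ⊤ ∧ if u ∈ D.alice then
      ∀ p, 1 ≤ p → p ≤ D.m → D.src p = u → ¬EdgeOk D.w a.f u (D.dst p)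
    else ∃ p, 1 ≤ p ∧ p ≤ D.m ∧ D.src p = u ∧ ¬EdgeOk D.w a.f u (D.dst p)

/-- With no edge left in her list, each edge out of `u` is either passed or the violated candidate.
-/
theorem Inv.forced_of_alice (h : a.Inv D) {u : V} (hu : u ∈ D.alice)
    (hbad : ¬EdgeOk D.w a.f u (D.dst (a.ptr u))) (hnext : lastIdx D.src (a.ptr u - 1) u = 0) :
    Forced D a u := by
  have htop : a.f u ≠ ⊤ := fun ht => hbad (.of_top ht)
  refine ⟨htop, ?_⟩
  rw [if_pos hu]
  intro p hp hpm hsrc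
  rcases lt_trichotomy p (a.ptr u) with h1 | h1 | h1
  · have := le_lastIdx D.src (p := p) (k := a.ptr u - 1) (by omega) (by omega)
    rw [hsrc] at this
    omega
  · subst h1
    exact hbad
  · exact (h.passed u hu p h1 hpm hsrc).resolve_right htop

/-- `g` solves the constraints of the edges. -/
structure _root_.LiftData.Solution (D : LiftData V) (g : V → ℕ∞) : Prop where
  alice : ∀ u ∈ D.alice, ∃ p, 1 ≤ p ∧ p ≤ D.m ∧ D.src p = u ∧ EdgeOk D.w g u (D.dst p)
  bob : ∀ u ∉ D.alice, ∀ p, 1 ≤ p → p ≤ D.m → D.src p = u → EdgeOk D.w g u (D.dst p)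

/-- If the value at `u` were already `g u`, the constraints of `g` at `u` would carry over to the
smaller targets of the present state. So a forced raise by one unit cannot overshoot `g`. -/
theorem Forced.lt {u : V} {g : V → ℕ∞} (hF : Forced D a u) (hg : D.Solution g)
    (hle : ∀ x, a.f x ≤ g x) : a.f u < g u := by
  refine lt_of_le_of_ne (hle u) fun heq => ?_
  obtain ⟨-, hF⟩ := hF
  split at hF
  · rename_i hu
    obtain ⟨p, h1, h2, h3, h4⟩ := hg.alice u hu
    exact hF p h1 h2 h3 (h4.of_le heq.ge (hle _))
  · rename_i hu
    obtain ⟨p, h1, h2, h3, h4⟩ := hF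
    exact h4 ((hg.bob u hu p h1 h2 h3).of_le heq.ge (hle _))

/-- A raise within the cap stays below `g` by `Forced.lt`. A jump to `∞` is harmless under `K`,
since then `g u` exceeds the cap and must be `∞`; under `S` it does not occur, since the value is
strictly below `g u` and so below the cap. -/
theorem LowerInv.raise {u : V} {K S : Prop} {g f₀ : V → ℕ∞} (h : a.LowerInv K S g f₀)
    (hF : Forced D a u) (hg : D.Solution g) (hK : K → ∀ u, g u ≤ D.cap u ∨ g u = ⊤)
    (hS : S → ∀ u, f₀ u ≠ ⊤ → g u ≤ D.cap u) : (a.raise D u).LowerInv K S g f₀ := by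
  refine ⟨fun hflag x => ?_, fun x => ?_, fun hs => ?_⟩
  · have hle : ∀ x, a.f x ≤ g x := h.le (hflag.imp (fun h' => by
      simp only [LiftState.raise, Bool.or_eq_false_iff] at h'
      exact h'.1) id)
    by_cases hxu : x = u
    · subst hxu
      have hlt := hF.lt hg hle
      simp only [LiftState.raise, Function.update_self, bump]
      split
      · exact Order.add_one_le_of_lt hlt
      · rename_i hcap
        rcases hflag with h' | h'
        · simp [LiftState.raise, hcap] at h'
        · rcases hK h' x with h' | h'
          · exact absurd (hlt.trans_le h') hcap
          · rw [h']
    · simpa [LiftState.raise, hxu] using hle x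
  · by_cases hxu : x = u
    · subst hxu
      simpa [LiftState.raise] using (h.start_le x).trans (le_bump _ _)
    · simpa [LiftState.raise, hxu] using h.start_le x
  · have h1 := h.flag hs
    have h2 := hF.lt hg (h.le (.inl h1))
    have h3 : f₀ u ≠ ⊤ := fun ht => hF.1 (top_le_iff.mp (ht ▸ h.start_le u))
    simp [LiftState.raise, h1, h2.trans_le (hS hs u h3)]

/-- A bound on the number of remaining steps. -/
def potential [Fintype V] (D : LiftData V) (a : LiftState V) : ℕ :=
  ∑ u, room (D.cap u) (a.f u) * (countIdx D.src D.m u + countIdx D.dst D.m u + 2) +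
    ∑ u, countIdx D.src (a.ptr u) u + (a.stack.map fun v => countIdx D.dst D.m v + 1).sum +
    countIdx D.dst a.cur (D.dst a.cur)

theorem countIdx_lastIdx_self (key : ℕ → V) (k : ℕ) (v : V) :
    countIdx key (lastIdx key k v) (key (lastIdx key k v)) = countIdx key k v := by
  by_cases h : lastIdx key k v = 0
  · rw [← countIdx_lastIdx key k v, h]
    rfl
  · rw [key_lastIdx _ _ _ h, countIdx_lastIdx]

theorem _root_.Finset.sum_add_eq_of_eq_off {V : Type*} [Fintype V] [DecidableEq V] {p q : V → ℕ}
    (u : V) (h : ∀ x, x ≠ u → p x = q x) : ∑ x, p x + q u = ∑ x, q x + p u := by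
  have h1 : p u + ∑ x ∈ Finset.univ.erase u, p x = ∑ x, p x :=
    Finset.add_sum_erase _ p (Finset.mem_univ u)
  have h2 : q u + ∑ x ∈ Finset.univ.erase u, q x = ∑ x, q x :=
    Finset.add_sum_erase _ q (Finset.mem_univ u)
  have h3 : ∑ x ∈ Finset.univ.erase u, p x = ∑ x ∈ Finset.univ.erase u, q x :=
    Finset.sum_congr rfl fun x hx => h x (Finset.ne_of_mem_erase hx)
  omega

variable [Fintype V]

theorem potential_pop {v : V} {l : List V} (hs : a.stack = v :: l) (hc : a.cur = 0) :
    potential D (a.pop D v l) + 1 ≤ potential D a := by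
  simp only [potential, LiftState.pop, countIdx_lastIdx_self, hs, hc, List.map_cons,
    List.sum_cons, countIdx]
  omega

theorem potential_drop (hc : a.cur ≠ 0) : potential D (a.drop D) + 1 ≤ potential D a := by
  have := countIdx_pred D.dst (p := a.cur) (by omega)
  simp only [potential, LiftState.drop, countIdx_lastIdx_self]
  omega

theorem potential_advance (h : a.Inv D) (u : V) :
    potential D (a.advance D u) + 1 ≤ potential D a := by
  have h1 := countIdx_pred D.src (h.one_le_ptr u)
  rw [h.src_ptr u] at h1
  have h2 := Finset.sum_add_eq_of_eq_off (p := fun x => countIdx D.src ((a.advance D u).ptr x) x)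
    (q := fun x => countIdx D.src (a.ptr x) x) u
    fun x hx => by simp [LiftState.advance, hx]
  simp only [LiftState.advance, Function.update_self, countIdx_lastIdx] at h2
  simp only [potential, LiftState.advance]
  omega

/-- The unit of room given up is worth out-degree plus in-degree plus two: it pays for resetting the
candidate, for the pushed node (in-degree plus one), and for the step itself. -/
theorem potential_raise (h : a.Inv D) {u : V} (hu : a.f u ≠ ⊤) :
    potential D (a.raise D u) + 1 ≤ potential D a := by
  have hr : room (D.cap u) (bump (D.cap u) (a.f u)) + 1 ≤ room (D.cap u) (a.f u) := by
    cases hf : a.f u with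
    | top => exact absurd hf hu
    | coe z =>
      have := h.le_cap u z hf
      rw [bump, room_natCast]
      split
      · rename_i hlt
        norm_cast at hlt
        have : ((z : ℕ∞) + 1) = ((z + 1 : ℕ) : ℕ∞) := by push_cast; rfl
        rw [this, room_natCast]
        omega
      · rw [room_top]
        omega
  have h1 := Finset.sum_add_eq_of_eq_off (p := fun x => countIdx D.src ((a.raise D u).ptr x) x)
    (q := fun x => countIdx D.src (a.ptr x) x) u
    fun x hx => by simp [LiftState.raise, hx]
  have h2 := Finset.sum_add_eq_of_eq_off
    (p := fun x => room (D.cap x) ((a.raise D u).f x) *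
      (countIdx D.src D.m x + countIdx D.dst D.m x + 2))
    (q := fun x => room (D.cap x) (a.f x) *
      (countIdx D.src D.m x + countIdx D.dst D.m x + 2)) u
    fun x hx => by simp [LiftState.raise, hx]
  have h3 := Nat.mul_le_mul_right (countIdx D.src D.m u + countIdx D.dst D.m u + 2) hr
  rw [add_mul, one_mul] at h3
  simp only [LiftState.raise, Function.update_self, countIdx_lastIdx] at h1 h2
  simp only [potential, LiftState.raise, List.map_cons, List.sum_cons]
  omega

theorem length_stack_le_potential : a.stack.length ≤ potential D a := by
  have : ∀ l : List V, l.length ≤ (l.map fun v => countIdx D.dst D.m v + 1).sum := by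
    intro l
    induction l with
    | nil => simp
    | cons v l ih =>
      simp only [List.length_cons, List.map_cons, List.sum_cons]
      omega
  have := this a.stack
  simp only [potential]
  omega

end LiftState

/-! ### Program logic with step counts -/

/-- The expression `e` evaluates to a number that satisfies `Q`. -/
def RamExpr.wp (B : ℕ) (s : RamState) (e : RamExpr) (Q : ℤ → Prop) : Prop :=
  ∃ z, e.eval B s = some z ∧ Q z

theorem fitWord_eq_some {B : ℕ} {z x : ℤ} : fitWord B z = some x ↔ z.natAbs ≤ B ∧ z = x := by
  simp [fitWord]

namespace RamExpr

variable {B : ℕ} {s : RamState} {Q : ℤ → Prop}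

theorem wp_const {z : ℤ} : (const z).wp B s Q ↔ z.natAbs ≤ B ∧ Q z := by
  simp [wp, eval, fitWord_eq_some]

theorem wp_var {x : ℕ} : (var x).wp B s Q ↔ (s.reg x).natAbs ≤ B ∧ Q (s.reg x) := by
  simp [wp, eval, fitWord_eq_some]

theorem wp_get {a : ℕ} {i : RamExpr} : (get a i).wp B s Q ↔
    i.wp B s fun k => 0 ≤ k ∧ (s.arr a k.toNat).natAbs ≤ B ∧ Q (s.arr a k.toNat) := by
  simp only [wp, eval, Option.bind_eq_some_iff, ite_eq_left_iff, Option.ite_none_right_eq_some,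
    fitWord_eq_some]
  constructor
  · rintro ⟨z, ⟨k, hk, h0, h1, rfl⟩, hQ⟩
    exact ⟨k, hk, h0, h1, hQ⟩
  · rintro ⟨k, hk, h0, h1, hQ⟩
    exact ⟨_, ⟨k, hk, h0, h1, rfl⟩, hQ⟩

theorem wp_add {e₁ e₂ : RamExpr} : (add e₁ e₂).wp B s Q ↔
    e₁.wp B s fun x => e₂.wp B s fun y => (x + y).natAbs ≤ B ∧ Q (x + y) := by
  simp only [wp, eval, Option.bind_eq_some_iff, fitWord_eq_some]
  constructor
  · rintro ⟨z, ⟨x, hx, y, hy, h1, rfl⟩, hQ⟩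
    exact ⟨x, hx, y, hy, h1, hQ⟩
  · rintro ⟨x, hx, y, hy, h1, hQ⟩
    exact ⟨_, ⟨x, hx, y, hy, h1, rfl⟩, hQ⟩

theorem wp_sub {e₁ e₂ : RamExpr} : (sub e₁ e₂).wp B s Q ↔
    e₁.wp B s fun x => e₂.wp B s fun y => (x - y).natAbs ≤ B ∧ Q (x - y) := by
  simp only [wp, eval, Option.bind_eq_some_iff, fitWord_eq_some]
  constructor
  · rintro ⟨z, ⟨x, hx, y, hy, h1, rfl⟩, hQ⟩
    exact ⟨x, hx, y, hy, h1, hQ⟩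
  · rintro ⟨x, hx, y, hy, h1, hQ⟩
    exact ⟨_, ⟨x, hx, y, hy, h1, rfl⟩, hQ⟩

theorem wp_mul {e₁ e₂ : RamExpr} : (mul e₁ e₂).wp B s Q ↔
    e₁.wp B s fun x => e₂.wp B s fun y => (x * y).natAbs ≤ B ∧ Q (x * y) := by
  simp only [wp, eval, Option.bind_eq_some_iff, fitWord_eq_some]
  constructor
  · rintro ⟨z, ⟨x, hx, y, hy, h1, rfl⟩, hQ⟩
    exact ⟨x, hx, y, hy, h1, hQ⟩
  · rintro ⟨x, hx, y, hy, h1, hQ⟩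
    exact ⟨_, ⟨x, hx, y, hy, h1, rfl⟩, hQ⟩

theorem wp_div {e₁ e₂ : RamExpr} : (div e₁ e₂).wp B s Q ↔
    e₁.wp B s fun x => e₂.wp B s fun y => y ≠ 0 ∧ (x / y).natAbs ≤ B ∧ Q (x / y) := by
  simp only [wp, eval, Option.bind_eq_some_iff, Option.ite_none_left_eq_some, fitWord_eq_some]
  constructor
  · rintro ⟨z, ⟨x, hx, y, hy, h0, h1, rfl⟩, hQ⟩
    exact ⟨x, hx, y, hy, h0, h1, hQ⟩
  · rintro ⟨x, hx, y, hy, h0, h1, hQ⟩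
    exact ⟨_, ⟨x, hx, y, hy, h0, h1, rfl⟩, hQ⟩

end RamExpr

/-- The test evaluates to a truth value that satisfies `Q`. -/
def RamTest.wp (B : ℕ) (s : RamState) (b : RamTest) (Q : Bool → Prop) : Prop :=
  ∃ r, b.eval B s = some r ∧ Q r

namespace RamTest

variable {B : ℕ} {s : RamState} {Q : Bool → Prop} {e₁ e₂ : RamExpr}

theorem wp_le : (le e₁ e₂).wp B s Q ↔
    e₁.wp B s fun x => e₂.wp B s fun y => Q (decide (x ≤ y)) := by
  simp only [wp, RamExpr.wp, eval, Option.bind_eq_some_iff, Option.some.injEq]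
  constructor
  · rintro ⟨z, ⟨x, hx, y, hy, rfl⟩, hQ⟩
    exact ⟨x, hx, y, hy, hQ⟩
  · rintro ⟨x, hx, y, hy, hQ⟩
    exact ⟨_, ⟨x, hx, y, hy, rfl⟩, hQ⟩

theorem wp_lt : (lt e₁ e₂).wp B s Q ↔
    e₁.wp B s fun x => e₂.wp B s fun y => Q (decide (x < y)) := by
  simp only [wp, RamExpr.wp, eval, Option.bind_eq_some_iff, Option.some.injEq]
  constructor
  · rintro ⟨z, ⟨x, hx, y, hy, rfl⟩, hQ⟩
    exact ⟨x, hx, y, hy, hQ⟩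
  · rintro ⟨x, hx, y, hy, hQ⟩
    exact ⟨_, ⟨x, hx, y, hy, rfl⟩, hQ⟩

theorem wp_eq : (eq e₁ e₂).wp B s Q ↔
    e₁.wp B s fun x => e₂.wp B s fun y => Q (decide (x = y)) := by
  simp only [wp, RamExpr.wp, eval, Option.bind_eq_some_iff, Option.some.injEq]
  constructor
  · rintro ⟨z, ⟨x, hx, y, hy, rfl⟩, hQ⟩
    exact ⟨x, hx, y, hy, hQ⟩
  · rintro ⟨x, hx, y, hy, hQ⟩
    exact ⟨_, ⟨x, hx, y, hy, rfl⟩, hQ⟩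

end RamTest

/-- The state in which register `x` holds `z`. -/
def RamState.setReg (s : RamState) (x : ℕ) (z : ℤ) : RamState :=
  { s with reg := Function.update s.reg x z }

/-- The state in which the cell `k` of the array `a` holds `z`. -/
def RamState.setArr (s : RamState) (a k : ℕ) (z : ℤ) : RamState :=
  { s with arr := Function.update s.arr a (Function.update (s.arr a) k z) }

namespace RamState

variable (s : RamState) (x y a b k l : ℕ) (z : ℤ)

theorem reg_setReg : (s.setReg x z).reg y = if y = x then z else s.reg y := by
  simp [setReg, Function.update_apply]

theorem arr_setReg : (s.setReg x z).arr = s.arr := rfl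

theorem reg_setArr : (s.setArr a k z).reg = s.reg := rfl

theorem arr_setArr : (s.setArr a k z).arr b l =
    if b = a ∧ l = k then z else s.arr b l := by
  by_cases hb : b = a
  · subst hb
    simp [setArr, Function.update_apply]
  · simp [setArr, hb]

end RamState

namespace RamProgram

/-- The weakest precondition of a program without loops. -/
def wp (B : ℕ) : RamProgram → RamState → (RamState → Prop) → Prop
  | skip, s, Q => Q s
  | set x e, s, Q => e.wp B s fun z => Q (s.setReg x z)
  | put a i e, s, Q => i.wp B s fun k => 0 ≤ k ∧ e.wp B s fun z => Q (s.setArr a k.toNat z)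
  | seq c₁ c₂, s, Q => c₁.wp B s fun s' => c₂.wp B s' Q
  | ite b c₁ c₂, s, Q => b.wp B s fun r => if r then c₁.wp B s Q else c₂.wp B s Q
  | loop _ _, _, _ => False

/-- The largest number of steps of a program without loops. -/
def maxCost : RamProgram → ℕ
  | skip => 1
  | set _ e => e.cost + 1
  | put _ i e => i.cost + e.cost + 1
  | seq c₁ c₂ => c₁.maxCost + c₂.maxCost
  | ite b c₁ c₂ => b.cost + max c₁.maxCost c₂.maxCost
  | loop _ _ => 0

/-- Started in `s`, the program halts after at most `T` steps in a state that satisfies `Q`. -/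
def RunsWithin (B : ℕ) (c : RamProgram) (s : RamState) (T : ℕ) (Q : RamState → Prop) : Prop :=
  ∃ t s', Runs B c s t s' ∧ t ≤ T ∧ Q s'

variable {B : ℕ} {c c₁ c₂ : RamProgram} {s : RamState} {Q R : RamState → Prop} {T T₁ T₂ : ℕ}

theorem wp_mono (h : c.wp B s R) (hRQ : ∀ s', R s' → Q s') : c.wp B s Q := by
  induction c generalizing s R Q with
  | skip => exact hRQ _ h
  | set x e =>
    obtain ⟨z, hz, h⟩ := h
    exact ⟨z, hz, hRQ _ h⟩
  | put a i e =>
    obtain ⟨k, hk, h0, z, hz, h⟩ := h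
    exact ⟨k, hk, h0, z, hz, hRQ _ h⟩
  | seq c₁ c₂ ih₁ ih₂ => exact ih₁ h fun s' h' => ih₂ h' hRQ
  | ite b c₁ c₂ ih₁ ih₂ =>
    obtain ⟨r, hr, h⟩ := h
    refine ⟨r, hr, ?_⟩
    cases r
    · exact ih₂ h hRQ
    · exact ih₁ h hRQ
  | loop => exact h

/-- The cost of loop-free code is bounded by its text alone, so its time and its effect can be
treated separately. -/
theorem RunsWithin.of_wp (h : c.wp B s Q) : RunsWithin B c s c.maxCost Q := by
  induction c generalizing s Q with
  | skip => exact ⟨1, s, .skip s, le_rfl, h⟩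
  | set x e =>
    obtain ⟨z, hz, h⟩ := h
    exact ⟨_, _, .set s x e z hz, le_rfl, h⟩
  | put a i e =>
    obtain ⟨k, hk, h0, z, hz, h⟩ := h
    exact ⟨_, _, .put s a i e k.toNat z (by rwa [Int.toNat_of_nonneg h0]) hz, le_rfl, h⟩
  | seq c₁ c₂ ih₁ ih₂ =>
    obtain ⟨t₁, s₁, hr₁, ht₁, h₁⟩ := ih₁ h
    obtain ⟨t₂, s₂, hr₂, ht₂, h₂⟩ := ih₂ h₁
    exact ⟨_, _, .seq _ _ _ _ _ _ _ hr₁ hr₂, Nat.add_le_add ht₁ ht₂, h₂⟩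
  | ite b c₁ c₂ ih₁ ih₂ =>
    obtain ⟨r, hr, h⟩ := h
    cases r
    · obtain ⟨t, s', hrun, ht, h'⟩ := ih₂ h
      exact ⟨_, _, .iteFalse _ _ _ _ _ _ hr hrun,
        Nat.add_le_add_left (ht.trans (le_max_right _ _)) _, h'⟩
    · obtain ⟨t, s', hrun, ht, h'⟩ := ih₁ h
      exact ⟨_, _, .iteTrue _ _ _ _ _ _ hr hrun,
        Nat.add_le_add_left (ht.trans (le_max_left _ _)) _, h'⟩
  | loop => exact h.elim

theorem RunsWithin.mono (h : RunsWithin B c s T₁ R) (hT : T₁ ≤ T₂) (hRQ : ∀ s', R s' → Q s') :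
    RunsWithin B c s T₂ Q := by
  obtain ⟨t, s', hr, ht, h'⟩ := h
  exact ⟨t, s', hr, ht.trans hT, hRQ s' h'⟩

theorem RunsWithin.seq (h₁ : RunsWithin B c₁ s T₁ R)
    (h₂ : ∀ s', R s' → RunsWithin B c₂ s' T₂ Q) : RunsWithin B (.seq c₁ c₂) s (T₁ + T₂) Q := by
  obtain ⟨t₁, s₁, hr₁, ht₁, h'⟩ := h₁
  obtain ⟨t₂, s₂, hr₂, ht₂, h''⟩ := h₂ s₁ h'
  exact ⟨_, _, .seq _ _ _ _ _ _ _ hr₁ hr₂, Nat.add_le_add ht₁ ht₂, h''⟩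

/-- A loop with the invariant `I k`, where `k` is a variant and `F k` is the remaining time. -/
theorem RunsWithin.loop {b : RamTest} (I : ℕ → RamState → Prop) (F : ℕ → ℕ)
    (h : ∀ k s, I k s → b.wp B s fun r =>
      if r then ∃ T, b.cost + T ≤ F k ∧
        RunsWithin B c s T fun s' => ∃ k' < k, b.cost + T + F k' ≤ F k ∧ I k' s'
      else b.cost ≤ F k ∧ Q s)
    {k : ℕ} (hI : I k s) : RunsWithin B (.loop b c) s (F k) Q := by
  induction k using Nat.strong_induction_on generalizing s with
  | _ k ih =>
    obtain ⟨r, hr, h'⟩ := h k s hI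
    cases r
    · exact ⟨_, _, .loopFalse _ _ _ hr, h'.1, h'.2⟩
    · obtain ⟨T, -, t, s', hrun, ht, k', hk', hF, hI'⟩ := h'
      obtain ⟨t', s'', hrun', ht', hQ⟩ := ih k' hk' hI'
      exact ⟨_, _, .loopTrue _ _ _ _ _ _ _ hr hrun hrun', by omega, hQ⟩

end RamProgram

/-! ### Representation of the game and of a run in memory -/

/-- A weighted game graph with numbered edges `1, …, m` and a bound on its finite energies. -/
structure GameCode (n : ℕ) where
  G : GameGraph (Fin n)
  w : Fin n → Fin n → ℤ
  M : ℕ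
  m : ℕ
  src : ℕ → Fin n
  dst : ℕ → Fin n
  mem_edges : ∀ p, 1 ≤ p → p ≤ m → (src p, dst p) ∈ G.edges
  exists_index : ∀ u v, (u, v) ∈ G.edges → ∃ p, 1 ≤ p ∧ p ≤ m ∧ src p = u ∧ dst p = v

namespace GameCode

variable {n : ℕ} (c : GameCode n)

/-- The state contains the input. -/
structure Input (s : RamState) : Prop where
  reg0 : s.reg 0 = n
  reg1 : s.reg 1 = c.m
  reg2 : s.reg 2 = c.M
  arr0 : ∀ u : Fin n, s.arr 0 u = if u ∈ c.G.alice then 1 else 0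
  arr1 : ∀ p, 1 ≤ p → p ≤ c.m → s.arr 1 (p - 1) = (c.src p : ℕ)
  arr2 : ∀ p, 1 ≤ p → p ≤ c.m → s.arr 2 (p - 1) = (c.dst p : ℕ)
  arr3 : ∀ p, 1 ≤ p → p ≤ c.m → s.arr 3 (p - 1) = c.w (c.src p) (c.dst p)

/-- The state contains the linked lists of the edges `1, …, k`. -/
structure Links (k : ℕ) (s : RamState) : Prop where
  arr5 : ∀ v : Fin n, s.arr 5 v = lastIdx c.dst k v
  arr6 : ∀ p, 1 ≤ p → p ≤ k → s.arr 6 p = lastIdx c.dst (p - 1) (c.dst p)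
  arr7 : ∀ v : Fin n, s.arr 7 v = lastIdx c.src k v
  arr8 : ∀ p, 1 ≤ p → p ≤ k → s.arr 8 p = lastIdx c.src (p - 1) (c.src p)

/-- The parts of the state that never change after the preparation. -/
structure Static (s : RamState) : Prop where
  input : c.Input s
  links : c.Links c.m s

variable {c}

theorem Input.congr {s s' : RamState} (h : c.Input s)
    (hs : s'.reg 0 = s.reg 0 ∧ s'.reg 1 = s.reg 1 ∧ s'.reg 2 = s.reg 2 ∧ s'.arr 0 = s.arr 0 ∧
      s'.arr 1 = s.arr 1 ∧ s'.arr 2 = s.arr 2 ∧ s'.arr 3 = s.arr 3) : c.Input s' := by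
  obtain ⟨h0, h1, h2, h3, h4, h5, h6⟩ := hs
  constructor
  · rw [h0, h.reg0]
  · rw [h1, h.reg1]
  · rw [h2, h.reg2]
  · rw [h3]; exact h.arr0
  · rw [h4]; exact h.arr1
  · rw [h5]; exact h.arr2
  · rw [h6]; exact h.arr3

theorem Links.congr {k : ℕ} {s s' : RamState} (h : c.Links k s)
    (hs : s'.arr 5 = s.arr 5 ∧ s'.arr 6 = s.arr 6 ∧ s'.arr 7 = s.arr 7 ∧ s'.arr 8 = s.arr 8) :
    c.Links k s' := by
  obtain ⟨h5, h6, h7, h8⟩ := hs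
  constructor
  · rw [h5]; exact h.arr5
  · rw [h6]; exact h.arr6
  · rw [h7]; exact h.arr7
  · rw [h8]; exact h.arr8

theorem Static.congr {s s' : RamState} (h : c.Static s)
    (hs : s'.reg 0 = s.reg 0 ∧ s'.reg 1 = s.reg 1 ∧ s'.reg 2 = s.reg 2)
    (hs' : s'.arr 0 = s.arr 0 ∧ s'.arr 1 = s.arr 1 ∧ s'.arr 2 = s.arr 2 ∧ s'.arr 3 = s.arr 3 ∧
      s'.arr 5 = s.arr 5 ∧ s'.arr 6 = s.arr 6 ∧ s'.arr 7 = s.arr 7 ∧ s'.arr 8 = s.arr 8) :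
    c.Static s' :=
  ⟨h.input.congr ⟨hs.1, hs.2.1, hs.2.2, hs'.1, hs'.2.1, hs'.2.2.1, hs'.2.2.2.1⟩,
    h.links.congr hs'.2.2.2.2⟩

/-- The array contains the stack, from its bottom. -/
def StackRep (x : ℕ → ℤ) : List (Fin n) → Prop
  | [] => True
  | v :: l => x l.length = (v : ℕ) ∧ StackRep x l

theorem StackRep.congr {x y : ℕ → ℤ} {l : List (Fin n)} (h : StackRep x l)
    (hxy : ∀ i < l.length, y i = x i) : StackRep y l := by
  induction l with
  | nil => trivial
  | cons v l ih =>
    exact ⟨by rw [hxy _ (by simp), h.1], ih h.2 fun i hi => hxy i (by simp; omega)⟩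

variable (c)

/-- The data of a worklist run in units of `b`. -/
def liftData (b : ℕ) (cap : Fin n → ℕ) : LiftData (Fin n) where
  alice := c.G.alice
  m := c.m
  src := c.src
  dst := c.dst
  w := ceilWeight c.w b
  cap := cap

/-- The state `s` represents the state `a` of a worklist run in units of `b`. -/
structure LiftSim (b : ℕ) (cap : Fin n → ℕ) (z : ℤ) (a : LiftState (Fin n)) (s : RamState) :
    Prop where
  static : c.Static s
  reg3 : s.reg 3 = b
  reg4 : s.reg 4 = a.cur
  reg5 : s.reg 5 = a.stack.length
  reg6 : s.reg 6 = if a.flag then 1 else 0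
  reg11 : s.reg 11 = z
  arr4 : ∀ u : Fin n, s.arr 4 u = energyCode (a.f u)
  arr9 : ∀ u : Fin n, s.arr 9 u = cap u
  arr10 : ∀ u : Fin n, s.arr 10 u = a.ptr u
  arr11 : StackRep (s.arr 11) a.stack

theorem energyCode_top : energyCode ⊤ = -1 := rfl

theorem energyCode_natCast (k : ℕ) : energyCode k = k := rfl

theorem energyCode_eq_neg_one {x : ℕ∞} : energyCode x = -1 ↔ x = ⊤ := by
  cases x with
  | top => simp [energyCode_top]
  | coe k =>
    simp only [energyCode_natCast, ENat.natCast_ne_top, iff_false]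
    omega

end GameCode

/-! ### One worklist step as a program -/

namespace RamProgram

/-- Set register `9` to `0` if the edge in register `8` out of the node in register `7` is
satisfied, and to `1` otherwise. -/
def testEdge : RamProgram :=
  .seq (.set 9 (.const 1)) (.seq (.set 13 (.get 2 (.sub (.var 8) (.const 1))))
    (.ite (.eq (.get 4 (.var 7)) (.const (-1))) (.set 9 (.const 0))
      (.ite (.eq (.get 4 (.var 13)) (.const (-1))) .skip
        (.ite (.le (.get 4 (.var 13)) (.sub (.get 4 (.var 7))
          (.div (.sub (.const 0) (.get 3 (.sub (.var 8) (.const 1)))) (.var 3))))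
          (.set 9 (.const 0)) .skip))))

/-- Raise the node in register `7` by one unit. -/
def raiseNode : RamProgram :=
  .seq (.put 10 (.var 7) (.get 7 (.var 7))) (.seq (.put 11 (.var 5) (.var 7))
    (.seq (.set 5 (.add (.var 5) (.const 1)))
      (.ite (.lt (.get 4 (.var 7)) (.get 9 (.var 7)))
        (.put 4 (.var 7) (.add (.get 4 (.var 7)) (.const 1)))
        (.seq (.put 4 (.var 7) (.const (-1))) (.set 6 (.const 1))))))

/-- Take a node from the stack. -/
def popNode : RamProgram :=
  .seq (.set 5 (.sub (.var 5) (.const 1))) (.set 4 (.get 5 (.get 11 (.var 5))))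

/-- Process the edge in register `8` out of the node in register `7`. -/
def handleEdge : RamProgram :=
  .seq testEdge
    (.ite (.eq (.var 9) (.const 0)) (.set 4 (.get 6 (.var 4)))
      (.seq (.ite (.eq (.get 0 (.var 7)) (.const 0)) (.set 8 (.const 0))
          (.set 8 (.get 8 (.var 8))))
        (.ite (.eq (.var 8) (.const 0)) raiseNode (.put 10 (.var 7) (.var 8)))))

/-- One step of a worklist run. -/
def liftStep : RamProgram :=
  .ite (.eq (.var 4) (.const 0)) popNode
    (.seq (.set 7 (.get 1 (.sub (.var 4) (.const 1))))
      (.seq (.ite (.eq (.get 0 (.var 7)) (.const 0)) (.set 8 (.var 4)) (.set 8 (.get 10 (.var 7))))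
        handleEdge))

/-- The test for remaining work. -/
def liftTest : RamTest := .lt (.const 0) (.add (.var 4) (.var 5))

end RamProgram

namespace GameCode

open RamProgram RamState

variable {n : ℕ} {c : GameCode n} {b N wB : ℕ} {cap : Fin n → ℕ} {z : ℤ} {a : LiftState (Fin n)}
  {s : RamState}

/-- Bounds on the numbers of a worklist run. -/
structure Bounds (c : GameCode n) (N wB : ℕ) : Prop where
  word : 4 * N + 4 ≤ wB
  one_le : 1 ≤ N
  n_le : n ≤ N
  m_le : c.m ≤ N
  w_le : ∀ u v, (u, v) ∈ c.G.edges → (c.w u v).natAbs ≤ N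
  energy_le : 3 * c.M + 2 * n ≤ N
  potential_le : 7 * c.m * (c.M + 2 * n + 1) ≤ N

theorem natAbs_energyCode_le (hN : 1 ≤ N) {x : ℕ∞} (h : ∀ k : ℕ, x = k → k ≤ N) :
    (energyCode x).natAbs ≤ N := by
  cases x with
  | top => simpa [energyCode_top] using hN
  | coe k => simpa [energyCode_natCast] using h k rfl

theorem natAbs_ediv_le (x : ℤ) (k : ℕ) : (x / k).natAbs ≤ x.natAbs :=
  Int.natAbs_ediv_le_natAbs x k

/-- Subtracting the floor of `-w / b` adds the rounded-up weight, so no rounded weights need be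
stored. The value `-1` for `∞` requires separate branches at both ends of the edge. -/
theorem wp_testEdge (hB : Bounds c N wB) (hcap : ∀ u, cap u ≤ N)
    (hs : c.LiftSim b cap z a s) (hb : 0 < b) (hbN : b ≤ N) (ha : a.Inv (c.liftData b cap))
    {u : Fin n} {p : ℕ} (hp : 1 ≤ p) (hpm : p ≤ c.m) (hsrc : c.src p = u)
    (h7 : s.reg 7 = (u : ℕ)) (h8 : s.reg 8 = p) {Q : RamState → Prop}
    (hQ : ∀ s', s'.arr = s.arr → (∀ x, x ≠ 9 → x ≠ 13 → s'.reg x = s.reg x) →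
      (s'.reg 9 = 0 ↔ EdgeOk (ceilWeight c.w b) a.f u (c.dst p)) →
      (s'.reg 9).natAbs ≤ 1 → Q s') :
    testEdge.wp wB s Q := by
  have hwB := hB.word
  have hm := hB.m_le
  have hn := hB.n_le
  have h2 := hs.static.input.arr2 p hp hpm
  have h3 := hs.static.input.arr3 p hp hpm
  have hw := hB.w_le _ _ (c.mem_edges p hp hpm)
  have hdiv := natAbs_ediv_le (-c.w u (c.dst p)) b
  rw [hsrc] at h3 hw
  have hfu := natAbs_energyCode_le hB.one_le fun k hk => (ha.le_cap u k hk).trans (hcap u)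
  have hfd := natAbs_energyCode_le hB.one_le
    fun k hk => (ha.le_cap (c.dst p) k hk).trans (hcap (c.dst p))
  have hul := u.isLt
  have hdl := (c.dst p).isLt
  have hidx : ((p : ℤ) - 1).toNat = p - 1 := by omega
  simp only [testEdge, RamProgram.wp, RamExpr.wp_const, RamExpr.wp_var, RamExpr.wp_get,
    RamExpr.wp_sub, RamExpr.wp_div, RamTest.wp_eq, RamTest.wp_le, reg_setReg, arr_setReg]
  simp [h7, h8, hidx, h2, h3, hs.arr4, hs.reg3]
  -- The conjuncts peeled off here, and likewise in the later programs, are word-size and index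
  -- conditions.
  repeat refine And.intro (by omega) ?_
  have frame : ∀ x y : ℤ, ((s.setReg 9 x).setReg 13 y).arr = s.arr ∧
      ∀ r, r ≠ 9 → r ≠ 13 → ((s.setReg 9 x).setReg 13 y).reg r = s.reg r := by
    intro x y
    refine ⟨rfl, fun r h9 h13 => ?_⟩
    simp [reg_setReg, h9, h13]
  have frame' : ∀ x y t : ℤ, (((s.setReg 9 x).setReg 13 y).setReg 9 t).arr = s.arr ∧
      ∀ r, r ≠ 9 → r ≠ 13 → (((s.setReg 9 x).setReg 13 y).setReg 9 t).reg r = s.reg r := by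
    intro x y t
    refine ⟨rfl, fun r h9 h13 => ?_⟩
    simp [reg_setReg, h9, h13]
  split
  · rename_i htop
    rw [energyCode_eq_neg_one] at htop
    refine hQ _ (frame' _ _ _).1 (frame' _ _ _).2 ?_ (by simp [reg_setReg])
    simpa [reg_setReg] using EdgeOk.of_top htop
  · rename_i htop
    rw [energyCode_eq_neg_one] at htop
    obtain ⟨x, hx⟩ := ENat.ne_top_iff_exists.mp htop
    repeat refine And.intro (by omega) ?_
    split
    · rename_i htop'
      rw [energyCode_eq_neg_one] at htop'
      refine hQ _ (frame _ _).1 (frame _ _).2 ?_ (by simp [reg_setReg])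
      suffices ¬EdgeOk (ceilWeight c.w b) a.f u (c.dst p) by simpa [reg_setReg] using this
      intro h
      obtain ⟨y, hy, -⟩ := h x hx.symm
      simp [htop'] at hy
    · rename_i htop'
      rw [energyCode_eq_neg_one] at htop'
      obtain ⟨y, hy⟩ := ENat.ne_top_iff_exists.mp htop'
      have key : EdgeOk (ceilWeight c.w b) a.f u (c.dst p) ↔
          energyCode (a.f (c.dst p)) ≤ energyCode (a.f u) - -c.w u (c.dst p) / b := by
        rw [← hx, ← hy, energyCode_natCast, energyCode_natCast]
        constructor
        · intro h
          obtain ⟨y', hy', hle⟩ := h x hx.symm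
          rw [← hy, Nat.cast_inj] at hy'
          subst hy'
          rw [ceilWeight] at hle
          linarith
        · intro h x' hx'
          rw [← hx, Nat.cast_inj] at hx'
          subst hx'
          exact ⟨y, hy.symm, by rw [ceilWeight]; linarith⟩
      repeat refine And.intro (by omega) ?_
      split
      · rename_i hle
        refine hQ _ (frame' _ _ _).1 (frame' _ _ _).2 ?_ (by simp [reg_setReg])
        rw [key]
        simpa [reg_setReg] using hle
      · rename_i hle
        refine hQ _ (frame _ _).1 (frame _ _).2 ?_ (by simp [reg_setReg])
        rw [key]
        simpa [reg_setReg] using hle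

theorem LiftSim.congr {s' : RamState} (hs : c.LiftSim b cap z a s) (harr : s'.arr = s.arr)
    (hreg : ∀ x, x ≠ 7 → x ≠ 8 → x ≠ 9 → x ≠ 13 → s'.reg x = s.reg x) :
    c.LiftSim b cap z a s' := by
  refine ⟨hs.static.congr ⟨hreg _ ?_ ?_ ?_ ?_, hreg _ ?_ ?_ ?_ ?_, hreg _ ?_ ?_ ?_ ?_⟩ ?_,
    ?_, ?_, ?_, ?_, ?_, ?_, ?_, ?_, ?_⟩
  -- The first 12 goals are the register inequalities, four for each of the registers `0`, `1`, `2`;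
  -- they are decided at the end.
  on_goal 13 => simp [harr]
  on_goal 13 => rw [hreg _ (by decide) (by decide) (by decide) (by decide), hs.reg3]
  on_goal 13 => rw [hreg _ (by decide) (by decide) (by decide) (by decide), hs.reg4]
  on_goal 13 => rw [hreg _ (by decide) (by decide) (by decide) (by decide), hs.reg5]
  on_goal 13 => rw [hreg _ (by decide) (by decide) (by decide) (by decide), hs.reg6]
  on_goal 13 => rw [hreg _ (by decide) (by decide) (by decide) (by decide), hs.reg11]
  on_goal 13 => rw [harr]; exact hs.arr4
  on_goal 13 => rw [harr]; exact hs.arr9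
  on_goal 13 => rw [harr]; exact hs.arr10
  on_goal 13 => rw [harr]; exact hs.arr11
  all_goals decide

theorem wp_popNode (hB : Bounds c N wB) (hs : c.LiftSim b cap z a s)
    {v : Fin n} {l : List (Fin n)} (hst : a.stack = v :: l) (hlen : a.stack.length ≤ N) :
    popNode.wp wB s (c.LiftSim b cap z (a.pop (c.liftData b cap) v l)) := by
  have hwB := hB.word
  have hm := hB.m_le
  have hn := hB.n_le
  have h5 := hs.reg5
  have h11 := hs.arr11
  rw [hst] at h5 h11 hlen
  simp only [List.length_cons] at h5 hlen
  have hv := v.isLt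
  have hle := lastIdx_le c.dst c.m v
  simp only [popNode, RamProgram.wp, RamExpr.wp_const, RamExpr.wp_var, RamExpr.wp_get,
    RamExpr.wp_sub, reg_setReg, arr_setReg]
  simp [h5, h11.1, hs.static.links.arr5]
  repeat refine And.intro (by omega) ?_
  exact ⟨hs.static.congr ⟨rfl, rfl, rfl⟩ ⟨rfl, rfl, rfl, rfl, rfl, rfl, rfl, rfl⟩, hs.reg3,
    rfl, rfl, hs.reg6, hs.reg11, hs.arr4, hs.arr9, hs.arr10, h11.2⟩

theorem wp_raiseNode (hB : Bounds c N wB) (hcap : ∀ u, cap u ≤ N)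
    (hs : c.LiftSim b cap z a s) (ha : a.Inv (c.liftData b cap)) {u : Fin n}
    (h7 : s.reg 7 = (u : ℕ)) (hlen : a.stack.length ≤ N) (htop : a.f u ≠ ⊤) :
    raiseNode.wp wB s (c.LiftSim b cap z (a.raise (c.liftData b cap) u)) := by
  have hwB := hB.word
  have hm := hB.m_le
  have hn := hB.n_le
  have hu := u.isLt
  have hle := lastIdx_le c.src c.m u
  have hcu := hcap u
  obtain ⟨x, hx⟩ := ENat.ne_top_iff_exists.mp htop
  have hxc : x ≤ cap u := ha.le_cap u x hx.symm
  have hne : ∀ v : Fin n, ((v : ℕ) = u) ↔ v = u := fun v => Fin.ext_iff.symm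
  have stack : ∀ t : ℕ → ℤ, (∀ i, t i = if i = a.stack.length then ((u : ℕ) : ℤ) else s.arr 11 i) →
      StackRep t (u :: a.stack) := by
    intro t ht
    refine ⟨by simp [ht], hs.arr11.congr fun i hi => ?_⟩
    rw [ht, if_neg (by omega)]
  simp only [raiseNode, RamProgram.wp, RamExpr.wp_const, RamExpr.wp_var, RamExpr.wp_get,
    RamExpr.wp_add, RamTest.wp_lt, reg_setReg, arr_setReg, reg_setArr, arr_setArr]
  simp [h7, hs.reg5, hs.arr4, hs.arr9, hs.static.links.arr7, ← hx, energyCode_natCast]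
  repeat refine And.intro (by omega) ?_
  have hbump : bump (cap u) (a.f u) = if x < cap u then ((x + 1 : ℕ) : ℕ∞) else ⊤ := by
    rw [bump, ← hx]
    simp only [Nat.cast_lt]
    push_cast
    rfl
  split
  · rename_i hlt
    rw [if_pos hlt] at hbump
    repeat refine And.intro (by omega) ?_
    refine ⟨hs.static.congr ⟨rfl, rfl, rfl⟩ ⟨?_, ?_, ?_, ?_, ?_, ?_, ?_, ?_⟩, ?_, ?_, ?_, ?_, ?_,
      fun v => ?_, fun v => ?_, fun v => ?_, stack _ fun i => ?_⟩
    -- Goals 1 to 13 are the unchanged arrays and the registers. Goal 14 concerns the values; once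
    -- it is closed, goal 15 concerns the candidate edges. These two need a case split on the raised
    -- node.
    on_goal 14 =>
      by_cases hv : v = u
      · subst hv
        simp [arr_setArr, arr_setReg, LiftState.raise, liftData, hbump, -Nat.cast_add,
          energyCode_natCast]
      · simp [arr_setArr, arr_setReg, LiftState.raise, hv, hne, hs.arr4]
    on_goal 15 =>
      by_cases hv : v = u
      · subst hv
        simp [arr_setArr, arr_setReg, LiftState.raise, liftData]
      · simp [arr_setArr, arr_setReg, LiftState.raise, hv, hne, hs.arr10]
    all_goals simp [funext_iff, reg_setReg, arr_setReg, reg_setArr, arr_setArr, LiftState.raise,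
      hs.reg3, hs.reg4, hs.reg5, hs.reg6, hs.reg11, hs.arr9, liftData, ← hx, hlt]
  · rename_i hlt
    rw [if_neg hlt] at hbump
    repeat refine And.intro (by omega) ?_
    refine ⟨hs.static.congr ⟨rfl, rfl, rfl⟩ ⟨?_, ?_, ?_, ?_, ?_, ?_, ?_, ?_⟩, ?_, ?_, ?_, ?_, ?_,
      fun v => ?_, fun v => ?_, fun v => ?_, stack _ fun i => ?_⟩
    on_goal 14 =>
      by_cases hv : v = u
      · subst hv
        simp [arr_setArr, arr_setReg, LiftState.raise, liftData, hbump, energyCode_top]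
      · simp [arr_setArr, arr_setReg, LiftState.raise, hv, hne, hs.arr4]
    on_goal 15 =>
      by_cases hv : v = u
      · subst hv
        simp [arr_setArr, arr_setReg, LiftState.raise, liftData]
      · simp [arr_setArr, arr_setReg, LiftState.raise, hv, hne, hs.arr10]
    all_goals simp [funext_iff, reg_setReg, arr_setReg, reg_setArr, arr_setArr, LiftState.raise,
      hs.reg3, hs.reg4, hs.reg5, hs.reg6, hs.reg11, hs.arr9, liftData, ← hx, hlt]

/-- The effect of a step of a worklist run. -/
structure StepPost (c : GameCode n) (b : ℕ) (cap : Fin n → ℕ) (z : ℤ) (a : LiftState (Fin n))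
    (s' : RamState) (a' : LiftState (Fin n)) : Prop where
  sim : c.LiftSim b cap z a' s'
  inv : a'.Inv (c.liftData b cap)
  potential : a'.potential (c.liftData b cap) + 1 ≤ a.potential (c.liftData b cap)
  lower : ∀ (K S : Prop) (g f₀), (c.liftData b cap).Solution g →
    (K → ∀ u, g u ≤ cap u ∨ g u = ⊤) → (S → ∀ u, f₀ u ≠ ⊤ → g u ≤ cap u) →
    a.LowerInv K S g f₀ → a'.LowerInv K S g f₀

/-- The branches of the program realise exactly `pop`, `drop`, `advance` and `raise`; only `raise`
changes values, and it happens only at forced nodes. -/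
theorem wp_liftStep (hB : Bounds c N wB) (hcap : ∀ u, cap u ≤ N)
    (hs : c.LiftSim b cap z a s) (hb : 0 < b) (hbN : b ≤ N) (ha : a.Inv (c.liftData b cap))
    (hpot : a.potential (c.liftData b cap) ≤ N) (hwork : a.cur ≠ 0 ∨ a.stack ≠ []) :
    liftStep.wp wB s fun s' => ∃ a', StepPost c b cap z a s' a' := by
  have hwB := hB.word
  have hm := hB.m_le
  have hn := hB.n_le
  have hlen := (LiftState.length_stack_le_potential (D := c.liftData b cap) (a := a)).trans hpot
  have hcm : a.cur ≤ c.m := ha.cur_le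
  by_cases hc : a.cur = 0
  · have hne := hwork.resolve_left (not_not.mpr hc)
    obtain ⟨v, l, hst⟩ := List.exists_cons_of_ne_nil hne
    -- Only the outer test is unfolded, so that `popNode` stays intact for `wp_popNode`.
    simp only [liftStep, RamProgram.wp.eq_5, RamTest.wp_eq, RamExpr.wp_const, RamExpr.wp_var]
    simp only [hs.reg4, hc]
    simp only [Nat.cast_zero, Int.natAbs_zero, zero_le, decide_true, if_true, true_and]
    refine RamProgram.wp_mono (wp_popNode hB hs hst hlen) fun s' hs' => ?_
    exact ⟨_, hs', ha.pop hst hc, LiftState.potential_pop hst hc,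
      fun _ _ _ _ _ _ _ h => ⟨h.le, h.start_le, h.flag⟩⟩
  · set u := c.src a.cur with hudef
    have hu := u.isLt
    have hsrc := hs.static.input.arr1 a.cur (by omega) hcm
    have hidx : ((a.cur : ℤ) - 1).toNat = a.cur - 1 := by omega
    have hptr := ha.ptr_le u
    have hptr1 := ha.one_le_ptr u
    have hsrcptr : c.src (a.ptr u) = u := ha.src_ptr u
    change a.ptr u ≤ c.m at hptr
    -- Both owners continue with the same code; they differ only in the tested edge `p`, the
    -- candidate for Alice and the current edge for Bob.
    have main : ∀ (s₁ : RamState) (p : ℕ), s₁.arr = s.arr →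
        (∀ x, x ≠ 7 → x ≠ 8 → s₁.reg x = s.reg x) → s₁.reg 7 = (u : ℕ) → s₁.reg 8 = p →
        (if u ∈ c.G.alice then a.ptr u else a.cur) = p →
        handleEdge.wp wB s₁
          fun s' => ∃ a', StepPost c b cap z a s' a' := by
      intro s₁ p harr hreg h7 h8 hp
      have hs₁ : c.LiftSim b cap z a s₁ := hs.congr harr fun x h1 h2 _ _ => hreg x h1 h2
      have hp1 : 1 ≤ p := by
        rw [← hp]
        split <;> omega
      have hpm : p ≤ c.m := by
        rw [← hp]
        split <;> omega
      have hpsrc : c.src p = u := by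
        rw [← hp]
        split
        · exact hsrcptr
        · rfl
      refine wp_testEdge hB hcap hs₁ hb hbN ha hp1 hpm hpsrc h7 h8 ?_
      intro s₂ harr₂ hreg₂ h9 h9'
      have hs₂ : c.LiftSim b cap z a s₂ := hs₁.congr harr₂ fun x _ _ h1 h2 => hreg₂ x h1 h2
      have h7' : s₂.reg 7 = (u : ℕ) := by rw [hreg₂ _ (by decide) (by decide), h7]
      have h8' : s₂.reg 8 = p := by rw [hreg₂ _ (by decide) (by decide), h8]
      have hin := hs₂.static.links.arr6 a.cur (by omega) hcm
      have hinle := lastIdx_le c.dst (a.cur - 1) (c.dst a.cur)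
      have hout := hs₂.static.links.arr8 p hp1 hpm
      have houtle := lastIdx_le c.src (p - 1) (c.src p)
      rw [hpsrc] at hout houtle
      simp only [RamProgram.wp, RamExpr.wp_const, RamExpr.wp_var, RamExpr.wp_get, RamTest.wp_eq]
      by_cases hok : EdgeOk (ceilWeight c.w b) a.f u (c.dst p)
      · have h90 := h9.mpr hok
        simp only [h90]
        simp [hs₂.reg4, hin]
        refine ⟨by omega, by omega, a.drop (c.liftData b cap), ?_, ?_, ?_, ?_⟩
        · exact ⟨hs₂.static.congr ⟨rfl, rfl, rfl⟩ ⟨rfl, rfl, rfl, rfl, rfl, rfl, rfl, rfl⟩,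
            hs₂.reg3, rfl, hs₂.reg5, hs₂.reg6, hs₂.reg11, hs₂.arr4, hs₂.arr9, hs₂.arr10,
            hs₂.arr11⟩
        · refine ha.drop fun p' hp' => ?_
          have : p' = p := hp'.symm.trans hp
          subst this
          exact hok
        · exact LiftState.potential_drop hc
        · exact fun _ _ _ _ _ _ _ h => ⟨h.le, h.start_le, h.flag⟩
      · have h90 := mt h9.mp hok
        have htop : a.f u ≠ ⊤ := fun h => hok (.of_top h)
        simp only [h90]
        have raise : ∀ s₃ : RamState, s₃.arr = s₂.arr → (∀ x, x ≠ 8 → s₃.reg x = s₂.reg x) →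
            LiftState.Forced (c.liftData b cap) a u →
            raiseNode.wp wB s₃ fun s' => ∃ a', StepPost c b cap z a s' a' := by
          intro s₃ harr₃ hreg₃ hF
          have hs₃ : c.LiftSim b cap z a s₃ := hs₂.congr harr₃ fun x _ h1 _ _ => hreg₃ x h1
          refine RamProgram.wp_mono (wp_raiseNode hB hcap hs₃ ha
            (by rw [hreg₃ _ (by decide), h7']) hlen htop) fun s' hs' => ?_
          exact ⟨_, hs', ha.raise hc, LiftState.potential_raise ha htop,
            fun _ _ _ _ hg hK hS h => h.raise hF hg hK hS⟩
        by_cases hal : u ∈ c.G.alice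
        · rw [if_pos hal] at hp
          subst hp
          simp [h7', h8', hs₂.static.input.arr0, hal, hout, reg_setReg, arr_setReg]
          repeat refine And.intro (by omega) ?_
          split
          · rename_i hz
            exact raise _ rfl (fun x hx => by simp [reg_setReg, hx])
              (ha.forced_of_alice hal hok hz)
          · rename_i hz
            refine ⟨by omega, by omega, a.advance (c.liftData b cap) u, ?_,
              ha.advance hc hok hz, LiftState.potential_advance ha u,
              fun _ _ _ _ _ _ _ h => ⟨h.le, h.start_le, h.flag⟩⟩
            refine ⟨hs₂.static.congr ⟨rfl, rfl, rfl⟩ ⟨rfl, rfl, rfl, rfl, rfl, rfl, rfl, rfl⟩,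
              hs₂.reg3, hs₂.reg4, hs₂.reg5, hs₂.reg6, hs₂.reg11, hs₂.arr4, hs₂.arr9,
              fun v => ?_, hs₂.arr11⟩
            by_cases hv : v = u
            · subst hv
              simp [arr_setArr, arr_setReg, LiftState.advance, liftData]
            · simp [arr_setArr, arr_setReg, LiftState.advance, hv, ← Fin.ext_iff, hs₂.arr10]
        · rw [if_neg hal] at hp
          simp [h7', hs₂.static.input.arr0, hal, reg_setReg, arr_setReg]
          repeat refine And.intro (by omega) ?_
          refine raise _ rfl (fun x hx => by simp [reg_setReg, hx]) ⟨htop, ?_⟩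
          rw [if_neg (show u ∉ (c.liftData b cap).alice from hal)]
          exact ⟨p, hp1, hpm, hpsrc, hok⟩
    simp only [liftStep, RamProgram.wp, RamTest.wp_eq, RamExpr.wp_const, RamExpr.wp_var,
      RamExpr.wp_get, RamExpr.wp_sub, hs.reg4, reg_setReg, arr_setReg]
    simp [hc, hidx, hsrc, hs.static.input.arr0, hs.arr10, ← hudef]
    repeat refine And.intro (by omega) ?_
    have frame : ∀ x y : ℤ, ∀ r, r ≠ 7 → r ≠ 8 →
        ((s.setReg 7 x).setReg 8 y).reg r = s.reg r := by
      intro x y r h1 h2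
      simp [reg_setReg, h1, h2]
    split
    · rename_i hal
      repeat refine And.intro (by omega) ?_
      exact main _ _ rfl (frame _ _) (by simp [reg_setReg]) (by simp [reg_setReg]) (if_pos hal)
    · rename_i hal
      repeat refine And.intro (by omega) ?_
      exact main _ _ rfl (frame _ _) (by simp [reg_setReg]) (by simp [reg_setReg]) (if_neg hal)

end GameCode

/-! ### Complete worklist runs -/

theorem LiftState.Inv.solution {V : Type*} [DecidableEq V] {D : LiftData V} {a : LiftState V}
    (h : a.Inv D) (hc : a.cur = 0) (hs : a.stack = []) : D.Solution a.f := by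
  refine ⟨fun u hu => ?_, fun u hu p hp hpm hsrc => ?_⟩
  · refine ⟨a.ptr u, h.one_le_ptr u, h.ptr_le u, h.src_ptr u, ?_⟩
    rcases h.alice u hu with h1 | h1 | ⟨p, h1, h2, -⟩
    · exact h1
    · simp [hs] at h1
    · omega
  · rcases h.bob u hu p hp hpm hsrc with h1 | h1 | ⟨h1, -⟩
    · exact h1
    · simp [hs] at h1
    · omega

/-- A worklist run. -/
def RamProgram.liftLoop : RamProgram := .loop liftTest liftStep

namespace GameCode

open RamProgram RamState

variable {n : ℕ} {c : GameCode n} {b N wB : ℕ} {cap : Fin n → ℕ} {z : ℤ} {a : LiftState (Fin n)}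
  {s : RamState}

/-- The potential is the variant. The lower invariant is transported for all parameters at once, so
that first and later phases can instantiate it differently. -/
theorem runsWithin_liftLoop (hB : Bounds c N wB) (hcap : ∀ u, cap u ≤ N)
    (hs : c.LiftSim b cap z a s) (hb : 0 < b) (hbN : b ≤ N) (ha : a.Inv (c.liftData b cap))
    (hpot : a.potential (c.liftData b cap) ≤ N) :
    RunsWithin wB liftLoop s
      ((liftTest.cost + liftStep.maxCost) * a.potential (c.liftData b cap) + liftTest.cost)
      fun s' => ∃ a', c.LiftSim b cap z a' s' ∧ (c.liftData b cap).Solution a'.f ∧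
        (∀ u (x : ℕ), a'.f u = x → x ≤ cap u) ∧
        ∀ (K S : Prop) (g f₀), (c.liftData b cap).Solution g →
          (K → ∀ u, g u ≤ cap u ∨ g u = ⊤) → (S → ∀ u, f₀ u ≠ ⊤ → g u ≤ cap u) →
          a.LowerInv K S g f₀ → a'.LowerInv K S g f₀ := by
  set D := c.liftData b cap with hD
  refine RunsWithin.loop (fun k s => ∃ a', c.LiftSim b cap z a' s ∧ a'.Inv D ∧
    a'.potential D = k ∧ k ≤ N ∧ ∀ (K S : Prop) (g f₀), D.Solution g →
      (K → ∀ u, g u ≤ cap u ∨ g u = ⊤) → (S → ∀ u, f₀ u ≠ ⊤ → g u ≤ cap u) →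
      a.LowerInv K S g f₀ → a'.LowerInv K S g f₀)
    (fun k => (liftTest.cost + liftStep.maxCost) * k + liftTest.cost) ?_
    ⟨a, hs, ha, rfl, hpot, fun _ _ _ _ _ _ _ h => h⟩
  rintro k s ⟨a', hs', ha', hk, hkN, hlow⟩
  have hwB := hB.word
  have hm := hB.m_le
  have hlen := LiftState.length_stack_le_potential (D := D) (a := a')
  have hcm : a'.cur ≤ c.m := ha'.cur_le
  have test : ∀ R : Bool → Prop, R (decide ((0 : ℤ) < a'.cur + a'.stack.length)) →
      liftTest.wp wB s R := by
    intro R hR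
    rw [liftTest, RamTest.wp_lt, RamExpr.wp_const, RamExpr.wp_add, RamExpr.wp_var, RamExpr.wp_var,
      hs'.reg4, hs'.reg5]
    exact ⟨by simp, by omega, by omega, by omega, hR⟩
  refine test _ ?_
  by_cases hwork : (0 : ℤ) < a'.cur + a'.stack.length
  · simp only [hwork, decide_true, if_true]
    have hw : a'.cur ≠ 0 ∨ a'.stack ≠ [] := by
      by_contra! h
      simp [h.1, h.2] at hwork
    have hstep := RunsWithin.of_wp (wp_liftStep hB hcap hs' hb hbN ha' (hk ▸ hkN) hw)
    have hk0 : 1 ≤ k := by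
      by_contra! h0
      obtain ⟨t, s', -, -, a'', h''⟩ := hstep
      have := h''.potential
      rw [← hD] at this
      omega
    obtain ⟨k, rfl⟩ := Nat.exists_eq_add_of_le' hk0
    refine ⟨liftStep.maxCost, ?_, hstep.mono le_rfl ?_⟩
    · rw [mul_add, mul_one]
      omega
    · rintro s' ⟨a'', h''⟩
      have hpot' := h''.potential
      rw [← hD] at hpot'
      refine ⟨a''.potential D, by omega, ?_, a'', h''.sim, h''.inv, rfl, by omega,
        fun K S g f₀ hg hK hS h => h''.lower K S g f₀ hg hK hS (hlow K S g f₀ hg hK hS h)⟩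
      have : (liftTest.cost + liftStep.maxCost) * (a''.potential D) ≤
        (liftTest.cost + liftStep.maxCost) * k := Nat.mul_le_mul_left _ (by omega)
      rw [mul_add, mul_one]
      omega
  · simp only [hwork, decide_false, Bool.false_eq_true, if_false]
    refine ⟨by omega, a', hs', ha'.solution ?_ ?_, ha'.le_cap, hlow⟩
    · omega
    · rw [← List.length_eq_zero_iff]
      omega

end GameCode

/-! ### Preparation: list building, first guess, initial values -/

namespace RamProgram

/-- Run `body` for the values `0, 1, …` of register `10` below the value of register `r`. -/
def forLoop (r : ℕ) (body : RamProgram) : RamProgram :=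
  .seq (.set 10 (.const 0)) (.loop (.lt (.var 10) (.var r))
    (.seq body (.set 10 (.add (.var 10) (.const 1)))))

/-- Insert the next edge into the linked lists. -/
def linkEdge : RamProgram :=
  .seq (.set 9 (.add (.var 10) (.const 1))) (.seq (.set 7 (.get 2 (.var 10)))
    (.seq (.put 6 (.var 9) (.get 5 (.var 7))) (.seq (.put 5 (.var 7) (.var 9))
      (.seq (.set 7 (.get 1 (.var 10))) (.seq (.put 8 (.var 9) (.get 7 (.var 7)))
        (.put 7 (.var 7) (.var 9)))))))

/-- Reset the candidate edge of a node and put the node onto the stack. -/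
def resetNode : RamProgram :=
  .seq (.put 10 (.var 10) (.get 7 (.var 10))) (.put 11 (.var 10) (.var 10))

/-- Prepare a node for the first worklist run. -/
def firstNode : RamProgram :=
  .seq (.put 4 (.var 10) (.const 0)) (.seq (.put 9 (.var 10) (.div (.var 2) (.var 3))) resetNode)

/-- Prepare a node for the next worklist run, in units that are half as large. -/
def nextNode : RamProgram :=
  .seq (.ite (.eq (.get 4 (.var 10)) (.const (-1))) (.put 9 (.var 10) (.const 0))
    (.seq (.put 4 (.var 10) (.mul (.const 2) (.get 4 (.var 10))))
      (.put 9 (.var 10) (.add (.get 4 (.var 10)) (.mul (.const 2) (.var 0)))))) resetNode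

/-- Double register `11` while it is at most `M / (2 n)`. -/
def initGuess : RamProgram :=
  .seq (.set 11 (.const 1)) (.loop (.le (.mul (.mul (.const 2) (.var 11)) (.var 0)) (.var 2))
    (.set 11 (.mul (.const 2) (.var 11))))

variable {wB : ℕ} {s : RamState}

/-- Per round, `7` is the test (`3`) and the increment (`4`); `5` is the initialisation (`2`) and
the last test (`3`). -/
theorem runsWithin_forLoop {r k : ℕ} {body : RamProgram} (J : ℕ → RamState → Prop)
    (hk : k + 1 ≤ wB) (h0 : J 0 (s.setReg 10 0)) (hreg : ∀ i s, J i s → s.reg r = k)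
    (hstep : ∀ i < k, ∀ s, J i s → s.reg 10 = i → body.wp wB s fun s' =>
      s'.reg 10 = i ∧ J (i + 1) (s'.setReg 10 (i + 1))) :
    RunsWithin wB (forLoop r body) s ((body.maxCost + 7) * k + 5) (J k) := by
  have hset : RunsWithin wB (.set 10 (.const 0)) s 2 (fun s' => J 0 s' ∧ s'.reg 10 = 0) := by
    refine RunsWithin.of_wp (c := .set 10 (.const 0)) ?_
    simp only [RamProgram.wp, RamExpr.wp_const]
    exact ⟨by simp, h0, by simp [RamState.reg_setReg]⟩
  rw [Nat.add_comm ((body.maxCost + 7) * k), show 5 = 2 + 3 from rfl, Nat.add_assoc,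
    Nat.add_comm 3]
  refine hset.seq fun s₁ hs₁ => ?_
  refine RunsWithin.loop (fun q s => ∃ i : ℕ, i + q = k ∧ J i s ∧ s.reg 10 = i)
    (fun q => (body.maxCost + 7) * q + 3) ?_ ⟨0, by simp, hs₁.1, by simpa using hs₁.2⟩
  rintro q s ⟨i, hi, hJ, h10⟩
  have hr := hreg i s hJ
  simp only [RamTest.wp_lt, RamExpr.wp_var, h10, hr, RamTest.cost, RamExpr.cost]
  refine ⟨by omega, by omega, ?_⟩
  by_cases hlt : i < k
  · simp only [Nat.cast_lt, hlt, decide_true, if_true]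
    obtain ⟨q, rfl⟩ := Nat.exists_eq_add_of_lt (by omega : 0 < q)
    refine ⟨body.maxCost + 4, by rw [mul_add]; omega, ?_⟩
    refine RunsWithin.seq (T₂ := 4) (RunsWithin.of_wp (hstep i hlt s hJ h10)) ?_
    rintro s' ⟨h10', hJ'⟩
    refine RunsWithin.of_wp (c := .set 10 (.add (.var 10) (.const 1))) ?_
    simp only [RamProgram.wp, RamExpr.wp_add, RamExpr.wp_var, RamExpr.wp_const, h10']
    refine ⟨by omega, by simp; omega, by omega, q, by omega, ?_, i + 1, by omega, hJ', ?_⟩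
    · rw [zero_add, mul_add]
      omega
    · simp [RamState.reg_setReg]
  · simp only [Nat.cast_lt, hlt, decide_false, Bool.false_eq_true, if_false]
    obtain rfl : i = k := by omega
    exact ⟨by omega, hJ⟩

end RamProgram

namespace GameCode

open RamProgram RamState

variable {n : ℕ} {c : GameCode n} {b N wB : ℕ} {cap : Fin n → ℕ} {z : ℤ} {a : LiftState (Fin n)}
  {s : RamState}

/-- Each edge is put in front of two lists: the old head becomes its successor and its own number
the new head. Numbering from `1` leaves `0` as the end marker, which the zero-initialised memory
already provides. -/
theorem runsWithin_buildLists (hB : Bounds c N wB) (hs : c.Input s) (hl : c.Links 0 s) :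
    RunsWithin wB (forLoop 1 linkEdge) s ((linkEdge.maxCost + 7) * c.m + 5) c.Static := by
  have hwB := hB.word
  have hm := hB.m_le
  have hn := hB.n_le
  refine (runsWithin_forLoop (fun i s => c.Input s ∧ c.Links i s) (by omega) ⟨?_, ?_⟩
    (fun i s h => h.1.reg1) ?_).mono le_rfl fun s' h => ⟨h.1, h.2⟩
  · exact hs.congr ⟨rfl, rfl, rfl, rfl, rfl, rfl, rfl⟩
  · exact hl.congr ⟨rfl, rfl, rfl, rfl⟩
  rintro i hi s ⟨hs, hl⟩ h10
  have h1 := hs.arr1 (i + 1) (by omega) (by omega)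
  have h2 := hs.arr2 (i + 1) (by omega) (by omega)
  rw [Nat.add_sub_cancel] at h1 h2
  set u := c.src (i + 1) with hu
  set v := c.dst (i + 1) with hv
  have hul := u.isLt
  have hvl := v.isLt
  have hle := lastIdx_le c.dst i v
  have hle' := lastIdx_le c.src i u
  simp only [linkEdge, RamProgram.wp, RamExpr.wp_const, RamExpr.wp_var, RamExpr.wp_get,
    RamExpr.wp_add, reg_setReg, arr_setReg, reg_setArr, arr_setArr]
  have hidx : ((i : ℤ) + 1).toNat = i + 1 := by omega
  simp [h10, h1, h2, hl.arr5, hl.arr7, hidx]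
  repeat refine And.intro (by omega) ?_
  refine ⟨hs.congr ⟨rfl, rfl, rfl, ?_, ?_, ?_, ?_⟩, ?_⟩
  iterate 4 · simp [funext_iff, arr_setReg, arr_setArr]
  refine ⟨fun x => ?_, fun p hp hpi => ?_, fun x => ?_, fun p hp hpi => ?_⟩
  · simp only [arr_setReg, arr_setArr, lastIdx, ← Fin.ext_iff, ← hv]
    by_cases hx : x = v
    · simp [hx]
    · simp [hx, Ne.symm hx, hl.arr5]
  · by_cases hpi' : p = i + 1
    · subst hpi'
      simp [arr_setReg, arr_setArr, ← hv]
    · simp [arr_setReg, arr_setArr, hpi', hl.arr6 p hp (by omega)]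
  · simp only [arr_setReg, arr_setArr, lastIdx, ← Fin.ext_iff, ← hu]
    by_cases hx : x = u
    · simp [hx]
    · simp [hx, Ne.symm hx, hl.arr7]
  · by_cases hpi' : p = i + 1
    · subst hpi'
      simp [arr_setReg, arr_setArr, ← hu]
    · simp [arr_setReg, arr_setArr, hpi', hl.arr8 p hp (by omega)]

theorem runsWithin_initGuess (hB : Bounds c N wB) (hn0 : 0 < n) (hs : c.Static s) :
    ∃ k : ℕ, (k = 0 ∨ 2 ^ k * n ≤ c.M) ∧ c.M < 2 ^ (k + 1) * n ∧
      RunsWithin wB initGuess s (11 * (k + 1)) fun s' => c.Static s' ∧ s'.reg 11 = 2 ^ k := by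
  have hwB := hB.word
  have hn := hB.n_le
  have hM := hB.energy_le
  obtain ⟨k, hk, hkM, hmin⟩ : ∃ k : ℕ, (k = 0 ∨ 2 ^ k * n ≤ c.M) ∧ c.M < 2 ^ (k + 1) * n ∧
      ∀ i < k, 2 ^ (i + 1) * n ≤ c.M := by
    have hex : ∃ k, c.M < 2 ^ (k + 1) * n := ⟨c.M, by
      have h1 : c.M < 2 ^ c.M := Nat.lt_two_pow_self
      have h2 : 2 ^ c.M ≤ 2 ^ (c.M + 1) * n := by
        rw [pow_succ, mul_assoc]
        exact Nat.le_mul_of_pos_right _ (by omega)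
      omega⟩
    classical
    refine ⟨Nat.find hex, ?_, Nat.find_spec hex, fun i hi => not_lt.mp (Nat.find_min hex hi)⟩
    rcases Nat.eq_zero_or_pos (Nat.find hex) with h | h
    · exact .inl h
    · right
      have := not_lt.mp (Nat.find_min hex (Nat.sub_lt h one_pos))
      rwa [show Nat.find hex - 1 + 1 = Nat.find hex by omega] at this
  refine ⟨k, hk, hkM, ?_⟩
  have hset : RunsWithin wB (.set 11 (.const 1)) s 2 (fun s' => c.Static s' ∧ s'.reg 11 = 1) := by
    refine RunsWithin.of_wp (c := .set 11 (.const 1)) ?_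
    simp only [RamProgram.wp, RamExpr.wp_const]
    exact ⟨by simp; omega, hs.congr ⟨rfl, rfl, rfl⟩ ⟨rfl, rfl, rfl, rfl, rfl, rfl, rfl, rfl⟩, rfl⟩
  rw [show 11 * (k + 1) = 2 + (11 * k + 9) by omega]
  refine hset.seq fun s₁ hs₁ => ?_
  refine RunsWithin.loop (fun q s => ∃ i : ℕ, i + q = k ∧ c.Static s ∧ s.reg 11 = 2 ^ i)
    (fun q => 11 * q + 9) ?_ ⟨0, by simp, hs₁.1, by simpa using hs₁.2⟩
  rintro q s ⟨i, hi, hJ, h11⟩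
  -- The summand `n` covers `i = 0`, where `n` may exceed `M`. The bound keeps the product in the
  -- test within a word.
  have hb : 2 ^ i * n ≤ c.M + n := by
    rcases Nat.eq_zero_or_pos i with h | h
    · subst h
      omega
    · have := hmin (i - 1) (by omega)
      rw [Nat.sub_add_cancel h] at this
      omega
  obtain ⟨P, hP⟩ : ∃ P : ℕ, P = 2 ^ i := ⟨_, rfl⟩
  obtain ⟨Y, hY⟩ : ∃ Y : ℕ, Y = P * n := ⟨_, rfl⟩
  have hPY : P ≤ Y := by
    rw [hY]
    exact Nat.le_mul_of_pos_right _ hn0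
  have h11' : s.reg 11 = (P : ℤ) := by rw [h11, hP, Nat.cast_pow, Nat.cast_ofNat]
  rw [← hP, ← hY] at hb
  have hcast : ((2 : ℤ) * P * n) = ((2 * Y : ℕ) : ℤ) := by
    rw [hY]
    push_cast
    ring
  have hpow : 2 ^ (i + 1) * n = 2 * Y := by
    rw [hY, hP]
    ring
  have hN := hB.one_le
  simp only [RamTest.wp_le, RamExpr.wp_var, RamExpr.wp_mul, RamExpr.wp_const, h11',
    hJ.input.reg0, hJ.input.reg2, RamTest.cost, RamExpr.cost, hcast]
  refine ⟨by simp; omega, by omega, by omega, by omega, by omega, by omega, ?_⟩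
  by_cases hlt : i < k
  · have h2 := hmin i hlt
    rw [hpow] at h2
    have : ((2 * Y : ℕ) : ℤ) ≤ c.M := by exact_mod_cast h2
    simp only [this, decide_true, if_true]
    obtain ⟨q, rfl⟩ := Nat.exists_eq_add_of_lt (by omega : 0 < q)
    refine ⟨4, by omega, ?_⟩
    refine RunsWithin.of_wp (c := .set 11 (.mul (.const 2) (.var 11))) ?_
    simp only [RamProgram.wp, RamExpr.wp_mul, RamExpr.wp_var, RamExpr.wp_const, h11']
    refine ⟨by simp; omega, by omega, by omega, q, by omega, by omega, i + 1, by omega,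
      hJ.congr ⟨rfl, rfl, rfl⟩ ⟨rfl, rfl, rfl, rfl, rfl, rfl, rfl, rfl⟩, ?_⟩
    simp [RamState.reg_setReg, hP]
    ring
  · obtain rfl : i = k := by omega
    have : ¬((2 * Y : ℕ) : ℤ) ≤ c.M := by omega
    simp only [this, decide_false, Bool.false_eq_true, if_false]
    exact ⟨by omega, hJ, by rw [hP, Nat.cast_pow, Nat.cast_ofNat]⟩

/-- The nodes below `i` are prepared for a worklist run with the initial values `f`. -/
structure Prepared (c : GameCode n) (b : ℕ) (cap : Fin n → ℕ) (z : ℤ) (flag : Bool)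
    (old : Fin n → ℤ) (f : Fin n → ℕ∞) (i : ℕ) (s : RamState) : Prop where
  static : c.Static s
  reg3 : s.reg 3 = b
  reg6 : s.reg 6 = if flag then 1 else 0
  reg11 : s.reg 11 = z
  arr4 : ∀ u : Fin n, s.arr 4 u = if (u : ℕ) < i then energyCode (f u) else old u
  arr9 : ∀ u : Fin n, (u : ℕ) < i → s.arr 9 u = cap u
  arr10 : ∀ u : Fin n, (u : ℕ) < i → s.arr 10 u = lastIdx c.src c.m u
  arr11 : ∀ j < i, s.arr 11 j = j

theorem Prepared.step {flag : Bool} {old : Fin n → ℤ} {f : Fin n → ℕ∞} {i : ℕ} (hi : i < n)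
    (h : Prepared c b cap z flag old f i s) {s' : RamState}
    (hreg : ∀ x, x ≠ 10 → s'.reg x = s.reg x)
    (harr : ∀ a, a ≠ 4 → a ≠ 9 → a ≠ 10 → a ≠ 11 → s'.arr a = s.arr a)
    (h4 : ∀ j, s'.arr 4 j = if j = i then energyCode (f ⟨i, hi⟩) else s.arr 4 j)
    (h9 : ∀ j, s'.arr 9 j = if j = i then (cap ⟨i, hi⟩ : ℤ) else s.arr 9 j)
    (h10 : ∀ j, s'.arr 10 j = if j = i then (lastIdx c.src c.m ⟨i, hi⟩ : ℤ) else s.arr 10 j)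
    (h11 : ∀ j, s'.arr 11 j = if j = i then (i : ℤ) else s.arr 11 j) :
    Prepared c b cap z flag old f (i + 1) s' := by
  have hu : ∀ u : Fin n, (u : ℕ) = i → u = ⟨i, hi⟩ := fun u h => Fin.ext h
  refine ⟨h.static.congr ⟨hreg _ ?_, hreg _ ?_, hreg _ ?_⟩ ⟨harr _ ?_ ?_ ?_ ?_, harr _ ?_ ?_ ?_ ?_,
    harr _ ?_ ?_ ?_ ?_, harr _ ?_ ?_ ?_ ?_, harr _ ?_ ?_ ?_ ?_, harr _ ?_ ?_ ?_ ?_,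
    harr _ ?_ ?_ ?_ ?_, harr _ ?_ ?_ ?_ ?_⟩, by rw [hreg _ (by decide), h.reg3],
    by rw [hreg _ (by decide), h.reg6], by rw [hreg _ (by decide), h.reg11],
    fun u => ?_, fun u hlt => ?_, fun u hlt => ?_, fun j hj => ?_⟩
  -- The first 35 goals are index inequalities: one for each of 3 registers and four for each of 8
  -- arrays.
  on_goal 36 =>
    rw [h4, h.arr4]
    by_cases hui : (u : ℕ) = i
    · rw [if_pos hui, if_pos (by omega), hu u hui]
    · rw [if_neg hui]
      by_cases hlt : (u : ℕ) < i
      · rw [if_pos hlt, if_pos (by omega)]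
      · rw [if_neg hlt, if_neg (by omega)]
  on_goal 36 =>
    rw [h9]
    by_cases hui : (u : ℕ) = i
    · rw [if_pos hui, hu u hui]
    · rw [if_neg hui, h.arr9 u (by omega)]
  on_goal 36 =>
    rw [h10]
    by_cases hui : (u : ℕ) = i
    · rw [if_pos hui, hu u hui]
    · rw [if_neg hui, h.arr10 u (by omega)]
  on_goal 36 =>
    rw [h11]
    by_cases hji : j = i
    · rw [if_pos hji, hji]
    · rw [if_neg hji, h.arr11 j (by omega)]
  all_goals decide

theorem runsWithin_firstNodes (hB : Bounds c N wB) (hb : 0 < b) (hbN : b ≤ N) (hs : c.Static s)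
    (h3 : s.reg 3 = b) (h6 : s.reg 6 = 0) (h11 : s.reg 11 = z) :
    RunsWithin wB (forLoop 0 firstNode) s ((firstNode.maxCost + 7) * n + 5)
      (Prepared c b (fun _ => c.M / b) z false (fun u => s.arr 4 u) (fun _ => 0) n) := by
  have hwB := hB.word
  have hm := hB.m_le
  have hn := hB.n_le
  have hM := hB.energy_le
  refine runsWithin_forLoop _ (by omega) ?_ (fun i s h => h.static.input.reg0) ?_
  · refine ⟨hs.congr ⟨rfl, rfl, rfl⟩ ⟨rfl, rfl, rfl, rfl, rfl, rfl, rfl, rfl⟩, h3, h6, h11,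
      fun u => ?_, ?_, ?_, ?_⟩ <;> simp [arr_setReg]
  · intro i hi s hs h10
    have hidx : ((i : ℤ)).toNat = i := by omega
    have h7 := hs.static.links.arr7 ⟨i, hi⟩
    have hle := lastIdx_le c.src c.m ⟨i, hi⟩
    have hdiv := natAbs_ediv_le (c.M : ℤ) b
    simp only at h7
    simp only [firstNode, resetNode, RamProgram.wp, RamExpr.wp_const, RamExpr.wp_var,
      RamExpr.wp_get, RamExpr.wp_div, reg_setReg, arr_setReg, reg_setArr, arr_setArr]
    simp [h10, hs.reg3, hs.static.input.reg2, h7]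
    repeat refine And.intro (by omega) ?_
    refine hs.step hi (fun x hx => ?_) (fun a h4 h9 h10 h11 => ?_) (fun j => ?_) (fun j => ?_)
      (fun j => ?_) (fun j => ?_)
    · simp [reg_setReg, reg_setArr, hx]
    · simp [funext_iff, arr_setReg, arr_setArr, h4, h9, h10, h11]
    · simp [arr_setReg, arr_setArr, show energyCode 0 = 0 from rfl]
    · simp [arr_setReg, arr_setArr]
    · simp [arr_setReg, arr_setArr]
    · simp [arr_setReg, arr_setArr]

/-- Twice an energy. -/
def _root_.doubleEnergy : ℕ∞ → ℕ∞
  | ⊤ => ⊤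
  | (a : ℕ) => (2 * a : ℕ)

/-- The cap of a node in a phase that starts with the doubled value of the previous phase. -/
def _root_.phaseCap (n : ℕ) : ℕ∞ → ℕ
  | ⊤ => 0
  | (a : ℕ) => 2 * a + 2 * n

theorem _root_.doubleEnergy_top : doubleEnergy ⊤ = ⊤ := rfl

theorem _root_.doubleEnergy_natCast (a : ℕ) : doubleEnergy a = (2 * a : ℕ) := rfl

theorem _root_.phaseCap_top (n : ℕ) : phaseCap n ⊤ = 0 := rfl

theorem _root_.phaseCap_natCast (n a : ℕ) : phaseCap n a = 2 * a + 2 * n := rfl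

/-- Each old value is read just before it is overwritten, so the invariant has to remember the old
values of the unprocessed nodes. A finite node gets room `2n + 1`; an infinite one stays infinite,
and its cap `0` only has to fit into a word. -/
theorem runsWithin_nextNodes (hB : Bounds c N wB) {flag : Bool} {f : Fin n → ℕ∞}
    (hf : ∀ u, phaseCap n (f u) ≤ N) (hs : c.Static s)
    (h3 : s.reg 3 = b) (h6 : s.reg 6 = if flag then 1 else 0) (h11 : s.reg 11 = z)
    (h4 : ∀ u : Fin n, s.arr 4 u = energyCode (f u)) :
    RunsWithin wB (forLoop 0 nextNode) s ((nextNode.maxCost + 7) * n + 5)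
      (Prepared c b (fun u => phaseCap n (f u)) z flag (fun u => energyCode (f u))
        (fun u => doubleEnergy (f u)) n) := by
  have hwB := hB.word
  have hm := hB.m_le
  have hn := hB.n_le
  have hN := hB.one_le
  refine runsWithin_forLoop _ (by omega) ?_ (fun i s h => h.static.input.reg0) ?_
  · refine ⟨hs.congr ⟨rfl, rfl, rfl⟩ ⟨rfl, rfl, rfl, rfl, rfl, rfl, rfl, rfl⟩, h3, h6, h11,
      fun u => ?_, ?_, ?_, ?_⟩ <;> simp [arr_setReg, h4]
  · intro i hi s hs h10
    have h7 := hs.static.links.arr7 ⟨i, hi⟩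
    have h4' := hs.arr4 ⟨i, hi⟩
    have hfi := hf ⟨i, hi⟩
    have hle := lastIdx_le c.src c.m ⟨i, hi⟩
    simp only [lt_self_iff_false, if_false] at h7 h4'
    simp only [nextNode, resetNode, RamProgram.wp, RamExpr.wp_const, RamExpr.wp_var,
      RamExpr.wp_get, RamExpr.wp_mul, RamExpr.wp_add, RamTest.wp_eq, reg_setReg, arr_setReg,
      reg_setArr, arr_setArr]
    cases hx : f ⟨i, hi⟩ with
    | top =>
      rw [hx, energyCode_top] at h4'
      simp [h10, hs.static.input.reg0, h7, h4']
      repeat refine And.intro (by omega) ?_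
      refine hs.step hi (fun x hx => ?_) (fun a h4 h9 h10 h11 => ?_) (fun j => ?_) (fun j => ?_)
        (fun j => ?_) (fun j => ?_)
      · simp [reg_setReg, reg_setArr, hx]
      · simp [funext_iff, arr_setReg, arr_setArr, h4, h9, h10, h11]
      · simp only [hx, doubleEnergy_top, energyCode_top, arr_setReg, arr_setArr]
        by_cases hj : j = i
        · simp [hj, h4']
        · simp [hj]
      · simp [arr_setReg, arr_setArr, hx, phaseCap_top]
      · simp [arr_setReg, arr_setArr]
      · simp [arr_setReg, arr_setArr]
    | coe x =>
      rw [hx, energyCode_natCast] at h4'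
      rw [hx] at hfi
      rw [phaseCap_natCast] at hfi
      have hne : ¬((x : ℤ) = -1) := by omega
      simp [h10, hs.static.input.reg0, h7, h4', hne]
      repeat refine And.intro (by omega) ?_
      refine hs.step hi (fun x hx => ?_) (fun a h4 h9 h10 h11 => ?_) (fun j => ?_) (fun j => ?_)
        (fun j => ?_) (fun j => ?_)
      · simp [reg_setReg, reg_setArr, hx]
      · simp [funext_iff, arr_setReg, arr_setArr, h4, h9, h10, h11]
      · simp only [hx, doubleEnergy_natCast, energyCode_natCast, arr_setReg, arr_setArr]
        by_cases hj : j = i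
        · simp [hj]
        · simp [hj]
      · simp [arr_setReg, arr_setArr, hx, phaseCap_natCast]
      · simp [arr_setReg, arr_setArr]
      · simp [arr_setReg, arr_setArr]

end GameCode

/-! ### Starting a worklist run -/

theorem card_le_of_forall_exists_key {V : Type*} [DecidableEq V] [Fintype V] {key : ℕ → V} {m : ℕ}
    (h : ∀ v, ∃ p, 1 ≤ p ∧ p ≤ m ∧ key p = v) : Fintype.card V ≤ m := by
  have h1 : ∑ _v : V, 1 ≤ ∑ v, countIdx key m v := by
    refine Finset.sum_le_sum fun v _ => ?_
    obtain ⟨p, h1, h2, rfl⟩ := h v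
    have h3 := lastIdx_pos key h1 h2
    have h4 := countIdx_pred key h3
    rw [key_lastIdx key _ _ (by omega), countIdx_lastIdx] at h4
    omega
  rw [sum_countIdx] at h1
  simpa using h1

namespace LiftState

variable {V : Type*} [DecidableEq V]

/-- The state at the start of a worklist run with the values `f`, where `l` lists all nodes. -/
def start (D : LiftData V) (f : V → ℕ∞) (l : List V) (flag : Bool) : LiftState V where
  f := f
  ptr u := lastIdx D.src D.m u
  stack := l
  cur := 0
  flag := flag

/-- With all nodes on the stack every constraint is pending, and with all candidates at the heads of
their lists no edge counts as passed. So any values below the caps may be used. -/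
theorem inv_start {D : LiftData V} {f : V → ℕ∞} {l : List V} {flag : Bool}
    (hD : ∀ u, ∃ p, 1 ≤ p ∧ p ≤ D.m ∧ D.src p = u) (hl : ∀ v, v ∈ l)
    (hf : ∀ u (x : ℕ), f u = x → x ≤ D.cap u) : (start D f l flag).Inv D where
  cur_le := Nat.zero_le _
  one_le_ptr u := by
    obtain ⟨p, h1, h2, rfl⟩ := hD u
    exact lastIdx_pos D.src h1 h2
  ptr_le u := lastIdx_le _ _ _
  src_ptr u := by
    obtain ⟨p, h1, h2, rfl⟩ := hD u
    exact key_lastIdx _ _ _ (by have := lastIdx_pos D.src h1 h2; omega)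
  le_cap := hf
  passed u _ p hp hpm hsrc := by
    have hp' : lastIdx D.src D.m u < p := hp
    have := le_lastIdx D.src (by omega) hpm
    rw [hsrc] at this
    omega
  bob _ _ _ _ _ _ := .inr (.inl (hl _))
  alice _ _ := .inr (.inl (hl _))

/-- The constant is `7 = 4 + 1 + 2`, using `n ≤ m`: the room contributes `(d + 1) (2m + 2n)`, the
candidates `m` and the stack `m + n`. -/
theorem potential_start_le [Fintype V] {D : LiftData V} {f : V → ℕ∞} {l : List V} {flag : Bool}
    {d : ℕ} (hD : ∀ u, ∃ p, 1 ≤ p ∧ p ≤ D.m ∧ D.src p = u)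
    (hl : (l.map fun v => countIdx D.dst D.m v + 1).sum = ∑ v, (countIdx D.dst D.m v + 1))
    (hroom : ∀ u, room (D.cap u) (f u) ≤ d + 1) :
    (start D f l flag).potential D ≤ 7 * D.m * (d + 1) := by
  have hcard : Fintype.card V ≤ D.m := card_le_of_forall_exists_key hD
  have h1 : ∑ u, room (D.cap u) (f u) * (countIdx D.src D.m u + countIdx D.dst D.m u + 2) ≤
      ∑ u, (d + 1) * (countIdx D.src D.m u + countIdx D.dst D.m u + 2) :=
    Finset.sum_le_sum fun u _ => Nat.mul_le_mul_right _ (hroom u)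
  rw [← Finset.mul_sum, Finset.sum_add_distrib, Finset.sum_add_distrib, sum_countIdx,
    sum_countIdx] at h1
  have h2 : (d + 1) * (D.m + D.m + ∑ _v : V, 2) ≤ (d + 1) * (4 * D.m) := by
    refine Nat.mul_le_mul_left _ ?_
    simp only [Finset.sum_const, Finset.card_univ, smul_eq_mul]
    omega
  have h3 : ∑ u, countIdx D.src (lastIdx D.src D.m u) u = D.m := by
    simp only [countIdx_lastIdx, sum_countIdx]
  have h4 : ∑ v, (countIdx D.dst D.m v + 1) ≤ 2 * D.m := by
    rw [Finset.sum_add_distrib, sum_countIdx]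
    simp only [Finset.sum_const, Finset.card_univ, smul_eq_mul]
    omega
  have h5 : 3 * D.m ≤ 3 * D.m * (d + 1) := Nat.le_mul_of_pos_right _ (Nat.succ_pos d)
  simp only [potential, start, hl, h3, countIdx]
  calc _ ≤ (d + 1) * (4 * D.m) + D.m + 2 * D.m + 0 := by omega
    _ ≤ (d + 1) * (4 * D.m) + 3 * D.m * (d + 1) := by omega
    _ = _ := by ring

end LiftState

/-! ### The phases of a guess -/

namespace RamProgram

/-- A worklist run on prepared nodes. -/
def runLift : RamProgram := .seq (.seq (.set 4 (.const 0)) (.set 5 (.var 0))) liftLoop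

/-- The number of steps of a worklist run, per edge and unit. -/
def runCost : ℕ := 7 * (liftTest.cost + liftStep.maxCost) + 4 + liftTest.cost

/-- The phase with the largest units. -/
def firstPhase : RamProgram :=
  .seq (.seq (.set 3 (.var 11)) (.set 6 (.const 0)))
    (.seq (forLoop 0 firstNode) (.seq runLift (.set 6 (.const 0))))

/-- A phase in units that are half as large as in the previous phase. -/
def nextPhase : RamProgram :=
  .seq (.set 3 (.div (.var 3) (.const 2))) (.seq (forLoop 0 nextNode) runLift)

end RamProgram

namespace GameCode

open RamProgram RamState

variable {n : ℕ} {c : GameCode n} {b N wB : ℕ} {cap : Fin n → ℕ} {z : ℤ} {s : RamState}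

theorem stackRep_of_reverse {x : ℕ → ℤ} {l : List (Fin n)}
    (h : ∀ i (hi : i < l.reverse.length), x i = (l.reverse[i] : ℕ)) : StackRep x l := by
  induction l with
  | nil => trivial
  | cons v l ih =>
    refine ⟨?_, ih fun i hi => ?_⟩
    · have := h l.length (by simp)
      simpa using this
    · have := h i (by simp at hi ⊢; omega)
      rw [this]
      simp only [List.reverse_cons]
      rw [List.getElem_append_left]

theorem exists_src (c : GameCode n) (u : Fin n) : ∃ p, 1 ≤ p ∧ p ≤ c.m ∧ c.src p = u := by
  obtain ⟨v, hv⟩ := c.G.exists_edge u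
  obtain ⟨p, h1, h2, h3, -⟩ := c.exists_index u v hv
  exact ⟨p, h1, h2, h3⟩

theorem solution_iff_feasible {f : Fin n → ℕ∞} :
    (c.liftData b cap).Solution f ↔ c.G.Feasible (ceilWeight c.w b) f := by
  constructor
  · intro h
    refine ⟨fun u hu => ?_, fun u hu v hv => ?_⟩
    · obtain ⟨p, h1, h2, h3, h4⟩ := h.alice u hu
      have h3' : c.src p = u := h3
      exact ⟨c.dst p, h3' ▸ c.mem_edges p h1 h2, h4⟩
    · obtain ⟨p, h1, h2, h3, rfl⟩ := c.exists_index u v hv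
      exact h.bob u hu p h1 h2 h3
  · intro h
    refine ⟨fun u hu => ?_, fun u hu p h1 h2 h3 => ?_⟩
    · obtain ⟨v, hv, hok⟩ := h.1 u hu
      obtain ⟨p, h1, h2, h3, rfl⟩ := c.exists_index u v hv
      exact ⟨p, h1, h2, h3, hok⟩
    · have h3' : c.src p = u := h3
      exact h.2 u hu _ (h3' ▸ c.mem_edges p h1 h2)

/-- The state after a worklist run that started with `f`. -/
structure RunPost (c : GameCode n) (b : ℕ) (cap : Fin n → ℕ) (z : ℤ) (K S : Prop)
    (g : Fin n → ℕ∞) (s : RamState) (f : Fin n → ℕ∞) (flag : Bool) : Prop where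
  static : c.Static s
  reg3 : s.reg 3 = b
  reg6 : s.reg 6 = if flag then 1 else 0
  reg11 : s.reg 11 = z
  arr4 : ∀ u : Fin n, s.arr 4 u = energyCode (f u)
  feasible : c.G.Feasible (ceilWeight c.w b) f
  le_cap : ∀ u (x : ℕ), f u = x → x ≤ cap u
  le : flag = false ∨ K → ∀ u, f u ≤ g u
  flag : S → flag = false

/-- `K` says that exceeding a cap proves `∞`, as in the first phase; `S` says that no cap can be
exceeded, as in later phases for an admissible guess. A flag already set is kept. -/
theorem runsWithin_runLift (hB : Bounds c N wB) (hm : 1 ≤ c.m) (hcap : ∀ u, cap u ≤ N)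
    (hb : 0 < b) (hbN : b ≤ N) {f g : Fin n → ℕ∞} {d : ℕ} {flag : Bool} {K S : Prop}
    {old : Fin n → ℤ} (hf : ∀ u (x : ℕ), f u = x → x ≤ cap u)
    (hroom : ∀ u, room (cap u) (f u) ≤ d + 1) (hd : 7 * c.m * (d + 1) ≤ N)
    (hs : Prepared c b cap z flag old f n s) (hg : c.G.Feasible (ceilWeight c.w b) g)
    (hK : K → ∀ u, g u ≤ cap u ∨ g u = ⊤) (hS : S → ∀ u, f u ≠ ⊤ → g u ≤ cap u)
    (hle : flag = false ∨ K → ∀ u, f u ≤ g u) (hflag : S → flag = false) :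
    RunsWithin wB runLift s (runCost * (c.m * (d + 1)))
      fun s' => ∃ f' flag', RunPost c b cap z K S g s' f' flag' := by
  have hwB := hB.word
  have hn := hB.n_le
  set D := c.liftData b cap with hD
  -- The preparation wrote node `i` into cell `i`, counted from the bottom, whereas the list starts
  -- with the top of the stack.
  set l := (List.finRange n).reverse with hl
  have hsrc : ∀ u, ∃ p, 1 ≤ p ∧ p ≤ D.m ∧ D.src p = u := c.exists_src
  have hinv : (LiftState.start D f l flag).Inv D :=
    LiftState.inv_start hsrc (by simp [hl]) hf
  have hpot : (LiftState.start D f l flag).potential D ≤ 7 * c.m * (d + 1) := by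
    refine LiftState.potential_start_le hsrc ?_ hroom
    rw [hl, List.map_reverse, List.sum_reverse, ← List.ofFn_eq_map, List.sum_ofFn]
  have hlen : l.length = n := by simp [hl]
  have hset : RunsWithin wB (.seq (.set 4 (.const 0)) (.set 5 (.var 0))) s 4
      fun s' => c.LiftSim b cap z (LiftState.start D f l flag) s' := by
    refine RunsWithin.of_wp (c := .seq (.set 4 (.const 0)) (.set 5 (.var 0))) ?_
    simp only [RamProgram.wp, RamExpr.wp_const, RamExpr.wp_var, reg_setReg]
    simp [hs.static.input.reg0]
    refine ⟨by omega, hs.static.congr ⟨rfl, rfl, rfl⟩ ⟨rfl, rfl, rfl, rfl, rfl, rfl, rfl, rfl⟩,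
      hs.reg3, rfl, ?_, hs.reg6, hs.reg11, fun u => ?_, fun u => hs.arr9 u u.isLt,
      fun u => hs.arr10 u u.isLt, ?_⟩
    · simp [reg_setReg, LiftState.start, hlen]
    · rw [arr_setReg, arr_setReg, hs.arr4, if_pos u.isLt]
      rfl
    · refine stackRep_of_reverse fun i hi => ?_
      have hi' : i < n := by simpa [LiftState.start, hl] using hi
      simp [arr_setReg, hs.arr11 i hi', LiftState.start, hl]
  have hT : 4 + ((liftTest.cost + liftStep.maxCost) * (LiftState.start D f l flag).potential D +
      liftTest.cost) ≤ runCost * (c.m * (d + 1)) := by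
    have h1 : 1 ≤ c.m * (d + 1) := Nat.mul_pos hm (Nat.succ_pos d)
    have h2 := Nat.mul_le_mul_left (liftTest.cost + liftStep.maxCost) hpot
    rw [runCost]
    calc _ ≤ (liftTest.cost + liftStep.maxCost) * (7 * c.m * (d + 1)) +
          (4 + liftTest.cost) * 1 := by omega
      _ ≤ (liftTest.cost + liftStep.maxCost) * (7 * c.m * (d + 1)) +
          (4 + liftTest.cost) * (c.m * (d + 1)) := by gcongr
      _ = _ := by ring
  refine RunsWithin.mono (hset.seq fun s₁ hs₁ =>
    runsWithin_liftLoop hB hcap hs₁ hb hbN hinv (hpot.trans hd)) hT ?_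
  rintro s' ⟨a, hsim, hsol, hac, hlow⟩
  have h := hlow K S g f (solution_iff_feasible.mpr hg) hK hS ⟨hle, fun _ => le_rfl, hflag⟩
  exact ⟨a.f, a.flag, hsim.static, hsim.reg3, hsim.reg6, hsim.reg11, hsim.arr4,
    solution_iff_feasible.mp hsol, hac, h.le, h.flag⟩

/-- The state between the phases of a guess `2 ^ k` of the penalty, in units of `2 ^ j`. -/
structure PhaseInv (c : GameCode n) (k j : ℕ) (s : RamState) (f : Fin n → ℕ∞) (flag : Bool) :
    Prop where
  static : c.Static s
  reg3 : s.reg 3 = 2 ^ j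
  reg6 : s.reg 6 = if flag then 1 else 0
  reg11 : s.reg 11 = 2 ^ k
  arr4 : ∀ u : Fin n, s.arr 4 u = energyCode (f u)
  feasible : c.G.Feasible (ceilWeight c.w (2 ^ j)) f
  bound : ∀ u (x : ℕ), f u = x → 2 ^ j * (x + 2 * n) ≤ c.M + 2 * n * 2 ^ k
  le : flag = false → ∀ u, f u ≤ scaleDown (2 ^ j) (c.G.minEnergy c.w u)
  flag : ((2 ^ k : ℕ) : ℕ∞) ≤ ENat.ceil (c.G.penalty c.w) → flag = false

theorem n_le_m (c : GameCode n) : n ≤ c.m := by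
  simpa using card_le_of_forall_exists_key c.exists_src

theorem two_pow_mul_le {k : ℕ} (hk : k = 0 ∨ 2 ^ k * n ≤ c.M) : 2 ^ k * n ≤ c.M + n := by
  rcases hk with rfl | h
  · omega
  · omega

/-- The number of steps of the first phase, per edge and unit. -/
def firstCost : ℕ := firstNode.maxCost + runCost + 20

/-- The number of steps of a later phase, per edge and unit. -/
def nextCost : ℕ := nextNode.maxCost + runCost + 20

/-- Finite energies are at most `M`, so in units of `b` a value beyond `M / b` really is `∞`.
Exceeding a cap here says nothing against the guess, and the flag is cleared. -/
theorem runsWithin_firstPhase (hB : Bounds c N wB) (hn0 : 0 < n)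
    (hE : c.G.IsEnergyBound c.w c.M) {k : ℕ} (hk : k = 0 ∨ 2 ^ k * n ≤ c.M)
    (hs : c.Static s) (h11 : s.reg 11 = 2 ^ k) :
    RunsWithin wB firstPhase s (firstCost * (c.m * (c.M / 2 ^ k + 1)))
      fun s' => ∃ f, PhaseInv c k k s' f false := by
  have hwB := hB.word
  have hn := hB.n_le
  have hM := hB.energy_le
  have hnm := c.n_le_m
  have hk2 := two_pow_mul_le hk
  obtain ⟨b, hbdef⟩ : ∃ b, b = 2 ^ k := ⟨_, rfl⟩
  have hb : 0 < b := by rw [hbdef]; positivity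
  have h11' : s.reg 11 = (b : ℤ) := by rw [h11, hbdef, Nat.cast_pow, Nat.cast_ofNat]
  have hbn : b ≤ b * n := Nat.le_mul_of_pos_right _ hn0
  rw [← hbdef] at hk2 ⊢
  have hbN : b ≤ N := by omega
  obtain ⟨d, hd⟩ : ∃ d, d = c.M / b := ⟨_, rfl⟩
  rw [← hd]
  have hdM : d ≤ c.M := hd ▸ Nat.div_le_self _ _
  have hbd : b * d ≤ c.M := hd ▸ Nat.mul_div_le _ _
  have hset : RunsWithin wB (.seq (.set 3 (.var 11)) (.set 6 (.const 0))) s 4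
      fun s' => c.Static s' ∧ s'.reg 3 = b ∧ s'.reg 6 = 0 ∧ s'.reg 11 = b := by
    refine RunsWithin.of_wp (c := .seq (.set 3 (.var 11)) (.set 6 (.const 0))) ?_
    simp only [RamProgram.wp, RamExpr.wp_const, RamExpr.wp_var, reg_setReg, h11']
    exact ⟨by omega, by simp, hs.congr ⟨rfl, rfl, rfl⟩ ⟨rfl, rfl, rfl, rfl, rfl, rfl, rfl, rfl⟩,
      rfl, rfl, by simp [h11']⟩
  set g : Fin n → ℕ∞ := fun u => scaleDown b (c.G.minEnergy c.w u) with hgdef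
  have hg : c.G.Feasible (ceilWeight c.w b) g := (c.G.feasible_minEnergy c.w).scaleDown hb
  have hgcap : ∀ u, g u ≤ (d : ℕ) ∨ g u = ⊤ := by
    intro u
    cases hu : c.G.minEnergy c.w u with
    | top => exact .inr (by simp only [hgdef, hu, scaleDown_top])
    | coe x =>
      left
      have h1 := hE u (by rw [hu]; exact ENat.natCast_lt_top x)
      rw [hu, Nat.cast_le] at h1
      simp only [hgdef, hu, scaleDown_natCast, Nat.cast_le]
      exact hd ▸ Nat.div_le_div_right h1
  have hrun : ∀ old s₂, Prepared c b (fun _ => d) b false old (fun _ => 0) n s₂ →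
      RunsWithin wB (.seq runLift (.set 6 (.const 0))) s₂ (runCost * (c.m * (d + 1)) + 2)
        fun s' => ∃ f, PhaseInv c k k s' f false := by
    intro old s₂ hs₂
    refine (runsWithin_runLift (d := d) (g := g) (K := True) (S := False) hB (by omega)
      (fun _ => by omega) hb hbN (fun u x hx => ?_) (fun u => ?_) ?_ hs₂ hg (fun _ => hgcap)
      False.elim (fun _ _ => bot_le) False.elim).seq (T₂ := 2) ?_
    · have hx : (0 : ℕ) = x := by exact_mod_cast hx
      omega
    · rw [show (0 : ℕ∞) = ((0 : ℕ) : ℕ∞) from rfl, room_natCast]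
      omega
    · exact le_trans (Nat.mul_le_mul_left _ (by omega)) hB.potential_le
    · rintro s' ⟨f, flag, h⟩
      refine RunsWithin.of_wp (c := .set 6 (.const 0)) ?_
      simp only [RamProgram.wp, RamExpr.wp_const]
      refine ⟨by simp, f, h.static.congr ⟨rfl, rfl, rfl⟩ ⟨rfl, rfl, rfl, rfl, rfl, rfl, rfl, rfl⟩,
        ?_, rfl, ?_, h.arr4, hbdef ▸ h.feasible, fun u x hx => ?_,
        fun _ u => hbdef ▸ h.le (.inr trivial) u, fun _ => rfl⟩
      · simp [reg_setReg, h.reg3, hbdef]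
      · simp [reg_setReg, h.reg11, hbdef]
      -- From `b x ≤ b (M / b) ≤ M`.
      · have hx' := Nat.mul_le_mul_left b (h.le_cap u x hx)
        rw [← hbdef, mul_add, mul_comm b (2 * n)]
        omega
  have hmd : n ≤ c.m * (d + 1) := hnm.trans (Nat.le_mul_of_pos_right _ (Nat.succ_pos d))
  have hT : 4 + (((firstNode.maxCost + 7) * n + 5) + (runCost * (c.m * (d + 1)) + 2)) ≤
      firstCost * (c.m * (d + 1)) := by
    have h1 := Nat.mul_le_mul_left (firstNode.maxCost + 7) hmd
    have h2 : firstCost * (c.m * (d + 1)) = (firstNode.maxCost + 7) * (c.m * (d + 1)) +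
        runCost * (c.m * (d + 1)) + 13 * (c.m * (d + 1)) := by
      rw [firstCost]
      ring
    omega
  refine RunsWithin.mono (hset.seq fun s₁ hs₁ => RunsWithin.seq
    (runsWithin_firstNodes hB hb hbN hs₁.1 hs₁.2.1 hs₁.2.2.1 hs₁.2.2.2) fun s₂ hs₂ => ?_) hT
    fun _ h => h
  rw [← hd] at hs₂
  exact hrun _ _ hs₂

/-- `2 ⌊y / (2b)⌋ ≤ ⌊y / b⌋`: doubling a lower bound gives a lower bound in the finer units. -/
theorem scaleDown_doubleEnergy_le {b : ℕ} {x y : ℕ∞} (h : x ≤ scaleDown (2 * b) y) :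
    doubleEnergy x ≤ scaleDown b y := by
  cases y with
  | top => exact le_top
  | coe y =>
    rw [scaleDown_natCast] at h
    obtain ⟨x, rfl, hx⟩ := ENat.le_natCast_iff.mp h
    rw [doubleEnergy_natCast, scaleDown_natCast, Nat.cast_le]
    have h1 : 2 * (y / (2 * b)) ≤ y / b := by
      rw [mul_comm 2 b, ← Nat.div_div_eq_div_mul]
      omega
    omega

/-- The doubled values are lower bounds as long as the flag is unset, and for an admissible guess
the truth is at most `2n` units above them. So caps `2n` above the start suffice, and the phase
costs `O(mn)` whether or not the guess is admissible. -/
theorem runsWithin_nextPhase (hB : Bounds c N wB) (hn0 : 0 < n)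
    {k j : ℕ} (hk : k = 0 ∨ 2 ^ k * n ≤ c.M) (hjk : j + 1 ≤ k) {f : Fin n → ℕ∞} {flag : Bool}
    (hs : PhaseInv c k (j + 1) s f flag) :
    RunsWithin wB nextPhase s (nextCost * (c.m * (2 * n + 1)))
      fun s' => ∃ f' flag', PhaseInv c k j s' f' flag' := by
  have hwB := hB.word
  have hn := hB.n_le
  have hM := hB.energy_le
  have hnm := c.n_le_m
  have hk2 := two_pow_mul_le hk
  obtain ⟨b, hbdef⟩ : ∃ b, b = 2 ^ j := ⟨_, rfl⟩
  have hb : 0 < b := by rw [hbdef]; positivity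
  have hb2 : 2 ^ (j + 1) = 2 * b := by rw [hbdef, pow_succ, mul_comm]
  have hbk : 2 * b ≤ 2 ^ k := hb2 ▸ Nat.pow_le_pow_right (by norm_num) hjk
  have hkn : 2 ^ k ≤ 2 ^ k * n := Nat.le_mul_of_pos_right _ hn0
  have hbN : b ≤ N := by omega
  have hbound : ∀ u (x : ℕ), f u = x → 2 * b * (x + 2 * n) ≤ c.M + 2 * n * 2 ^ k :=
    fun u x hx => hb2 ▸ hs.bound u x hx
  have hX : c.M + 2 * n * 2 ^ k ≤ N := by
    have : 2 * n * 2 ^ k = 2 * (2 ^ k * n) := by ring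
    omega
  have hset : RunsWithin wB (.set 3 (.div (.var 3) (.const 2))) s 4
      fun s' => c.Static s' ∧ s'.reg 3 = b ∧ s'.reg 6 = (if flag then 1 else 0) ∧
        s'.reg 11 = 2 ^ k ∧ ∀ u : Fin n, s'.arr 4 u = energyCode (f u) := by
    have h3 : s.reg 3 = ((2 * b : ℕ) : ℤ) := by rw [hs.reg3, ← hb2]; push_cast; rfl
    refine RunsWithin.of_wp (c := .set 3 (.div (.var 3) (.const 2))) ?_
    simp only [RamProgram.wp, RamExpr.wp_const, RamExpr.wp_var, RamExpr.wp_div, h3]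
    refine ⟨by omega, by simp; omega, by norm_num, by omega,
      hs.static.congr ⟨rfl, rfl, rfl⟩ ⟨rfl, rfl, rfl, rfl, rfl, rfl, rfl, rfl⟩,
      ?_, hs.reg6, hs.reg11, hs.arr4⟩
    simp only [reg_setReg, if_true]
    omega
  set g : Fin n → ℕ∞ := fun u => scaleDown b (c.G.minEnergy c.w u) with hgdef
  have hg : c.G.Feasible (ceilWeight c.w b) g := (c.G.feasible_minEnergy c.w).scaleDown hb
  have hcap : ∀ u, phaseCap n (f u) ≤ N := by
    intro u
    cases hu : f u with
    | top => simp [phaseCap_top]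
    | coe x =>
      have h1 := hbound u x hu
      have h2 : 2 * (x + 2 * n) ≤ 2 * b * (x + 2 * n) :=
        Nat.mul_le_mul_right _ (by omega)
      rw [phaseCap_natCast]
      omega
  have hcap' : ∀ u (x : ℕ), doubleEnergy (f u) = x →
      ∃ y : ℕ, f u = y ∧ x = 2 * y ∧ phaseCap n (f u) = 2 * y + 2 * n := by
    intro u x hx
    cases hu : f u with
    | top => simp [hu, doubleEnergy_top] at hx
    | coe y =>
      rw [hu, doubleEnergy_natCast, Nat.cast_inj] at hx
      exact ⟨y, rfl, hx.symm, rfl⟩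
  have hpot : 7 * c.m * (2 * n + 1) ≤ N :=
    le_trans (Nat.mul_le_mul_left _ (by omega)) hB.potential_le
  -- The rounding estimate is applied to the previous units `2b ≤ 2 ^ k ≤ ⌈P⌉`. Dividing `e* ≤ 2b y
  -- + n (2b - 1)` by `b` gives at most `2y + 2n`, the cap.
  have hS : ((2 ^ k : ℕ) : ℕ∞) ≤ ENat.ceil (c.G.penalty c.w) → ∀ u, doubleEnergy (f u) ≠ ⊤ →
      g u ≤ phaseCap n (f u) := by
    intro hP u hu
    obtain ⟨x, hx⟩ := ENat.ne_top_iff_exists.mp hu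
    obtain ⟨y, hy, -, hc⟩ := hcap' u x hx.symm
    have hP' : ((2 * b : ℕ) : ℕ∞) ≤ ENat.ceil (c.G.penalty c.w) :=
      le_trans (by exact_mod_cast hbk) hP
    have h1 := GameGraph.minEnergy_le_of_feasible_ceilWeight (by omega) hP'
      (hb2 ▸ hs.feasible) hy
    rw [Fintype.card_fin] at h1
    obtain ⟨e, he, hle⟩ := ENat.le_natCast_iff.mp h1
    rw [hc]
    simp only [hgdef, he, scaleDown_natCast, Nat.cast_le]
    rw [← Nat.lt_succ_iff, Nat.div_lt_iff_lt_mul hb]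
    have h2 : n * (2 * b - 1) ≤ n * (2 * b) := Nat.mul_le_mul_left _ (by omega)
    calc e ≤ 2 * b * y + n * (2 * b) := by omega
      _ = (2 * y + 2 * n) * b := by ring
      _ < (2 * y + 2 * n).succ * b := Nat.mul_lt_mul_of_pos_right (Nat.lt_succ_self _) hb
  have hrun : ∀ s₂, Prepared c b (fun u => phaseCap n (f u)) (2 ^ k) flag
      (fun u => energyCode (f u)) (fun u => doubleEnergy (f u)) n s₂ →
      RunsWithin wB runLift s₂ (runCost * (c.m * (2 * n + 1)))
        fun s' => ∃ f' flag', PhaseInv c k j s' f' flag' := by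
    intro s₂ hs₂
    refine (runsWithin_runLift (d := 2 * n) (g := g) (K := False)
      (S := ((2 ^ k : ℕ) : ℕ∞) ≤ ENat.ceil (c.G.penalty c.w)) hB (by omega)
      hcap hb hbN (fun u x hx => ?_) (fun u => ?_) hpot hs₂ hg False.elim hS
      (fun hfl u => ?_) hs.flag).mono le_rfl ?_
    · obtain ⟨y, -, h1, h2⟩ := hcap' u x hx
      omega
    · cases hx : doubleEnergy (f u) with
      | top => simp [room_top]
      | coe x =>
        obtain ⟨y, -, h1, h2⟩ := hcap' u x hx
        rw [room_natCast]
        omega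
    · refine scaleDown_doubleEnergy_le ?_
      rw [← hb2]
      exact hs.le (hfl.resolve_right id) u
    · rintro s' ⟨f', flag', h⟩
      refine ⟨f', flag', h.static, ?_, h.reg6, h.reg11, h.arr4, hbdef ▸ h.feasible,
        fun u x hx => ?_, fun hfl u => hbdef ▸ h.le (.inl hfl) u, h.flag⟩
      · rw [h.reg3, hbdef, Nat.cast_pow, Nat.cast_ofNat]
      · have h1 := h.le_cap u x hx
        cases hu : f u with
        | top =>
          rw [hu, phaseCap_top] at h1
          have h2 : b * (x + 2 * n) ≤ 2 ^ k * (2 * n) := Nat.mul_le_mul (by omega) (by omega)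
          rw [← hbdef]
          linarith
        | coe y =>
          have h3 := hbound u y hu
          rw [hu, phaseCap_natCast] at h1
          -- The offset `2n` is chosen so that the bound reproduces itself: `x ≤ 2y + 2n` gives `x +
          -- 2n ≤ 2 (y + 2n)`. Hence the numbers do not outgrow a word, even for wrong guesses.
          have h2 : b * (x + 2 * n) ≤ b * (2 * (y + 2 * n)) := Nat.mul_le_mul_left _ (by omega)
          rw [← hbdef]
          linarith
  have hmd : n ≤ c.m * (2 * n + 1) := hnm.trans (Nat.le_mul_of_pos_right _ (Nat.succ_pos _))
  have hT : 4 + (((nextNode.maxCost + 7) * n + 5) + runCost * (c.m * (2 * n + 1))) ≤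
      nextCost * (c.m * (2 * n + 1)) := by
    have h1 := Nat.mul_le_mul_left (nextNode.maxCost + 7) hmd
    have h2 : nextCost * (c.m * (2 * n + 1)) = (nextNode.maxCost + 7) * (c.m * (2 * n + 1)) +
        runCost * (c.m * (2 * n + 1)) + 13 * (c.m * (2 * n + 1)) := by
      rw [nextCost]
      ring
    omega
  refine RunsWithin.mono (hset.seq fun s₁ hs₁ => RunsWithin.seq
    (runsWithin_nextNodes hB hcap hs₁.1 hs₁.2.1 hs₁.2.2.1 hs₁.2.2.2.1 hs₁.2.2.2.2)
    fun s₂ hs₂ => hrun s₂ hs₂) hT fun _ h => h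

end GameCode

/-! ### The search for the penalty -/

namespace RamProgram

/-- The phases after the first one. -/
def laterPhases : RamProgram := .loop (.lt (.const 1) (.var 3)) nextPhase

/-- Accept the present guess if no cap was exceeded, and otherwise halve it. -/
def judgeGuess : RamProgram :=
  .ite (.eq (.var 6) (.const 0)) (.set 11 (.const 0)) (.set 11 (.div (.var 11) (.const 2)))

/-- Try smaller and smaller guesses of the penalty. -/
def guessLoop : RamProgram :=
  .loop (.lt (.const 0) (.var 11)) (.seq firstPhase (.seq laterPhases judgeGuess))

/-- Compute the minimal energies. -/
def solveEnergies : RamProgram := .seq (forLoop 1 linkEdge) (.seq initGuess guessLoop)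

end RamProgram

namespace GameCode

open RamProgram RamState

variable {n : ℕ} {c : GameCode n} {N wB : ℕ} {s : RamState}

theorem runsWithin_laterPhases (hB : Bounds c N wB) (hn0 : 0 < n) {k j : ℕ}
    (hk : k = 0 ∨ 2 ^ k * n ≤ c.M) (hjk : j ≤ k)
    (hs : ∃ f flag, PhaseInv c k j s f flag) :
    RunsWithin wB laterPhases s ((nextCost * (c.m * (2 * n + 1)) + 3) * j + 3)
      fun s' => ∃ f' flag', PhaseInv c k 0 s' f' flag' := by
  have hwB := hB.word
  have hM := hB.energy_le
  have hk2 := two_pow_mul_le hk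
  have hkn : 2 ^ k ≤ 2 ^ k * n := Nat.le_mul_of_pos_right _ hn0
  refine RunsWithin.loop (fun j s => j ≤ k ∧ ∃ f flag, PhaseInv c k j s f flag)
    (fun j => (nextCost * (c.m * (2 * n + 1)) + 3) * j + 3) ?_ ⟨hjk, hs⟩
  rintro j s ⟨hjk, f, flag, hs⟩
  obtain ⟨b, hbdef⟩ : ∃ b, b = 2 ^ j := ⟨_, rfl⟩
  have h3 : s.reg 3 = (b : ℤ) := by rw [hs.reg3, hbdef, Nat.cast_pow, Nat.cast_ofNat]
  have hbk : b ≤ 2 ^ k := hbdef ▸ Nat.pow_le_pow_right (by norm_num) hjk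
  simp only [RamTest.wp_lt, RamExpr.wp_const, RamExpr.wp_var, h3, RamTest.cost, RamExpr.cost]
  refine ⟨by simp; omega, by omega, ?_⟩
  rcases Nat.eq_zero_or_pos j with rfl | hj
  · obtain rfl : b = 1 := by simpa using hbdef
    simp only [Nat.cast_one, lt_self_iff_false, decide_false, Bool.false_eq_true, if_false]
    exact ⟨by omega, f, flag, hs⟩
  · obtain ⟨j, rfl⟩ : ∃ i, j = i + 1 := ⟨j - 1, by omega⟩
    have hlt : (1 : ℤ) < b := by
      have : 1 ≤ 2 ^ j := Nat.one_le_two_pow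
      rw [pow_succ] at hbdef
      omega
    simp only [hlt, decide_true, if_true]
    refine ⟨nextCost * (c.m * (2 * n + 1)), ?_,
      (runsWithin_nextPhase hB hn0 hk hjk hs).mono le_rfl fun s' h => ⟨j, by omega, ?_, by omega, h⟩⟩
    · rw [Nat.mul_add_one (nextCost * _ + 3)]
      omega
    · rw [Nat.mul_add_one (nextCost * _ + 3)]
      omega

/-- The number of steps of a guess, per edge and unit. -/
def guessCost : ℕ := firstCost + 3 * nextCost + 19

/-- A bound on the number of steps for the guess `2 ^ k`. -/
def guessTime (c : GameCode n) (k : ℕ) : ℕ :=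
  guessCost * (c.m * (c.M / 2 ^ k) + c.m * n * (k + 1))

/-- The additive terms are absorbed into `m n (k + 1)`: `2n + 1 ≤ 3n` accounts for the factor `3` of
`nextCost`, and `3k + 13 ≤ 19 (k + 1)` for the tests and assignments around the phases. -/
theorem le_guessTime (c : GameCode n) (hn0 : 0 < n) (k : ℕ) :
    3 + (firstCost * (c.m * (c.M / 2 ^ k + 1)) +
      (((nextCost * (c.m * (2 * n + 1)) + 3) * k + 3) + judgeGuess.maxCost)) ≤
      guessTime c k := by
  have hm : 1 ≤ c.m := hn0.trans_le c.n_le_m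
  have hmn : c.m ≤ c.m * n := Nat.le_mul_of_pos_right _ hn0
  have hmn1 : 1 ≤ c.m * n := hm.trans hmn
  have h1 : judgeGuess.maxCost = 7 := rfl
  have h2 : c.m * n ≤ c.m * n * (k + 1) := Nat.le_mul_of_pos_right _ (Nat.succ_pos k)
  have h3 : k + 1 ≤ c.m * n * (k + 1) := Nat.le_mul_of_pos_left _ hmn1
  have h4 : nextCost * (c.m * (2 * n + 1)) * k ≤ nextCost * (3 * (c.m * n * (k + 1))) := by
    rw [mul_assoc]
    refine Nat.mul_le_mul_left _ ?_
    calc c.m * (2 * n + 1) * k ≤ (3 * (c.m * n)) * (k + 1) := by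
          refine Nat.mul_le_mul ?_ (Nat.le_succ k)
          rw [mul_add, mul_one, ← mul_assoc, mul_comm c.m 2, mul_assoc]
          omega
      _ = _ := by ring
  have h5 : firstCost * c.m ≤ firstCost * (c.m * n * (k + 1)) :=
    Nat.mul_le_mul_left _ (hmn.trans h2)
  rw [h1, guessTime, guessCost]
  calc _ = firstCost * (c.m * (c.M / 2 ^ k)) + firstCost * c.m +
        nextCost * (c.m * (2 * n + 1)) * k + (3 * k + 13) := by ring
    _ ≤ firstCost * (c.m * (c.M / 2 ^ k)) + firstCost * (c.m * n * (k + 1)) +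
        nextCost * (3 * (c.m * n * (k + 1))) + 19 * (c.m * n * (k + 1)) +
        (3 * nextCost + 19) * (c.m * (c.M / 2 ^ k)) := by omega
    _ = _ := by ring

/-- The array `4` contains the minimal energies. -/
def Solved (c : GameCode n) (s : RamState) : Prop :=
  ∀ v : Fin n, s.arr 4 v = energyCode (c.G.minEnergy c.w v)

/-- In units of `1` nothing is rounded: an unset flag gives a lower bound, and feasibility an upper
bound. Nothing is assumed about the guess, so an accepted result is always correct. -/
theorem PhaseInv.solved {k : ℕ} {f : Fin n → ℕ∞} (hs : PhaseInv c k 0 s f false) :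
    c.Solved s := by
  intro v
  rw [hs.arr4]
  congr 1
  apply le_antisymm
  · have := hs.le rfl v
    rwa [pow_zero, scaleDown_one] at this
  · have := hs.feasible
    rw [pow_zero, ceilWeight_one] at this
    exact GameGraph.minEnergy_le_of_feasible this v

/-- The search cannot pass an admissible guess `2 ^ k₁`; it may stop earlier, which only saves time.
-/
theorem runsWithin_guessLoop (hB : Bounds c N wB) (hn0 : 0 < n)
    (hE : c.G.IsEnergyBound c.w c.M) {k₀ k₁ : ℕ} (hk : k₀ = 0 ∨ 2 ^ k₀ * n ≤ c.M)
    (h10 : k₁ ≤ k₀) (hP : ((2 ^ k₁ : ℕ) : ℕ∞) ≤ ENat.ceil (c.G.penalty c.w))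
    (hs : c.Static s ∧ s.reg 11 = 2 ^ k₀) :
    RunsWithin wB guessLoop s (∑ i ∈ Finset.range (k₀ - k₁ + 1), guessTime c (k₁ + i) + 3)
      c.Solved := by
  have hwB := hB.word
  have hM := hB.energy_le
  -- The variant counts the guesses down to `k₁`; the value `0` means that a result was accepted,
  -- which the program signals by setting the guess to `0`.
  let I : ℕ → RamState → Prop := fun q s => match q with
    | 0 => s.reg 11 = 0 ∧ c.Solved s
    | q + 1 => (k₁ + q = 0 ∨ 2 ^ (k₁ + q) * n ≤ c.M) ∧ c.Static s ∧ s.reg 11 = 2 ^ (k₁ + q)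
  refine RunsWithin.loop I (fun q => ∑ i ∈ Finset.range q, guessTime c (k₁ + i) + 3) ?_
    (show I (k₀ - k₁ + 1) s by
      simp only [I]
      rw [Nat.add_sub_cancel' h10]
      exact ⟨hk, hs⟩)
  intro q s hI
  simp only [RamTest.wp_lt, RamExpr.wp_const, RamExpr.wp_var, RamTest.cost, RamExpr.cost]
  cases q with
  | zero =>
    obtain ⟨h11, hsol⟩ := hI
    simp only [h11]
    simp
    exact hsol
  | succ q =>
    obtain ⟨hk, hst, h11⟩ := hI
    have hk2 := two_pow_mul_le hk
    have hkn : 2 ^ (k₁ + q) ≤ 2 ^ (k₁ + q) * n := Nat.le_mul_of_pos_right _ hn0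
    obtain ⟨b, hbdef⟩ : ∃ b, b = 2 ^ (k₁ + q) := ⟨_, rfl⟩
    have hb : 0 < b := by rw [hbdef]; positivity
    have h11' : s.reg 11 = (b : ℤ) := by rw [h11, hbdef, Nat.cast_pow, Nat.cast_ofNat]
    have hlt : (0 : ℤ) < b := by omega
    rw [← hbdef] at hk2 hkn
    simp only [h11', hlt, decide_true, if_true]
    refine ⟨by simp, by omega, _, ?_, (runsWithin_firstPhase hB hn0 hE hk hst h11).seq
      fun s₁ hs₁ => (runsWithin_laterPhases hB hn0 hk le_rfl
        (hs₁.imp fun f hf => ⟨false, hf⟩)).seq (T₂ := judgeGuess.maxCost) ?_⟩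
    · rw [Finset.sum_range_succ]
      have := le_guessTime c hn0 (k₁ + q)
      omega
    · rintro s₂ ⟨f, flag, hs₂⟩
      have htime := le_guessTime c hn0 (k₁ + q)
      refine RunsWithin.of_wp ?_
      have h11₂ : s₂.reg 11 = (b : ℤ) := by rw [hs₂.reg11, hbdef, Nat.cast_pow, Nat.cast_ofNat]
      simp only [judgeGuess, RamProgram.wp, RamTest.wp_eq, RamExpr.wp_const, RamExpr.wp_var,
        RamExpr.wp_div, hs₂.reg6, h11₂]
      cases flag with
      | false =>
        simp only [Bool.false_eq_true, if_false, decide_true, if_true]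
        refine ⟨by simp, by simp, by simp, 0, by omega, ?_, rfl, hs₂.solved⟩
        rw [Finset.sum_range_succ, Finset.sum_range_zero]
        simp only [judgeGuess, RamProgram.wp] at htime ⊢
        omega
      | true =>
        -- The guess `2 ^ k₁` cannot fail, so a smaller one is never needed. In particular, the
        -- guess `1` is never halved to `0`, which would look like acceptance.
        have hq : q ≠ 0 := by
          rintro rfl
          have := hs₂.flag hP
          simp at this
        obtain ⟨q, rfl⟩ : ∃ r, q = r + 1 := ⟨q - 1, by omega⟩
        simp only [if_true, one_ne_zero, decide_false, Bool.false_eq_true, if_false]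
        have hb2 : b = 2 * 2 ^ (k₁ + q) := by
          rw [hbdef, ← add_assoc, pow_succ, mul_comm]
        refine ⟨by simp; omega, by simp, by omega, by simp; omega, by norm_num, by omega, q + 1,
          by omega, ?_, ?_, ?_, ?_⟩
        · rw [Finset.sum_range_succ _ (q + 1)]
          simp only [judgeGuess, RamProgram.wp] at htime ⊢
          omega
        · right
          rcases hk with hk | hk
          · omega
          · rw [← hbdef, hb2] at hk
            rw [mul_assoc] at hk
            omega
        · exact hs₂.static.congr ⟨rfl, rfl, rfl⟩ ⟨rfl, rfl, rfl, rfl, rfl, rfl, rfl, rfl⟩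
        · simp only [reg_setReg, if_true, hb2]
          push_cast
          omega

/-- The constant in the bound on the number of steps. -/
def solveCost : ℕ := linkEdge.maxCost + 26 + 2 * guessCost

/-- The starting exponent `k₀` depends on `M` and `n` only, whereas `k₁` exists only in the
analysis: every admissible `k₁ ≤ k₀` yields a valid time bound for the same run. -/
theorem runsWithin_solveEnergies (hB : Bounds c N wB) (hn0 : 0 < n)
    (hE : c.G.IsEnergyBound c.w c.M) (hs : c.Input s) (hl : c.Links 0 s) :
    ∃ k₀ : ℕ, (k₀ = 0 ∨ 2 ^ k₀ * n ≤ c.M) ∧ c.M < 2 ^ (k₀ + 1) * n ∧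
      ∀ k₁ ≤ k₀, ((2 ^ k₁ : ℕ) : ℕ∞) ≤ ENat.ceil (c.G.penalty c.w) →
        RunsWithin wB solveEnergies s
          (solveCost * (c.m * n * (k₀ + 1) * (k₀ - k₁ + 1) + c.m * (c.M / 2 ^ k₁))) c.Solved := by
  obtain ⟨t₁, s₁, hr₁, ht₁, hs₁⟩ := runsWithin_buildLists hB hs hl
  obtain ⟨k₀, hk, hkM, hr₂⟩ := runsWithin_initGuess hB hn0 hs₁
  refine ⟨k₀, hk, hkM, fun k₁ h10 hP => ?_⟩
  have hm : 1 ≤ c.m := hn0.trans_le c.n_le_m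
  have hrun := RunsWithin.seq (c₁ := forLoop 1 linkEdge) (R := fun s' => s' = s₁)
    ⟨t₁, s₁, hr₁, ht₁, rfl⟩ fun s' hs' => by
      subst hs'
      exact hr₂.seq fun s₂ hs₂ => runsWithin_guessLoop hB hn0 hE hk h10 hP hs₂
  refine hrun.mono ?_ fun _ h => h
  -- The terms `M / 2 ^ k` form a geometric series, at most twice the largest; each of the `k₀ - k₁
  -- + 1` guesses has at most `k₀ + 1` phases.
  have hsum : ∑ i ∈ Finset.range (k₀ - k₁ + 1), guessTime c (k₁ + i) ≤
      guessCost * (c.m * (2 * (c.M / 2 ^ k₁)) + c.m * n * ((k₀ + 1) * (k₀ - k₁ + 1))) := by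
    simp only [guessTime]
    rw [← Finset.mul_sum, Finset.sum_add_distrib, ← Finset.mul_sum, ← Finset.mul_sum]
    refine Nat.mul_le_mul_left _ (Nat.add_le_add (Nat.mul_le_mul_left _ ?_)
      (Nat.mul_le_mul_left _ ?_))
    · have := Nat.geom_sum_le (le_refl 2) (c.M / 2 ^ k₁) (k₀ - k₁ + 1)
      simp only [Nat.div_div_eq_div_mul, ← pow_add] at this
      omega
    · have := Finset.sum_le_card_nsmul (Finset.range (k₀ - k₁ + 1)) (fun i => k₁ + i + 1) (k₀ + 1)
        (fun i hi => by
          rw [Finset.mem_range] at hi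
          omega)
      rw [Finset.card_range, smul_eq_mul] at this
      linarith
  obtain ⟨Y, hY⟩ : ∃ Y, Y = c.m * n * (k₀ + 1) * (k₀ - k₁ + 1) := ⟨_, rfl⟩
  have hmY : c.m ≤ Y := by
    rw [hY, mul_assoc, mul_assoc]
    exact Nat.le_mul_of_pos_right _ (by positivity)
  have hkY : k₀ + 1 ≤ Y := by
    rw [hY, mul_right_comm]
    exact Nat.le_mul_of_pos_left _ (by positivity)
  have h1 := Nat.mul_le_mul_left (linkEdge.maxCost + 7) hmY
  have h2 : c.m * n * ((k₀ + 1) * (k₀ - k₁ + 1)) = Y := by rw [hY]; ring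
  rw [h2] at hsum
  rw [← hY, solveCost]
  calc _ ≤ (linkEdge.maxCost + 7) * Y + 5 + (11 * (k₀ + 1) +
        (guessCost * (c.m * (2 * (c.M / 2 ^ k₁)) + Y) + 3)) := by omega
    _ ≤ (linkEdge.maxCost + 7) * Y + 19 * Y +
        guessCost * (c.m * (2 * (c.M / 2 ^ k₁)) + Y) + guessCost * Y +
        (linkEdge.maxCost + 26) * (c.m * (c.M / 2 ^ k₁)) := by omega
    _ = _ := by ring

end GameCode

/-! ### Comparison with the stated running time -/

theorem one_le_timeLog (x : ℝ) : 1 ≤ timeLog x := le_max_left _ _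

theorem natCast_le_timeLog {k : ℕ} {x : ℝ} (h : (2 : ℝ) ^ k ≤ x) : (k : ℝ) ≤ timeLog x := by
  refine le_trans ?_ (le_max_right _ _)
  have hpos : (0 : ℝ) < 2 ^ k := by positivity
  rw [Real.le_logb_iff_rpow_le (by norm_num) (hpos.trans_le h), Real.rpow_natCast]
  exact h

theorem timeLog_le {k : ℕ} {x : ℝ} (h : x ≤ 2 ^ k) (h0 : 0 ≤ x) : timeLog x ≤ k + 1 := by
  refine max_le (by linarith [(Nat.cast_nonneg k : (0 : ℝ) ≤ k)]) ?_
  rcases h0.eq_or_lt with rfl | h0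
  · simp
    positivity
  · rw [Real.logb_le_iff_le_rpow (by norm_num) h0]
    refine h.trans ?_
    rw [← Real.rpow_natCast]
    exact Real.rpow_le_rpow_of_exponent_le (by norm_num) (by linarith)

/-- The step count of the algorithm for the best guess of the penalty is within the bound. -/
theorem exists_guess_le_energyTime {n m M k₀ : ℕ} {P : ℝ≥0∞} (hn : 0 < n)
    (hP : 1 ≤ ENat.ceil P) (hk : k₀ = 0 ∨ 2 ^ k₀ * n ≤ M) (hkM : M < 2 ^ (k₀ + 1) * n) :
    ∃ k₁ ≤ k₀, ((2 ^ k₁ : ℕ) : ℕ∞) ≤ ENat.ceil P ∧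
      ((m * n * (k₀ + 1) * (k₀ - k₁ + 1) + m * (M / 2 ^ k₁) : ℕ) : ℝ) ≤
        8 * energyTime n m M P := by
  have hnR : (0 : ℝ) < n := by exact_mod_cast hn
  set L₁ := timeLog ((M : ℝ) / n) with hL₁
  have hL1 : (1 : ℝ) ≤ L₁ := one_le_timeLog _
  have hk₀ : (k₀ : ℝ) + 1 ≤ 2 * L₁ := by
    have : (k₀ : ℝ) ≤ L₁ := by
      rcases hk with rfl | hk
      · simpa using zero_le_one.trans hL1
      · refine natCast_le_timeLog ?_
        rw [le_div_iff₀ hnR]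
        exact_mod_cast hk
    linarith
  -- At the largest guess the first phase costs `O(mn)`, which the first summand of the bound
  -- absorbs. This covers penalties above `M / n`, including `∞`.
  have hM0 : ((M / 2 ^ k₀ : ℕ) : ℝ) ≤ 2 * n := by
    have : M / 2 ^ k₀ < 2 * n := by
      rw [Nat.div_lt_iff_lt_mul (by positivity)]
      calc M < 2 ^ (k₀ + 1) * n := hkM
        _ = 2 * n * 2 ^ k₀ := by ring
    exact_mod_cast this.le
  set L₂ := timeLog ((M : ℝ≥0∞) / (n * ((ENat.ceil P : ℕ∞) : ℝ≥0∞))).toReal with hL₂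
  have hL2 : (1 : ℝ) ≤ L₂ := one_le_timeLog _
  set R := ((M : ℝ≥0∞) / ((ENat.ceil P : ℕ∞) : ℝ≥0∞)).toReal with hR
  have hR0 : 0 ≤ R := ENNReal.toReal_nonneg
  -- The factor `8` is `2 * 3` from the two logarithms plus `2` from the term `2 n`.
  have finish : ∀ k₁ ≤ k₀, ((k₀ - k₁ + 1 : ℕ) : ℝ) ≤ 3 * L₂ →
      ((M / 2 ^ k₁ : ℕ) : ℝ) ≤ 2 * n + 2 * R →
      ((m * n * (k₀ + 1) * (k₀ - k₁ + 1) + m * (M / 2 ^ k₁) : ℕ) : ℝ) ≤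
        8 * energyTime n m M P := by
    intro k₁ _ h1 h2
    rw [energyTime, ← hL₁, ← hL₂, ← hR, Nat.cast_add, Nat.cast_mul _ (k₀ - k₁ + 1),
      Nat.cast_mul m (M / 2 ^ k₁), Nat.cast_mul, Nat.cast_mul]
    push_cast at h1 ⊢
    have h3 : ((k₀ : ℝ) + 1) * (((k₀ - k₁ : ℕ) : ℝ) + 1) ≤ (2 * L₁) * (3 * L₂) := by
      refine mul_le_mul hk₀ (by simpa using h1) (by positivity) (by linarith)
    have h4 : (1 : ℝ) ≤ L₁ * L₂ := one_le_mul_of_one_le_of_one_le hL1 hL2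
    have hmn : (0 : ℝ) ≤ m * n := by positivity
    have h5 := mul_le_mul_of_nonneg_left h3 hmn
    have h6 := mul_le_mul_of_nonneg_left h4 hmn
    have h7 := mul_le_mul_of_nonneg_left h2 (Nat.cast_nonneg m : (0 : ℝ) ≤ m)
    have h8 : (0 : ℝ) ≤ m * R := by positivity
    nlinarith
  have base : ((2 ^ k₀ : ℕ) : ℕ∞) ≤ ENat.ceil P → ∃ k₁ ≤ k₀, ((2 ^ k₁ : ℕ) : ℕ∞) ≤ ENat.ceil P ∧
      ((m * n * (k₀ + 1) * (k₀ - k₁ + 1) + m * (M / 2 ^ k₁) : ℕ) : ℝ) ≤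
        8 * energyTime n m M P := by
    intro h
    refine ⟨k₀, le_rfl, h, finish k₀ le_rfl ?_ (by linarith)⟩
    rw [Nat.sub_self]
    push_cast
    linarith
  cases hc : ENat.ceil P with
  | top =>
    rw [hc] at base
    exact base le_top
  | coe p =>
    rw [hc] at base hP hL₂ hR
    have hp : 1 ≤ p := by exact_mod_cast hP
    by_cases h : 2 ^ k₀ ≤ p
    · exact base (by exact_mod_cast h)
    · have hpR : (0 : ℝ) < p := by exact_mod_cast hp
      have hlog : 2 ^ Nat.log 2 p ≤ p := Nat.pow_log_le_self 2 (by omega)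
      have hlog' : p < 2 ^ (Nat.log 2 p + 1) := Nat.lt_pow_succ_log_self (by norm_num) p
      have hlt : Nat.log 2 p < k₀ := by
        rw [← Nat.pow_lt_pow_iff_right (a := 2) (by norm_num)]
        omega
      -- The largest power of two below `⌈P⌉` loses at most a factor `2` in `M / ⌈P⌉` and one guess
      -- more in the logarithm.
      set k₁ := Nat.log 2 p
      have hRp : R = M / p := by
        rw [hR]
        simp [ENNReal.toReal_div]
      have hL₂p : L₂ = timeLog ((M : ℝ) / (n * p)) := by
        rw [hL₂]
        simp [ENNReal.toReal_div, ENNReal.toReal_mul]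
      have hlogR : (p : ℝ) ≤ 2 ^ (k₁ + 1) := by exact_mod_cast hlog'.le
      refine ⟨k₁, hlt.le, by exact_mod_cast hlog, finish k₁ hlt.le ?_ ?_⟩
      · have hkM' : 2 ^ k₀ * n ≤ M := hk.resolve_left (by omega)
        have h1 : ((k₀ - k₁ - 1 : ℕ) : ℝ) ≤ L₂ := by
          rw [hL₂p]
          refine natCast_le_timeLog ?_
          rw [le_div_iff₀ (by positivity)]
          calc (2 : ℝ) ^ (k₀ - k₁ - 1) * (n * p) ≤ 2 ^ (k₀ - k₁ - 1) * (n * 2 ^ (k₁ + 1)) := by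
                gcongr
            _ = 2 ^ ((k₀ - k₁ - 1) + (k₁ + 1)) * n := by ring
            _ = 2 ^ k₀ * n := by rw [show (k₀ - k₁ - 1) + (k₁ + 1) = k₀ by omega]
            _ ≤ M := by exact_mod_cast hkM'
        rw [show k₀ - k₁ + 1 = (k₀ - k₁ - 1) + 2 by omega]
        push_cast
        linarith
      · have h1 : ((M / 2 ^ k₁ : ℕ) : ℝ) ≤ M / 2 ^ k₁ := by
          simpa using (Nat.cast_div_le (m := M) (n := 2 ^ k₁) (α := ℝ))
        have h2 : (M : ℝ) / 2 ^ k₁ ≤ 2 * R := by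
          rw [hRp, div_le_iff₀ (by positivity)]
          have h3 : (M : ℝ) * p ≤ M * 2 ^ (k₁ + 1) := by gcongr
          rw [show 2 * ((M : ℝ) / p) * 2 ^ k₁ = M * 2 ^ (k₁ + 1) / p by ring, le_div_iff₀ hpR]
          exact h3
        linarith

/-! ### From inputs to the theorem -/

/-- The numbered edges of an input. -/
def GameCode.ofEdgeList {n : ℕ} (G : GameGraph (Fin n)) (w : Fin n → Fin n → ℤ)
    (es : List (Fin n × Fin n)) (M : ℕ) (hn : 0 < n) (hes : IsEdgeList G es) : GameCode n where
  G := G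
  w := w
  M := M
  m := es.length
  -- Edge `p` sits in cell `p - 1`; the default pair plays no role for `1 ≤ p ≤ m`.
  src p := (es.getD (p - 1) (⟨0, hn⟩, ⟨0, hn⟩)).1
  dst p := (es.getD (p - 1) (⟨0, hn⟩, ⟨0, hn⟩)).2
  mem_edges p h1 h2 := by
    rw [← hes.2, Prod.mk.eta, List.getD_eq_getElem _ _ (by omega)]
    exact List.getElem_mem _
  exists_index u v h := by
    rw [← hes.2, List.mem_iff_getElem] at h
    obtain ⟨i, hi, h⟩ := h
    refine ⟨i + 1, by omega, by omega, ?_, ?_⟩ <;>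
      rw [Nat.add_sub_cancel, List.getD_eq_getElem _ _ hi, h]

theorem GameCode.input_inputState {n : ℕ} (G : GameGraph (Fin n)) (w : Fin n → Fin n → ℤ)
    (es : List (Fin n × Fin n)) (M : ℕ) (hn : 0 < n) (hes : IsEdgeList G es) :
    (GameCode.ofEdgeList G w es M hn hes).Input (inputState G w es M) := by
  have key : ∀ p, 1 ≤ p → p ≤ es.length → p - 1 < es.length := fun p h1 h2 => by omega
  refine ⟨rfl, rfl, rfl, fun u => ?_, fun p h1 h2 => ?_, fun p h1 h2 => ?_, fun p h1 h2 => ?_⟩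
  · simp [inputState, ofEdgeList]
  · have := key p h1 h2
    simp [inputState, ofEdgeList, this]
  · have := key p h1 h2
    simp [inputState, ofEdgeList, this]
  · have := key p h1 h2
    simp [inputState, ofEdgeList, this]

theorem GameCode.links_inputState {n : ℕ} (G : GameGraph (Fin n)) (w : Fin n → Fin n → ℤ)
    (es : List (Fin n × Fin n)) (M : ℕ) (hn : 0 < n) (hes : IsEdgeList G es) :
    (GameCode.ofEdgeList G w es M hn hes).Links 0 (inputState G w es M) :=
  ⟨fun _ => rfl, fun p h1 h2 => by omega, fun _ => rfl, fun p h1 h2 => by omega⟩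

theorem card_edges_le {n : ℕ} (G : GameGraph (Fin n)) : G.edges.card ≤ n ^ 2 := by
  have := Finset.card_le_univ G.edges
  rw [Fintype.card_prod, Fintype.card_fin] at this
  rwa [sq]

theorem IsEdgeList.length_eq {n : ℕ} {G : GameGraph (Fin n)} {es : List (Fin n × Fin n)}
    (h : IsEdgeList G es) : es.length = G.edges.card := by
  rw [← List.toFinset_card_of_nodup h.1]
  congr 1
  ext p
  rw [List.mem_toFinset, h.2]

theorem computesEnergies_solveEnergies {n : ℕ} (G : GameGraph (Fin n)) (w : Fin n → Fin n → ℤ)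
    (es : List (Fin n × Fin n)) (M : ℕ) (hn : 0 < n) (hes : IsEdgeList G es)
    (hE : G.IsEnergyBound w M) :
    ComputesEnergies RamProgram.solveEnergies (60 * (n + G.maxWeight w + M + 1) ^ 3) G w es M
      ((8 * GameCode.solveCost : ℕ) * energyTime n G.edges.card M (G.penalty w)) := by
  set c := GameCode.ofEdgeList G w es M hn hes with hc
  obtain ⟨N₀, hN₀⟩ : ∃ N₀, N₀ = n + G.maxWeight w + M + 1 := ⟨_, rfl⟩
  have hm : c.m = G.edges.card := hes.length_eq
  have hmn : c.m ≤ N₀ ^ 2 := by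
    rw [hm]
    exact (card_edges_le G).trans (Nat.pow_le_pow_left (by omega) 2)
  have h1 : N₀ ≤ N₀ ^ 3 := Nat.le_self_pow (by norm_num) _
  have h2 : N₀ ^ 2 ≤ N₀ ^ 3 := Nat.pow_le_pow_right (by omega) (by norm_num)
  -- The potential is the largest quantity to bound: `7 m (M + 2n + 1) ≤ 7 N₀ ^ 2 * 2 N₀`. The word
  -- bound then follows from `4 * 14 N₀ ^ 3 + 4 ≤ 60 N₀ ^ 3`.
  have hB : c.Bounds (14 * N₀ ^ 3) (60 * N₀ ^ 3) := by
    refine ⟨by omega, by omega, by omega, by omega, fun u v huv => ?_, ?_, ?_⟩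
    · have := G.abs_weight_le_maxWeight w huv
      change (w u v).natAbs ≤ _
      omega
    · change 3 * M + 2 * n ≤ _
      omega
    · change 7 * c.m * (M + 2 * n + 1) ≤ _
      calc 7 * c.m * (M + 2 * n + 1) ≤ 7 * N₀ ^ 2 * (2 * N₀) :=
            Nat.mul_le_mul (Nat.mul_le_mul_left _ hmn) (by omega)
        _ = 14 * N₀ ^ 3 := by ring
  obtain ⟨k₀, hk, hkM, hrun⟩ := GameCode.runsWithin_solveEnergies hB hn hE
    (GameCode.input_inputState G w es M hn hes) (GameCode.links_inputState G w es M hn hes)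
  have : Nonempty (Fin n) := ⟨⟨0, hn⟩⟩
  obtain ⟨k₁, h10, hP, hT⟩ := exists_guess_le_energyTime (m := c.m) hn
    (G.one_le_ceil_penalty w) hk hkM
  obtain ⟨t, s, hr, ht, hs⟩ := hrun k₁ h10 hP
  rw [← hN₀]
  refine ⟨t, s, hr, ?_, hs⟩
  rw [← hm]
  calc (t : ℝ) ≤ ((GameCode.solveCost * (c.m * n * (k₀ + 1) * (k₀ - k₁ + 1) +
        c.m * (M / 2 ^ k₁)) : ℕ) : ℝ) := by exact_mod_cast ht
    _ = GameCode.solveCost * ((c.m * n * (k₀ + 1) * (k₀ - k₁ + 1) +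
        c.m * (M / 2 ^ k₁) : ℕ) : ℝ) := by rw [Nat.cast_mul]
    _ ≤ GameCode.solveCost * (8 * energyTime n c.m M (G.penalty w)) :=
        mul_le_mul_of_nonneg_left hT (Nat.cast_nonneg _)
    _ = _ := by
        push_cast
        ring

theorem Polynomial.eval_natCoeff_mono (q : Polynomial ℕ) {x y : ℕ} (h : x ≤ y) :
    q.eval x ≤ q.eval y := by
  rw [eval_eq_sum_range, eval_eq_sum_range]
  exact Finset.sum_le_sum fun i _ => Nat.mul_le_mul_left _ (Nat.pow_le_pow_left h i)

/-- For `M = n W` both logarithms are bounded by the bit length of `W` plus one, and `M / ⌈P⌉ ≤ n Q`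
because `W ≤ Q P ≤ Q ⌈P⌉`. -/
theorem energyTime_le {n m W Q : ℕ} {P : ℝ≥0∞} (hn : 0 < n) (hP : 1 ≤ ENat.ceil P)
    (h : (W : ℝ≥0∞) ≤ Q * P) :
    energyTime n m (n * W) P ≤ ((m * n * (W.size + 1) ^ 2 + m * (n * Q) : ℕ) : ℝ) := by
  have hnR : (0 : ℝ) < n := by exact_mod_cast hn
  have hW : (W : ℝ) ≤ 2 ^ W.size := by exact_mod_cast (Nat.lt_size_self W).le
  have h1 : timeLog (((n * W : ℕ) : ℝ) / n) ≤ W.size + 1 := by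
    rw [Nat.cast_mul, mul_div_cancel_left₀ _ hnR.ne']
    exact timeLog_le hW (by positivity)
  have key : timeLog (((n * W : ℕ) : ℝ≥0∞) / (n * ((ENat.ceil P : ℕ∞) : ℝ≥0∞))).toReal ≤
      W.size + 1 ∧
      (((n * W : ℕ) : ℝ≥0∞) / ((ENat.ceil P : ℕ∞) : ℝ≥0∞)).toReal ≤ n * Q := by
    cases hc : ENat.ceil P with
    | top =>
      have hn' : (n : ℝ≥0∞) ≠ 0 := by exact_mod_cast hn.ne'
      constructor
      · refine timeLog_le ?_ ENNReal.toReal_nonneg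
        simp [ENNReal.mul_top hn']
      · simp
        positivity
    | coe p =>
      rw [hc] at hP
      have hp : 1 ≤ p := by exact_mod_cast hP
      have hpR : (1 : ℝ) ≤ p := by exact_mod_cast hp
      have hWp : (W : ℝ) ≤ Q * p := by
        have hPp : P ≤ (p : ℝ≥0∞) := by
          have := ENat.le_ceil_self (r := P)
          rwa [hc] at this
        have : (W : ℝ≥0∞) ≤ Q * p := h.trans (mul_le_mul_right hPp _)
        exact_mod_cast this
      constructor
      · refine timeLog_le ?_ ENNReal.toReal_nonneg
        simp only [ENat.toENNReal_coe, ENNReal.toReal_div, ENNReal.toReal_mul,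
          ENNReal.toReal_natCast, Nat.cast_mul]
        rw [mul_div_mul_left _ _ hnR.ne']
        exact (div_le_self (Nat.cast_nonneg _) hpR).trans hW
      · simp only [ENat.toENNReal_coe, ENNReal.toReal_div, ENNReal.toReal_mul,
          ENNReal.toReal_natCast, Nat.cast_mul]
        rw [div_le_iff₀ (by linarith), mul_assoc]
        exact mul_le_mul_of_nonneg_left hWp hnR.le
  rw [energyTime]
  push_cast at h1 key ⊢
  have h2 : timeLog ((n : ℝ) * W / n) * timeLog (((n : ℝ≥0∞) * W) /
      (n * ((ENat.ceil P : ℕ∞) : ℝ≥0∞))).toReal ≤ ((W.size : ℝ) + 1) * (W.size + 1) :=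
    mul_le_mul h1 key.1 (zero_le_one.trans (one_le_timeLog _)) (by positivity)
  have hmn : (0 : ℝ) ≤ m * n := by positivity
  have h3 := mul_le_mul_of_nonneg_left h2 hmn
  have h4 := mul_le_mul_of_nonneg_left key.2 (Nat.cast_nonneg m : (0 : ℝ) ≤ m)
  linarith

theorem theorem1 :
    ∃ (c : RamProgram) (K d : ℕ) (C : ℝ),
      (∀ (n : ℕ) (G : GameGraph (Fin n)) (w : Fin n → Fin n → ℤ) (es : List (Fin n × Fin n))
          (M : ℕ), 0 < n → IsEdgeList G es → G.IsEnergyBound w M →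
        ComputesEnergies c (K * (n + G.maxWeight w + M + 1) ^ d) G w es M
          (C * energyTime n G.edges.card M (G.penalty w))) ∧
      (∀ q : Polynomial ℕ, ∃ p : Polynomial ℕ, ∀ (n : ℕ) (G : GameGraph (Fin n))
          (w : Fin n → Fin n → ℤ) (es : List (Fin n × Fin n)), 0 < n → IsEdgeList G es →
        (G.maxWeight w : ℝ≥0∞) ≤ (q.eval n : ℕ) * G.penalty w →
        ComputesEnergies c (K * (n + G.maxWeight w + n * G.maxWeight w + 1) ^ d) G w es
          (n * G.maxWeight w)
          (p.eval (n + G.edges.card + Nat.size (G.maxWeight w)) : ℕ)) := by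
  refine ⟨RamProgram.solveEnergies, 60, 3, (8 * GameCode.solveCost : ℕ),
    fun n G w es M hn hes hE => computesEnergies_solveEnergies G w es M hn hes hE, fun q => ?_⟩
  -- The bound of `energyTime_le` with `n`, `m` and the size of `W` all replaced by their sum;
  -- coefficients in `ℕ` make `q` monotone.
  refine ⟨Polynomial.C (8 * GameCode.solveCost) * (Polynomial.X * Polynomial.X *
    (Polynomial.X + 1) ^ 2 + Polynomial.X * (Polynomial.X * q)), fun n G w es hn hes hW => ?_⟩
  have hE := G.isEnergyBound_card_mul_maxWeight w
  rw [Fintype.card_fin] at hE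
  obtain ⟨t, s, hr, ht, hs⟩ := computesEnergies_solveEnergies G w es _ hn hes hE
  refine ⟨t, s, hr, ht.trans ?_, hs⟩
  have : Nonempty (Fin n) := ⟨⟨0, hn⟩⟩
  have h1 := energyTime_le (m := G.edges.card) hn (G.one_le_ceil_penalty w) hW
  set x := n + G.edges.card + Nat.size (G.maxWeight w) with hx
  have h2 : G.edges.card * n * (Nat.size (G.maxWeight w) + 1) ^ 2 +
      G.edges.card * (n * q.eval n) ≤ x * x * (x + 1) ^ 2 + x * (x * q.eval x) := by
    have h3 : n ≤ x := by omega
    have h4 : G.edges.card ≤ x := by omega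
    have h5 : Nat.size (G.maxWeight w) ≤ x := by omega
    have h6 := q.eval_natCoeff_mono h3
    gcongr
  simp only [Polynomial.eval_mul, Polynomial.eval_add, Polynomial.eval_pow, Polynomial.eval_C,
    Polynomial.eval_X, Polynomial.eval_one]
  rw [Nat.cast_mul (8 * GameCode.solveCost) (x * x * (x + 1) ^ 2 + x * (x * q.eval x))]
  exact mul_le_mul_of_nonneg_left (h1.trans (by exact_mod_cast h2)) (Nat.cast_nonneg _)
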